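/- Let $d\in\mathbb N$ and $\alpha,\beta\in\mathbb R^d$ with $\alpha_i,\beta_i>-\tfrac12$ for all $i$. Let $$\mu(dx)=\prod_{i=1}^d \frac{(1-x_i)^{\alpha_i}(1+x_i)^{\beta_i}}{2^{\alpha_i+\beta_i+1}B(\alpha_i+1,\beta_i+1)}\,dx_i$$ be the Jacobi probability measure on $[-1,1]^d$. For $\kappa\in\mathbb N^d$ let $p_\kappa(x)=\prod_{i}p_{\kappa_i}^{\alpha_i,\beta_i}(x_i)$, where $p_n^{a,b}$ is the one-dimensional Jacobi polynomial of degree $n$ normalized in $L^2$ of the one-dimensional Jacobi probability measure, and let $\lambda_\kappa=\sum_i\kappa_i(\kappa_i+\alpha_i+\beta_i+1)$. For $t>0$ let $$T_tf(x)=\int_{[-1,1]^d} f(y)\sum_{\kappa\in\mathbb N^d} e^{-\lambda_\kappa t}p_\kappa(x)p_\kappa(y)\,\mu(dy)$$ be the Jacobi semigroup, let $$P_tf(x)=\int_0^\infty T_sf(x)\,\frac{t}{2\sqrt\pi}\,e^{-t^2/4s}s^{-3/2}\,ds$$ be the Poisson–Jacobi semigroup, and let $Q_tf=-t\,\partial_tP_tf$.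 (i) If $f\in L^1([-1,1]^d,\mu)$ and $\int f\,d\mu=0$, then $$f=\int_0^\infty Q_tf\,\frac{dt}{t},$$ where the integral is the improper integral $\lim_{a\to0^+,\,b\to\infty}\int_a^b Q_tf\,\frac{dt}{t}$; the limit holds both in $L^1(\mu)$ and $\mu$-almost everywhere. For $\mu$-almost every $x$, the function $t\mapsto P_tf(x)$ is differentiable on $(0,\infty)$ and $Q_tf(x)/t$ is integrable on every $[a,b]\subset(0,\infty)$. (ii) Let $f$ be a polynomial with $\int f\,d\mu=0$, let $0<\gamma<1$, and put $$C_\gamma=-\frac{1}{\gamma^2c_\gamma\Gamma(\gamma)},\qquad c_\gamma=\int_0^\infty s^{-\gamma-1}(e^{-s}-1)\,ds .$$ Then at every point of $[-1,1]^d$ $$f=C_\gamma\int_0^\infty\!\!\int_0^\infty t^{-\gamma}s^{\gamma}\,Q_t(Q_sf)\,\frac{ds}{s}\frac{dt}{t},$$ and also $$C_\gamma\int_0^\infty\!\!\int_0^\infty t^{-\gamma}s^{\gamma}\,Q_t(Q_sf)\,\frac{ds}{s}\frac{dt}{t}=\int_0^\infty u\,\frac{\partial^2}{\partial u^2}P_uf\,du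 .$$ At every point of $[-1,1]^d$ the derivatives involved exist, and the double integral and the integral over $u$ converge absolutely. -/

import Mathlib

open MeasureTheory Filter Topology Set

noncomputable section

/-- The probability measure `(1-x)^a (1+x)^b dx / (2^(a+b+1) B(a+1,b+1))` on `[-1,1]`. -/
def jacobiMeasure₁ (a b : ℝ) : Measure ℝ :=
  (volume.restrict (Icc (-1 : ℝ) 1)).withDensity fun x =>
    ENNReal.ofReal
      ((1 - x) ^ a * (1 + x) ^ b / ((2 : ℝ) ^ (a + b + 1) * ProbabilityTheory.beta (a + 1) (b + 1)))

/-- The `d`-dimensional Jacobi probability measure, a product measure carried by `[-1,1]^d`. -/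
def jacobiMeasure {d : ℕ} (α β : Fin d → ℝ) : Measure (Fin d → ℝ) :=
  Measure.pi fun i => jacobiMeasure₁ (α i) (β i)

/-- The generalized binomial coefficient `r (r-1) ⋯ (r-k+1) / k!`. -/
def realBinom (r : ℝ) (k : ℕ) : ℝ := (descPochhammer ℝ k).eval r / (k.factorial : ℝ)

/-- The classical Jacobi polynomial `P_n^{(a,b)}`. -/
def jacobiP (a b : ℝ) (n : ℕ) (x : ℝ) : ℝ :=
  ∑ k ∈ Finset.range (n + 1),
    realBinom (n + a) (n - k) * realBinom (n + b) k * ((x - 1) / 2) ^ k * ((x + 1) / 2) ^ (n - k)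

/-- Rodrigues' formula for the classical Jacobi polynomials. -/
theorem jacobiP_rodrigues (a b : ℝ) (n : ℕ) {x : ℝ} (hx : x ∈ Ioo (-1 : ℝ) 1) :
    (1 - x) ^ a * (1 + x) ^ b * jacobiP a b n x =
      (-1) ^ n / (2 ^ n * (n.factorial : ℝ)) *
        iteratedDeriv n (fun y : ℝ => (1 - y) ^ (a + n) * (1 + y) ^ (b + n)) x := by
  obtain ⟨h1, h2⟩ := hx
  have p1 : 0 < 1 - x := by linarith
  have p2 : 0 < 1 + x := by linarith
  have hc1 : ContDiffAt ℝ n (fun y : ℝ => (1 - y) ^ (a + n)) x :=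
    (contDiffAt_const.sub contDiffAt_id).rpow_const_of_ne p1.ne'
  have hc2 : ContDiffAt ℝ n (fun y : ℝ => (1 + y) ^ (b + n)) x :=
    (contDiffAt_const.add contDiffAt_id).rpow_const_of_ne p2.ne'
  have hd1 (i : ℕ) : iteratedDeriv i (fun y : ℝ => (1 - y) ^ (a + n)) x =
      (-1) ^ i * ((descPochhammer ℝ i).eval (a + n) * (1 - x) ^ (a + n - i)) := by
    have h := congrFun (iteratedDeriv_comp_const_sub i (fun y : ℝ => y ^ (a + n)) 1) x
    rw [h, iteratedDeriv_eq_iterate, Real.iter_deriv_rpow_const, smul_eq_mul]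
  have hd2 (i : ℕ) : iteratedDeriv i (fun y : ℝ => (1 + y) ^ (b + n)) x =
      (descPochhammer ℝ i).eval (b + n) * (1 + x) ^ (b + n - i) := by
    have h := congrFun (iteratedDeriv_comp_const_add i (fun y : ℝ => y ^ (b + n)) 1) x
    rw [h, iteratedDeriv_eq_iterate, Real.iter_deriv_rpow_const]
  have hmul := iteratedDeriv_mul hc1 hc2
  have hfun : (fun y : ℝ => (1 - y) ^ (a + n) * (1 + y) ^ (b + n)) =
      (fun y : ℝ => (1 - y) ^ (a + n)) * (fun y : ℝ => (1 + y) ^ (b + n)) := rfl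
  rw [hfun, hmul, ← Finset.sum_range_reflect, jacobiP, Finset.mul_sum, Finset.mul_sum]
  refine Finset.sum_congr rfl fun k hk => ?_
  obtain ⟨m, rfl⟩ := Nat.exists_eq_add_of_le (Nat.lt_succ_iff.mp (Finset.mem_range.mp hk))
  have e1 : k + m + 1 - 1 - k = m := by omega
  have e2 : k + m - m = k := by omega
  have e3 : k + m - k = m := by omega
  rw [e1, e2, e3, hd1, hd2, realBinom, realBinom]
  have r1 : a + ((k + m : ℕ) : ℝ) - m = a + k := by push_cast; ring
  have r2 : b + ((k + m : ℕ) : ℝ) - k = b + m := by push_cast; ring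
  rw [r1, r2, Real.rpow_add_natCast p1.ne', Real.rpow_add_natCast p2.ne',
    add_comm a, add_comm b]
  have hchoose : (((k + m).choose m : ℕ) : ℝ) * (k.factorial * m.factorial) =
      ((k + m).factorial : ℝ) := by
    have := Nat.add_choose_mul_factorial_mul_factorial k m
    rw [← mul_assoc]
    rw [← this]; push_cast; ring
  rw [← hchoose]
  have hk0 : (k.factorial : ℝ) ≠ 0 := by positivity
  have hm0 : (m.factorial : ℝ) ≠ 0 := by positivity
  have hch : (((k + m).choose m : ℕ) : ℝ) ≠ 0 := by
    have := Nat.choose_pos (Nat.le_add_left m k)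
    positivity
  have hs : (x - 1) ^ k = (-1) ^ k * (1 - x) ^ k := by rw [← mul_pow]; ring
  have hs2 : ((-1 : ℝ) ^ m) * (-1) ^ m = 1 := by rw [← mul_pow]; simp
  rw [div_pow, div_pow, hs, pow_add (-1 : ℝ), pow_add (2 : ℝ), add_comm x 1]
  field_simp
  linear_combination (-(descPochhammer ℝ m).eval (((k + m : ℕ) : ℝ) + a) *
    (descPochhammer ℝ k).eval (((k + m : ℕ) : ℝ) + b)) * hs2

/-- The one-dimensional Jacobi polynomial, normalized in `L²` of the Jacobi measure. -/
def jacobiPoly₁ (a b : ℝ) (n : ℕ) (x : ℝ) : ℝ :=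
  jacobiP a b n x / Real.sqrt (∫ y, jacobiP a b n y ^ 2 ∂jacobiMeasure₁ a b)

/-- The normalized `d`-dimensional Jacobi polynomial of multi-index `κ`. -/
def jacobiPoly {d : ℕ} (α β : Fin d → ℝ) (κ : Fin d → ℕ) (x : Fin d → ℝ) : ℝ :=
  ∏ i, jacobiPoly₁ (α i) (β i) (κ i) (x i)

/-- `λ_κ = ∑ κ_i (κ_i + α_i + β_i + 1)`; the Jacobi operator has the eigenvalues `-λ_κ`. -/
def jacobiEigenvalue {d : ℕ} (α β : Fin d → ℝ) (κ : Fin d → ℕ) : ℝ :=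
  ∑ i, (κ i : ℝ) * (κ i + α i + β i + 1)

/-- The kernel `p(t,x,y)` of the Jacobi semigroup (`t > 0`). -/
def jacobiKernel {d : ℕ} (α β : Fin d → ℝ) (t : ℝ) (x y : Fin d → ℝ) : ℝ :=
  ∑' κ : Fin d → ℕ,
    Real.exp (-(jacobiEigenvalue α β κ * t)) * jacobiPoly α β κ x * jacobiPoly α β κ y

/-- The Jacobi semigroup `T_t f (x)`, for `t > 0`. -/
def jacobiT {d : ℕ} (α β : Fin d → ℝ) (t : ℝ) (f : (Fin d → ℝ) → ℝ) (x : Fin d → ℝ) : ℝ :=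
  ∫ y, f y * jacobiKernel α β t x y ∂jacobiMeasure α β

/-- The density in `s` of the one-sided stable law of order `1/2` with parameter `t > 0`. -/
def stableDensity (t s : ℝ) : ℝ :=
  t / (2 * Real.sqrt Real.pi) * Real.exp (-(t ^ 2 / (4 * s))) * s ^ (-(3 / 2) : ℝ)

/-- The Poisson–Jacobi semigroup `P_t f (x)`, for `t > 0`, subordinated to the Jacobi semigroup. -/
def poissonJacobi {d : ℕ} (α β : Fin d → ℝ) (t : ℝ) (f : (Fin d → ℝ) → ℝ) (x : Fin d → ℝ) : ℝ :=
  ∫ s in Ioi (0 : ℝ), jacobiT α β s f x * stableDensity t s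

/-- `Q_t f (x) = -t ∂_t P_t f (x)`. -/
def jacobiQ {d : ℕ} (α β : Fin d → ℝ) (t : ℝ) (f : (Fin d → ℝ) → ℝ) (x : Fin d → ℝ) : ℝ :=
  -t * deriv (fun u => poissonJacobi α β u f x) t

/-- `c_γ = ∫₀^∞ s^{-γ-1} (e^{-s} - 1) ds`. -/
def fracConst (γ : ℝ) : ℝ :=
  ∫ s in Ioi (0 : ℝ), s ^ (-γ - 1) * (Real.exp (-s) - 1)

/-- `C_γ = -1 / (γ² c_γ Γ(γ))`. -/
def calderonConst (γ : ℝ) : ℝ := -1 / (γ ^ 2 * fracConst γ * Real.Gamma γ)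

end

/-! Part (i) is the fundamental theorem of calculus. Since `jacobiQ` divided by `t` is minus the
`t`-derivative of `P_t f`, its integral over `[a,b]` is `P_a f - P_b f`, and it remains to show that
`P_a f` tends to `f` at zero and `P_b f` tends to `0` at infinity, in `L¹` and almost everywhere.
For a finite combination of Jacobi polynomials without constant term both limits are visible,
because `P_t` multiplies the mode `κ` by `exp (-√λ_κ t)`. Such combinations are dense among the
mean-zero functions of `L¹`. The `L¹` limits follow because `P_t` contracts `L¹`; the almost
everywhere limits follow from a weak type `(1,1)` bound for the supremum over `t` of `|P_t f|`,
together with Borel–Cantelli.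

The maximal bound (`IsMarkovDensity.ergodicMaximal_weak_type`) is Hopf's maximal ergodic inequality
for a symmetric Markov semigroup. The stable density of order `1/2` is dominated by a sum of dyadic
averages, so the subordinated semigroup is dominated by the ergodic maximal function
(`lintegral_densityOp_stableDensity_le`).

To apply this, the Jacobi kernel must be a convergent series and nonnegative. Convergence holds
because normalized Jacobi polynomials grow at most exponentially in the degree, while `exp (-λ_κ t)`
decays like a Gaussian. Nonnegativity comes from the minimum principle for the Jacobi operator: its
resolvents preserve nonnegative polynomials, their powers converge to the semigroup, and testing the
kernel against its own negative part shows that this part vanishes (`jacobiKernel_nonneg_ae`).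

Part (ii) is a computation on each mode, with `m = √λ_κ > 0`. The double integral splits into the
Gamma integrals `m^γ Γ(1-γ)` and `m^(-γ) Γ(1+γ)`; the powers of `m` cancel and `C_γ` is the inverse
of the product of Gamma values (`calderonConst_mul`). The integral over `u` of `u m² exp (-m u)`
equals `1`. -/

noncomputable section

/-! ### Jacobi polynomials, their differential equation and the minimum principle. -/

section JacobiPolynomials

open Polynomial

/-- The classical Jacobi polynomial as an element of `ℝ[X]`. -/
def jacobiPolynomial (a b : ℝ) (n : ℕ) : ℝ[X] :=
  ∑ k ∈ Finset.range (n + 1), C (realBinom (n + a) (n - k) * realBinom (n + b) k) *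
    ((C (1 / 2) * (X - C 1)) ^ k * (C (1 / 2) * (X + C 1)) ^ (n - k))

theorem jacobiPolynomial_eval (a b : ℝ) (n : ℕ) (x : ℝ) :
    (jacobiPolynomial a b n).eval x = jacobiP a b n x := by
  simp only [jacobiPolynomial, jacobiP, eval_finsetSum, eval_mul, eval_pow, eval_C, eval_sub,
    eval_add, eval_X]
  refine Finset.sum_congr rfl fun k _ => ?_
  rw [div_eq_mul_one_div (x - 1), div_eq_mul_one_div (x + 1)]
  ring

theorem realBinom_pos {r : ℝ} {k : ℕ} (h : (k : ℝ) - 1 < r) : 0 < realBinom r k :=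
  div_pos (descPochhammer_pos h) (by positivity)

theorem realBinom_zero (r : ℝ) : realBinom r 0 = 1 := by simp [realBinom]

theorem realBinom_succ (r : ℝ) (k : ℕ) :
    realBinom r (k + 1) * (k + 1) = realBinom r k * (r - k) := by
  have : (k.factorial : ℝ) ≠ 0 := by positivity
  have h' : (k : ℝ) + 1 ≠ 0 := by positivity
  rw [realBinom, realBinom, descPochhammer_succ_eval, Nat.factorial_succ]
  push_cast
  field_simp

/-- The second-order differential operator `(1-x²) ∂² + (b-a-(a+b+2)x) ∂` on polynomials. -/
def jacobiOp (a b : ℝ) : ℝ[X] →ₗ[ℝ] ℝ[X] where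
  toFun p := (1 - X ^ 2) * derivative (derivative p) +
    (C (b - a) - C (a + b + 2) * X) * derivative p
  map_add' p q := by simp only [derivative_add]; ring
  map_smul' c p := by simp only [derivative_smul, RingHom.id_apply]; simp only [smul_eq_C_mul]; ring

theorem jacobiOp_apply (a b : ℝ) (p : ℝ[X]) : jacobiOp a b p =
    (1 - X ^ 2) * derivative (derivative p) +
      (C (b - a) - C (a + b + 2) * X) * derivative p := rfl

theorem jacobiOp_eval (a b : ℝ) (p : ℝ[X]) (x : ℝ) : (jacobiOp a b p).eval x =
    (1 - x ^ 2) * (derivative (derivative p)).eval x +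
      (b - a - (a + b + 2) * x) * (derivative p).eval x := by
  simp [jacobiOp_apply]

/-- The action of the Jacobi operator on `u ^ k * v ^ m`, `u = (x-1)/2`, `v = (x+1)/2`. -/
theorem jacobiOp_eval_monomial (a b : ℝ) (k m : ℕ) (x : ℝ) :
    (jacobiOp a b ((C (1 / 2) * (X - C 1)) ^ k * (C (1 / 2) * (X + C 1)) ^ m)).eval x =
      -(k * (k + a) * (((x - 1) / 2) ^ (k - 1) * ((x + 1) / 2) ^ (m + 1)) +
        (2 * k * m + (a + 1) * m + (b + 1) * k) * (((x - 1) / 2) ^ k * ((x + 1) / 2) ^ m) +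
        m * (m + b) * (((x - 1) / 2) ^ (k + 1) * ((x + 1) / 2) ^ (m - 1))) := by
  have e1 : (1 / 2 : ℝ) * (x - 1) = (x - 1) / 2 := by ring
  have e2 : (1 / 2 : ℝ) * (x + 1) = (x + 1) / 2 := by ring
  rw [jacobiOp_eval]
  -- Exponents `0` and `1` are separated from the rest because two differentiations lower exponents
  -- by up to two and natural subtraction truncates.
  rcases k with _ | _ | k <;> rcases m with _ | _ | m <;>
  simp [derivative_mul, derivative_pow] <;> ring

/-- With `u = (x-1)/2` and `v = (x+1)/2`, the operator maps `u^k v^m` to itself and its two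
neighbours of the same degree. The ratio of consecutive coefficients turns the neighbour terms back
into the original monomials, and the factors add up to `n(n+a+b+1)` for every `k + m = n`. -/
theorem jacobiOp_jacobiPolynomial (a b : ℝ) (n : ℕ) :
    jacobiOp a b (jacobiPolynomial a b n) =
      (-(n * (n + a + b + 1)) : ℝ) • jacobiPolynomial a b n := by
  refine Polynomial.funext fun x => ?_
  set u := (x - 1) / 2
  set v := (x + 1) / 2
  set A : ℕ → ℝ := fun k => realBinom (n + a) (n - k) * realBinom (n + b) k with hA
  have hrec : ∀ k < n, A (k + 1) * ((k + 1 : ℕ) * ((k + 1 : ℕ) + a)) =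
      A k * ((n - k : ℕ) * ((n - k : ℕ) + b)) := by
    intro k hk
    obtain ⟨m, rfl⟩ := Nat.exists_eq_add_of_lt hk
    have h1 := realBinom_succ ((k + m + 1 : ℕ) + a) m
    have h2 := realBinom_succ ((k + m + 1 : ℕ) + b) k
    have e1 : k + m + 1 - (k + 1) = m := by omega
    have e2 : k + m + 1 - k = m + 1 := by omega
    simp only [hA, e1, e2]
    push_cast at h1 h2 ⊢
    have h3 : (m : ℝ) + 1 + b = k + m + 1 + b - k := by ring
    have h4 : (k : ℝ) + 1 + a = k + m + 1 + a - m := by ring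
    rw [h3, h4]
    linear_combination realBinom (k + m + 1 + a) m * (k + m + 1 + a - m) * h2 -
      realBinom (k + m + 1 + b) k * (k + m + 1 + b - k) * h1
  have hL : (jacobiOp a b (jacobiPolynomial a b n)).eval x =
      -(∑ k ∈ Finset.range (n + 1), A k * (k * (k + a)) * (u ^ (k - 1) * v ^ (n - k + 1)) +
        ∑ k ∈ Finset.range (n + 1), A k * (2 * k * (n - k : ℕ) + (a + 1) * (n - k : ℕ)
          + (b + 1) * k) * (u ^ k * v ^ (n - k)) +
        ∑ k ∈ Finset.range (n + 1), A k * ((n - k : ℕ) * ((n - k : ℕ) + b)) *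
          (u ^ (k + 1) * v ^ (n - k - 1))) := by
    rw [jacobiPolynomial, map_sum, eval_finsetSum, ← Finset.sum_add_distrib,
      ← Finset.sum_add_distrib, ← Finset.sum_neg_distrib]
    refine Finset.sum_congr rfl fun k _ => ?_
    rw [← smul_eq_C_mul, map_smul, eval_smul, jacobiOp_eval_monomial, smul_eq_mul]
    ring
  -- The index shift loses nothing: the left term with `k = 0` and the right term with `k = n` both
  -- vanish. `hS3` is the same shift in the other direction.
  have hS1 : ∑ k ∈ Finset.range (n + 1), A k * (k * (k + a)) * (u ^ (k - 1) * v ^ (n - k + 1)) =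
      ∑ k ∈ Finset.range (n + 1), A k * ((n - k : ℕ) * ((n - k : ℕ) + b)) *
        (u ^ k * v ^ (n - k)) := by
    rw [Finset.sum_range_succ', Finset.sum_range_succ (n := n)]
    simp only [Nat.cast_zero, zero_mul, mul_zero, add_zero, Nat.sub_self]
    refine Finset.sum_congr rfl fun k hk => ?_
    have hk' := Finset.mem_range.mp hk
    rw [hrec k hk', Nat.add_sub_cancel, show n - (k + 1) + 1 = n - k by omega]
  have hS3 : ∑ k ∈ Finset.range (n + 1), A k * ((n - k : ℕ) * ((n - k : ℕ) + b)) *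
          (u ^ (k + 1) * v ^ (n - k - 1)) =
      ∑ k ∈ Finset.range (n + 1), A k * (k * (k + a)) * (u ^ k * v ^ (n - k)) := by
    rw [Finset.sum_range_succ, Finset.sum_range_succ']
    simp only [Nat.cast_zero, zero_mul, mul_zero, add_zero, Nat.sub_self]
    refine Finset.sum_congr rfl fun k hk => ?_
    have hk' := Finset.mem_range.mp hk
    rw [← hrec k hk', show n - (k + 1) = n - k - 1 by omega]
  rw [hL, hS1, hS3, eval_smul, jacobiPolynomial_eval, jacobiP, smul_eq_mul, Finset.mul_sum,
    ← Finset.sum_add_distrib, ← Finset.sum_add_distrib, ← Finset.sum_neg_distrib]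
  refine Finset.sum_congr rfl fun k hk => ?_
  have hk' : k ≤ n := Nat.lt_succ_iff.mp (Finset.mem_range.mp hk)
  simp only [hA, Nat.cast_sub hk']
  ring

theorem jacobiPolynomial_coeff_pos {a b : ℝ} (ha : -1 < a) (hb : -1 < b) {n k : ℕ} (hk : k ≤ n) :
    0 < realBinom (n + a) (n - k) * realBinom (n + b) k := by
  have h : (k : ℝ) ≤ n := by exact_mod_cast hk
  refine mul_pos (realBinom_pos ?_) (realBinom_pos ?_)
  · rw [Nat.cast_sub hk]; have : (0 : ℝ) ≤ k := by positivity
    linarith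
  · linarith

/-- Every summand is a positive multiple of a monic polynomial of degree `n`, so the leading
coefficients cannot cancel. -/
theorem jacobiPolynomial_degree {a b : ℝ} (ha : -1 < a) (hb : -1 < b) (n : ℕ) :
    (jacobiPolynomial a b n).degree = n := by
  have hterm : ∀ k ∈ Finset.range (n + 1),
      (C (realBinom (n + a) (n - k) * realBinom (n + b) k) *
        ((C (1 / 2) * (X - C 1)) ^ k * (C (1 / 2) * (X + C 1)) ^ (n - k))) =
      C (realBinom (n + a) (n - k) * realBinom (n + b) k * (1 / 2) ^ n) *
        ((X - C 1) ^ k * (X + C 1) ^ (n - k)) := by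
    intro k hk
    have hk' : k ≤ n := Nat.lt_succ_iff.mp (Finset.mem_range.mp hk)
    have : (1 / 2 : ℝ) ^ n = (1 / 2) ^ k * (1 / 2) ^ (n - k) := by
      rw [← pow_add]; congr 1; omega
    rw [this]
    simp only [C_mul, C_pow, mul_pow]
    ring
  have hmonic : ∀ k, ((X - C (1 : ℝ)) ^ k * (X + C 1) ^ (n - k)).Monic := fun k =>
    ((monic_X_sub_C 1).pow k).mul ((monic_X_add_C 1).pow (n - k))
  have hdeg : ∀ k ≤ n, ((X - C (1 : ℝ)) ^ k * (X + C 1) ^ (n - k)).natDegree = n := by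
    intro k hk
    rw [((monic_X_sub_C (1 : ℝ)).pow k).natDegree_mul ((monic_X_add_C 1).pow (n - k)),
      natDegree_pow, natDegree_pow, natDegree_X_sub_C, natDegree_X_add_C]
    omega
  rw [jacobiPolynomial, Finset.sum_congr rfl hterm]
  refine degree_eq_of_le_of_coeff_ne_zero ?_ ?_
  · refine (degree_sum_le _ _).trans (Finset.sup_le fun k hk => ?_)
    exact degree_le_of_natDegree_le ((natDegree_C_mul_le _ _).trans
      (hdeg k (Nat.lt_succ_iff.mp (Finset.mem_range.mp hk))).le)
  · rw [finsetSum_coeff]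
    refine (Finset.sum_pos (fun k hk => ?_) ⟨0, by simp⟩).ne'
    have hk' : k ≤ n := Nat.lt_succ_iff.mp (Finset.mem_range.mp hk)
    have h1 : ((X - C (1 : ℝ)) ^ k * (X + C 1) ^ (n - k)).coeff n = 1 := by
      have := (hmonic k).coeff_natDegree
      rwa [hdeg k hk'] at this
    rw [coeff_C_mul, h1, mul_one]
    exact mul_pos (jacobiPolynomial_coeff_pos ha hb hk') (by positivity)

/-- The Jacobi polynomials form a degree-indexed sequence, so they span all polynomials. -/
theorem span_jacobiPolynomial {a b : ℝ} (ha : -1 < a) (hb : -1 < b) :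
    Submodule.span ℝ (Set.range (jacobiPolynomial a b)) = ⊤ :=
  Polynomial.Sequence.span (⟨jacobiPolynomial a b, jacobiPolynomial_degree ha hb⟩ :
    Polynomial.Sequence ℝ) fun i => by
      refine IsUnit.mk0 _ (leadingCoeff_ne_zero.mpr fun h => ?_)
      have := jacobiPolynomial_degree ha hb i
      rw [show jacobiPolynomial a b i = 0 from h] at this
      simp at this

/-- The minimum principle at a point of `[-1,1]` for the Jacobi operator. -/
theorem jacobiOp_eval_nonneg_of_isMinOn {a b : ℝ} (ha : -1 < a) (hb : -1 < b) (p : ℝ[X]) {y : ℝ}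
    (hy : y ∈ Icc (-1 : ℝ) 1) (hmin : ∀ z ∈ Icc (-1 : ℝ) 1, p.eval y ≤ p.eval z) :
    0 ≤ (jacobiOp a b p).eval y := by
  have hd : ∀ z, HasDerivAt (fun z => p.eval z) ((derivative p).eval z) z := fun z =>
    p.hasDerivAt z
  rw [jacobiOp_eval]
  -- At an endpoint the second-order term vanishes and the drift, `2(b+1)` at `-1` and `-2(a+1)` at
  -- `1`, points inwards, as does the slope of a function minimal there. Inside, the first
  -- derivative vanishes and only the second-order term is left.
  rcases eq_or_lt_of_le hy.1 with h1 | h1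
  · subst h1
    have : 0 ≤ (derivative p).eval (-1) := by
      have h := (hd (-1)).hasDerivWithinAt (s := Ioi (-1))
      refine ge_of_tendsto (hasDerivWithinAt_iff_tendsto_slope' (by simp) |>.mp h) ?_
      filter_upwards [Ioo_mem_nhdsGT (show (-1 : ℝ) < 1 by norm_num)] with z hz
      rw [slope_def_field]
      exact div_nonneg (sub_nonneg.mpr (hmin z ⟨hz.1.le, hz.2.le⟩)) (by linarith [hz.1])
    have h2 : 0 ≤ (b - a - (a + b + 2) * (-1)) * (derivative p).eval (-1) :=
      mul_nonneg (by linarith) this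
    linarith
  rcases eq_or_lt_of_le hy.2 with h2 | h2
  · subst h2
    have : (derivative p).eval 1 ≤ 0 := by
      have h := (hd 1).hasDerivWithinAt (s := Iio 1)
      refine le_of_tendsto (hasDerivWithinAt_iff_tendsto_slope' (by simp) |>.mp h) ?_
      filter_upwards [Ioo_mem_nhdsLT (show (-1 : ℝ) < 1 by norm_num)] with z hz
      rw [slope_def_field]
      exact div_nonpos_of_nonneg_of_nonpos (sub_nonneg.mpr (hmin z ⟨hz.1.le, hz.2.le⟩))
        (by linarith [hz.2])
    have h3 : 0 ≤ (b - a - (a + b + 2) * 1) * (derivative p).eval 1 :=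
      mul_nonneg_of_nonpos_of_nonpos (by linarith) this
    linarith
  · have hloc : IsLocalMin (fun z => p.eval z) y := by
      filter_upwards [Icc_mem_nhds h1 h2] with z hz using hmin z hz
    have h0 : (derivative p).eval y = 0 := hloc.hasDerivAt_eq_zero (hd y)
    have h2' : 0 ≤ (derivative (derivative p)).eval y := by
      -- A negative second derivative would make `y` a local maximum as well; the polynomial would
      -- then be constant near `y`, with second derivative zero.
      by_contra! hneg
      have hder : deriv (fun z => p.eval z) = fun z => (derivative p).eval z :=
        _root_.funext fun z => (hd z).deriv
      have hmax := isLocalMax_of_deriv_deriv_neg (f := fun z => p.eval z) (x₀ := y)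
        (by rw [hder, Polynomial.deriv]; exact hneg) (by rw [hder]; exact h0)
        p.continuous.continuousAt
      have hconst : (fun z => p.eval z) =ᶠ[𝓝 y] fun _ => p.eval y := by
        filter_upwards [hloc, hmax] with z hz1 hz2 using le_antisymm hz2 hz1
      have := hconst.deriv.deriv_eq
      rw [hder, Polynomial.deriv] at this
      simp at this
      exact hneg.ne this
    rw [h0]
    have : 0 ≤ (1 - y ^ 2) * (derivative (derivative p)).eval y :=
      mul_nonneg (by nlinarith) h2'
    linarith

end JacobiPolynomials

/-! ### The one-dimensional Jacobi measure: orthogonality and size of the polynomials. -/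

section JacobiMeasureOne

/-- The density of the one-dimensional Jacobi measure. -/
def jacobiWeight (a b x : ℝ) : ℝ :=
  (1 - x) ^ a * (1 + x) ^ b / ((2 : ℝ) ^ (a + b + 1) * ProbabilityTheory.beta (a + 1) (b + 1))

theorem jacobiWeight_const_pos {a b : ℝ} (ha : -1 < a) (hb : -1 < b) :
    0 < (2 : ℝ) ^ (a + b + 1) * ProbabilityTheory.beta (a + 1) (b + 1) :=
  mul_pos (by positivity) (ProbabilityTheory.beta_pos (by linarith) (by linarith))

theorem jacobiWeight_nonneg {a b : ℝ} (ha : -1 < a) (hb : -1 < b) {x : ℝ}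
    (hx : x ∈ Icc (-1 : ℝ) 1) : 0 ≤ jacobiWeight a b x := by
  have h1 : 0 ≤ 1 - x := by linarith [hx.2]
  have h2 : 0 ≤ 1 + x := by linarith [hx.1]
  exact div_nonneg (by positivity) (jacobiWeight_const_pos ha hb).le

theorem measurable_jacobiWeight (a b : ℝ) : Measurable (jacobiWeight a b) := by
  unfold jacobiWeight
  fun_prop

theorem integrableOn_jacobiWeight {a b : ℝ} (ha : -1 < a) (hb : -1 < b) :
    IntegrableOn (jacobiWeight a b) (Icc (-1 : ℝ) 1) := by
  -- Splitting at `0` leaves only one possibly singular factor on each half.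
  have h1 : IntervalIntegrable (fun x : ℝ => (1 - x) ^ a * (1 + x) ^ b) volume (-1) 0 := by
    have := (intervalIntegral.intervalIntegrable_rpow' (a := 0) (b := 1) hb).comp_add_left 1
    norm_num at this
    refine this.continuousOn_mul fun x hx => ?_
    rw [uIcc_of_le (by norm_num)] at hx
    exact ContinuousAt.continuousWithinAt
      ((continuousAt_const.sub continuousAt_id).rpow_const (Or.inl (by simp; linarith [hx.2])))
  have h2 : IntervalIntegrable (fun x : ℝ => (1 - x) ^ a * (1 + x) ^ b) volume 0 1 := by
    have := (intervalIntegral.intervalIntegrable_rpow' (a := 1) (b := 0) ha).comp_sub_left 1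
    norm_num at this
    refine this.mul_continuousOn fun x hx => ?_
    rw [uIcc_of_le (by norm_num)] at hx
    exact ContinuousAt.continuousWithinAt
      ((continuousAt_const.add continuousAt_id).rpow_const (Or.inl (by simp; linarith [hx.1])))
  have h3 := (intervalIntegrable_iff_integrableOn_Icc_of_le (by norm_num)).mp (h1.trans h2)
  exact h3.div_const _

theorem jacobiMeasure₁_eq (a b : ℝ) : jacobiMeasure₁ a b =
    (volume.restrict (Icc (-1 : ℝ) 1)).withDensity fun x => ENNReal.ofReal (jacobiWeight a b x) :=
  rfl

theorem isFiniteMeasure_jacobiMeasure₁ {a b : ℝ} (ha : -1 < a) (hb : -1 < b) :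
    IsFiniteMeasure (jacobiMeasure₁ a b) := by
  rw [jacobiMeasure₁_eq]
  exact isFiniteMeasure_withDensity_ofReal (integrableOn_jacobiWeight ha hb).2

theorem ae_mem_jacobiMeasure₁ (a b : ℝ) : ∀ᵐ x ∂jacobiMeasure₁ a b, x ∈ Icc (-1 : ℝ) 1 :=
  (withDensity_absolutelyContinuous _ _).ae_le (ae_restrict_mem measurableSet_Icc)

theorem integral_jacobiMeasure₁ {a b : ℝ} (ha : -1 < a) (hb : -1 < b) (f : ℝ → ℝ) :
    ∫ x, f x ∂jacobiMeasure₁ a b = ∫ x in (-1 : ℝ)..1, jacobiWeight a b x * f x := by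
  rw [jacobiMeasure₁_eq, integral_withDensity_eq_integral_toReal_smul
    (measurable_jacobiWeight a b).ennreal_ofReal (by simp),
    intervalIntegral.integral_of_le (by norm_num), ← integral_Icc_eq_integral_Ioc]
  refine setIntegral_congr_fun measurableSet_Icc fun x hx => ?_
  simp [ENNReal.toReal_ofReal (jacobiWeight_nonneg ha hb hx)]

-- Symmetry of the operator: the weighted integrand is the derivative of `(1-x)^(a+1) (1+x)^(b+1)
-- (p'q - pq')` up to the normalization, and this boundary term vanishes at both ends because `a, b
-- > -1`.
open Polynomial in
theorem integral_jacobiOp_mul_sub {a b : ℝ} (ha : -1 < a) (hb : -1 < b) (p q : ℝ[X]) :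
    ∫ x, ((jacobiOp a b p).eval x * q.eval x - p.eval x * (jacobiOp a b q).eval x)
      ∂jacobiMeasure₁ a b = 0 := by
  set Z := (2 : ℝ) ^ (a + b + 1) * ProbabilityTheory.beta (a + 1) (b + 1) with hZ
  set r := derivative p * q - p * derivative q with hr
  have hder : ∀ x ∈ Ioo (-1 : ℝ) 1,
      HasDerivAt (fun x => (1 - x) ^ (a + 1) * (1 + x) ^ (b + 1) / Z * r.eval x)
        (jacobiWeight a b x *
          ((jacobiOp a b p).eval x * q.eval x - p.eval x * (jacobiOp a b q).eval x)) x := by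
    intro x hx
    have p1 : 0 < 1 - x := by linarith [hx.2]
    have p2 : 0 < 1 + x := by linarith [hx.1]
    have d1 := ((hasDerivAt_id x).const_sub 1).rpow_const (p := a + 1) (Or.inl p1.ne')
    have d2 := ((hasDerivAt_id x).const_add 1).rpow_const (p := b + 1) (Or.inl p2.ne')
    have d3 := ((d1.mul d2).div_const Z).mul (r.hasDerivAt x)
    refine d3.congr_deriv ?_
    simp only [id, Pi.mul_apply, hr, jacobiOp_eval, jacobiWeight, ← hZ, derivative_sub,
      derivative_mul, eval_sub, eval_mul, eval_add, add_sub_cancel_right,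
      Real.rpow_add_one p1.ne', Real.rpow_add_one p2.ne']
    ring
  have hcont : ContinuousOn (fun x => (1 - x) ^ (a + 1) * (1 + x) ^ (b + 1) / Z * r.eval x)
      (Icc (-1 : ℝ) 1) := by
    refine Continuous.continuousOn ?_
    have c1 : Continuous fun x : ℝ => (1 - x) ^ (a + 1) :=
      (continuous_const.sub continuous_id).rpow_const fun _ => Or.inr (by linarith)
    have c2 : Continuous fun x : ℝ => (1 + x) ^ (b + 1) :=
      (continuous_const.add continuous_id).rpow_const fun _ => Or.inr (by linarith)
    exact ((c1.mul c2).div_const Z).mul r.continuous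
  have hint : IntervalIntegrable (fun x => jacobiWeight a b x *
      ((jacobiOp a b p).eval x * q.eval x - p.eval x * (jacobiOp a b q).eval x)) volume (-1) 1 := by
    refine IntervalIntegrable.mul_continuousOn
      ((intervalIntegrable_iff_integrableOn_Icc_of_le (by norm_num)).mpr
        (integrableOn_jacobiWeight ha hb)) (Continuous.continuousOn ?_)
    fun_prop
  rw [integral_jacobiMeasure₁ ha hb,
    intervalIntegral.integral_eq_sub_of_hasDerivAt_of_le (by norm_num) hcont hder hint]
  have h1 : (0 : ℝ) ^ (a + 1) = 0 := Real.zero_rpow (by linarith)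
  have h2 : (0 : ℝ) ^ (b + 1) = 0 := Real.zero_rpow (by linarith)
  simp [h1, h2]

-- By symmetry the integral is killed by the difference of the two eigenvalues, `(n-m)(n+m+a+b+1)`;
-- the second factor is positive since `a + b + 1 > 0`.
open Polynomial in
theorem integral_jacobiP_mul_of_ne {a b : ℝ} (ha : -(1 / 2) < a) (hb : -(1 / 2) < b) {m n : ℕ}
    (hmn : m ≠ n) : ∫ x, jacobiP a b m x * jacobiP a b n x ∂jacobiMeasure₁ a b = 0 := by
  have h := integral_jacobiOp_mul_sub (a := a) (b := b) (by linarith) (by linarith)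
    (jacobiPolynomial a b m) (jacobiPolynomial a b n)
  simp only [jacobiOp_jacobiPolynomial, eval_smul, jacobiPolynomial_eval, smul_eq_mul] at h
  have h' : ∀ x, -(↑m * (↑m + a + b + 1)) * jacobiP a b m x * jacobiP a b n x -
      jacobiP a b m x * (-(↑n * (↑n + a + b + 1)) * jacobiP a b n x) =
      ((n - m) * (n + m + a + b + 1)) * (jacobiP a b m x * jacobiP a b n x) := fun x => by ring
  simp only [h', integral_const_mul, mul_eq_zero, sub_eq_zero] at h
  rcases h with (h | h) | h
  · exact absurd (by exact_mod_cast h.symm) hmn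
  · have : (0 : ℝ) ≤ n := by positivity
    have : (0 : ℝ) ≤ m := by positivity
    linarith
  · exact h

/-- The falling factorial is monotone on this range, so `a` may be raised to the integer `N` and an
ordinary binomial coefficient bounds the value. -/
theorem realBinom_le {a : ℝ} (ha : -1 < a) {N n m : ℕ} (hN : a ≤ N) (hm : m ≤ n) :
    realBinom (n + a) m ≤ 2 ^ (n + N) := by
  have hm' : (m : ℝ) ≤ n := by exact_mod_cast hm
  have h1 : realBinom (n + a) m ≤ (((n + N).choose m : ℕ) : ℝ) := by
    rw [realBinom, Nat.cast_choose_eq_descPochhammer_div]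
    refine div_le_div_of_nonneg_right ?_ (by positivity)
    refine monotoneOn_descPochhammer_eval m ?_ ?_ ?_
    · change (m : ℝ) - 1 ≤ n + a; linarith
    · have : (0 : ℝ) ≤ N := by positivity
      change (m : ℝ) - 1 ≤ (n + N : ℕ); push_cast; linarith
    · push_cast; linarith
  exact h1.trans (by exact_mod_cast Nat.choose_le_two_pow _ _)

/-- The value is the product of `(j+1+a)/(j+1)` over `j < n`, and `a > -1/2` makes each factor at
least `1/2`. -/
theorem realBinom_ge {a : ℝ} (ha : -(1 / 2) < a) (n : ℕ) :
    (1 / 2 : ℝ) ^ n ≤ realBinom (n + a) n := by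
  rw [realBinom, descPochhammer_eval_eq_prod_range, ← Finset.prod_range_reflect,
    ← Finset.prod_range_add_one_eq_factorial]
  push_cast
  have hprod : (1 / 2 : ℝ) ^ n = ∏ _j ∈ Finset.range n, (1 / 2 : ℝ) := by simp
  rw [← Finset.prod_div_distrib, hprod]
  refine Finset.prod_le_prod (fun _ _ => by positivity) fun j hj => ?_
  have hj' : j + 1 ≤ n := Finset.mem_range.mp hj
  rw [div_le_div_iff₀ (by positivity) (by positivity),
    show n - 1 - j = n - (j + 1) by omega, Nat.cast_sub hj']
  push_cast
  have : (0 : ℝ) ≤ j := by positivity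
  linarith

theorem abs_jacobiP_le {a b : ℝ} (ha : -1 < a) (hb : -1 < b) {N : ℕ} (haN : a ≤ N)
    (hbN : b ≤ N) (n : ℕ) {x : ℝ} (hx : x ∈ Icc (-1 : ℝ) 1) :
    |jacobiP a b n x| ≤ 2 ^ n * (2 ^ (n + N) * 2 ^ (n + N)) := by
  have hu : |(x - 1) / 2| ≤ 1 := by rw [abs_le]; constructor <;> linarith [hx.1, hx.2]
  have hv : |(x + 1) / 2| ≤ 1 := by rw [abs_le]; constructor <;> linarith [hx.1, hx.2]
  calc |jacobiP a b n x| ≤ ∑ k ∈ Finset.range (n + 1), (2 ^ (n + N) * 2 ^ (n + N) : ℝ) := by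
        refine (Finset.abs_sum_le_sum_abs _ _).trans (Finset.sum_le_sum fun k hk => ?_)
        have hk' : k ≤ n := Nat.lt_succ_iff.mp (Finset.mem_range.mp hk)
        rw [abs_mul, abs_mul, abs_of_pos (jacobiPolynomial_coeff_pos ha hb hk'), abs_pow, abs_pow]
        have hA : realBinom (n + a) (n - k) * realBinom (n + b) k ≤ 2 ^ (n + N) * 2 ^ (n + N) :=
          mul_le_mul (realBinom_le ha haN (Nat.sub_le _ _)) (realBinom_le hb hbN hk')
            (realBinom_pos (by have : (k : ℝ) ≤ n := by exact_mod_cast hk'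
                               linarith)).le (by positivity)
        calc _ ≤ (2 ^ (n + N) * 2 ^ (n + N) : ℝ) * 1 * 1 := by
              gcongr
              · exact pow_le_one₀ (abs_nonneg _) hu
              · exact pow_le_one₀ (abs_nonneg _) hv
          _ = _ := by ring
    _ = (n + 1 : ℕ) * (2 ^ (n + N) * 2 ^ (n + N) : ℝ) := by simp
    _ ≤ _ := by
        gcongr
        exact_mod_cast Nat.lt_two_pow_self

/-- Near `x = 1` the term `k = 0` dominates. It is at least `(1/2)^n / 2` by Bernoulli's inequality;
all others carry a factor `|(x-1)/2| ≤ δ/2`. The choice `δ = 16^(-(n+N+1))` outweighs the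
coefficients, at most `4^(n+N)`, and the number of terms, at most `2^n`. -/
theorem jacobiP_ge_near_one {a b : ℝ} (ha : -(1 / 2) < a) (hb : -(1 / 2) < b) {N : ℕ}
    (haN : a ≤ N) (hbN : b ≤ N) (n : ℕ) {x : ℝ} (hx : x ∈ Icc (1 - (1 / 16 : ℝ) ^ (n + N + 1)) 1) :
    (1 / 2 : ℝ) ^ n / 4 ≤ jacobiP a b n x := by
  set δ : ℝ := (1 / 16 : ℝ) ^ (n + N + 1) with hδ
  have hδ1 : δ ≤ 1 := pow_le_one₀ (by norm_num) (by norm_num)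
  have hδ0 : 0 ≤ δ := by positivity
  have hn : (n : ℝ) ≤ 2 ^ n := by exact_mod_cast Nat.lt_two_pow_self.le
  have hδn : n * δ ≤ 1 / 16 := by
    calc n * δ ≤ 2 ^ n * ((1 / 16) ^ n * (1 / 16) ^ 1) := by
          rw [hδ, show n + N + 1 = (n + 1) + N by ring, pow_add, pow_add]
          refine mul_le_mul hn ?_ (by positivity) (by positivity)
          exact mul_le_of_le_one_right (by positivity) (pow_le_one₀ (by norm_num) (by norm_num))
      _ = (1 / 8) ^ n * (1 / 16) := by rw [← mul_assoc, ← mul_pow]; norm_num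
      _ ≤ 1 * (1 / 16) := by gcongr; exact pow_le_one₀ (by norm_num) (by norm_num)
      _ = _ := by norm_num
  have hu0 : |(x - 1) / 2| ≤ δ / 2 := by rw [abs_le]; constructor <;> linarith [hx.1, hx.2]
  have hu : |(x - 1) / 2| ≤ 1 := by linarith
  have hv : |(x + 1) / 2| ≤ 1 := by rw [abs_le]; constructor <;> linarith [hx.1, hx.2]
  have hA0 : (1 / 2 : ℝ) ^ n ≤ realBinom (n + a) n := realBinom_ge ha n
  have hv0 : 1 / 2 ≤ ((x + 1) / 2) ^ n := by
    have h := one_add_mul_le_pow (a := (x - 1) / 2) (by linarith [(abs_le.mp hu).1]) n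
    have h1 : (n : ℝ) * -(δ / 2) ≤ n * ((x - 1) / 2) :=
      mul_le_mul_of_nonneg_left (abs_le.mp hu0).1 (by positivity)
    rw [show 1 + (x - 1) / 2 = (x + 1) / 2 by ring] at h
    linarith
  rw [jacobiP, Finset.sum_range_succ']
  have htail : |∑ k ∈ Finset.range n, realBinom (n + a) (n - (k + 1)) * realBinom (n + b) (k + 1) *
      ((x - 1) / 2) ^ (k + 1) * ((x + 1) / 2) ^ (n - (k + 1))| ≤ (1 / 2) ^ n / 4 := by
    calc _ ≤ ∑ k ∈ Finset.range n, (2 ^ (n + N) * 2 ^ (n + N) : ℝ) * (δ / 2) := by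
          refine (Finset.abs_sum_le_sum_abs _ _).trans (Finset.sum_le_sum fun k hk => ?_)
          have hk' : k + 1 ≤ n := Finset.mem_range.mp hk
          rw [abs_mul, abs_mul, abs_of_pos (jacobiPolynomial_coeff_pos (by linarith)
            (by linarith) hk'), abs_pow, abs_pow]
          have hA : realBinom (n + a) (n - (k + 1)) * realBinom (n + b) (k + 1) ≤
              2 ^ (n + N) * 2 ^ (n + N) :=
            mul_le_mul (realBinom_le (by linarith) haN (Nat.sub_le _ _))
              (realBinom_le (by linarith) hbN hk')
              (realBinom_pos (by have : ((k + 1 : ℕ) : ℝ) ≤ n := by exact_mod_cast hk'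
                                 linarith)).le (by positivity)
          calc _ ≤ (2 ^ (n + N) * 2 ^ (n + N) : ℝ) * (δ / 2) * 1 := by
                gcongr
                · rw [pow_succ]
                  calc _ ≤ 1 * |(x - 1) / 2| := by
                        gcongr; exact pow_le_one₀ (abs_nonneg _) hu
                    _ ≤ _ := by rw [one_mul]; exact hu0
                · exact pow_le_one₀ (abs_nonneg _) hv
            _ = _ := by ring
      _ = n * ((2 ^ (n + N) * 2 ^ (n + N) : ℝ) * (δ / 2)) := by simp
      _ ≤ 2 ^ n * ((2 ^ (n + N) * 2 ^ (n + N) : ℝ) * (δ / 2)) := by gcongr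
      _ = (2 ^ n * 4 ^ n * (1 / 16) ^ n) * (4 ^ N * (1 / 16) ^ N) / 32 := by
          rw [← mul_pow, hδ, pow_succ, pow_add (1 / 16 : ℝ), show (2 * 2 : ℝ) = 4 by norm_num,
            pow_add (4 : ℝ)]
          ring
      _ = (1 / 2) ^ n * (1 / 4) ^ N / 32 := by
          rw [← mul_pow, ← mul_pow, ← mul_pow]; norm_num
      _ ≤ (1 / 2) ^ n * 1 / 32 := by
          gcongr; exact pow_le_one₀ (by norm_num) (by norm_num)
      _ ≤ _ := by
          have : (0 : ℝ) < (1 / 2) ^ n := by positivity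
          linarith
  have hmain : (1 / 2 : ℝ) ^ n * (1 / 2) ≤ realBinom (n + a) (n - 0) * realBinom (n + b) 0 *
      ((x - 1) / 2) ^ 0 * ((x + 1) / 2) ^ (n - 0) := by
    rw [realBinom_zero, pow_zero, Nat.sub_zero, mul_one, mul_one]
    exact mul_le_mul hA0 hv0 (by positivity) ((by positivity : (0 : ℝ) ≤ (1 / 2) ^ n).trans hA0)
  linarith [(abs_le.mp htail).1]

/-- An exponential lower bound for the norms of the Jacobi polynomials. -/
theorem exists_integral_jacobiP_sq_ge {a b : ℝ} (ha : -(1 / 2) < a) (hb : -(1 / 2) < b) :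
    ∃ c ρ : ℝ, 0 < c ∧ 0 < ρ ∧
      ∀ n, c * ρ ^ n ≤ ∫ x, jacobiP a b n x ^ 2 ∂jacobiMeasure₁ a b := by
  have ha' : -1 < a := by linarith
  have hb' : -1 < b := by linarith
  obtain ⟨N, hN⟩ := exists_nat_ge (max |a| |b|)
  have haN : |a| ≤ N := (le_max_left _ _).trans hN
  have hbN : |b| ≤ N := (le_max_right _ _).trans hN
  set Z := (2 : ℝ) ^ (a + b + 1) * ProbabilityTheory.beta (a + 1) (b + 1) with hZ
  have hZ0 : 0 < Z := jacobiWeight_const_pos ha' hb'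
  set q : ℝ := (1 / 16 : ℝ) ^ (N + 1) with hq
  -- The constants come from multiplying three lower bounds on `[1-δ, 1-δ/2]`, with `δ = q 16^(-n)`:
  -- the weight is at least `(δ/2)^N (1/2)^N / Z`, the square of the polynomial at least `((1/2)^n /
  -- 4)²`, the length is `δ/2`. The interval stays away from `1`, where the weight may degenerate.
  refine ⟨(q / 2) ^ N * (1 / 2) ^ N / Z * (1 / 16) * (q / 2),
    ((1 / 16) ^ N) * (1 / 4) * (1 / 16), by positivity, by positivity, fun n => ?_⟩
  set δ : ℝ := (1 / 16 : ℝ) ^ (n + N + 1) with hδ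
  have hδ0 : 0 < δ := by positivity
  have hδ1 : δ ≤ 1 := pow_le_one₀ (by norm_num) (by norm_num)
  have hδq : δ = q * (1 / 16) ^ n := by rw [hδ, hq, ← pow_add]; congr 1; ring
  have hpow : ∀ y : ℝ, ∀ e : ℝ, 0 < y → y ≤ 1 → |e| ≤ N → y ^ N ≤ y ^ e := by
    intro y e h0 h1 he
    rw [← Real.rpow_natCast]
    exact Real.rpow_le_rpow_of_exponent_ge h0 h1 ((le_abs_self e).trans he)
  have hpow2 : ∀ y : ℝ, ∀ e : ℝ, 1 ≤ y → y ≤ 2 → |e| ≤ N → (1 / 2 : ℝ) ^ N ≤ y ^ e := by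
    intro y e h0 h1 he
    have : (y⁻¹) ^ N ≤ y ^ e := by
      rw [← Real.rpow_natCast, Real.inv_rpow (by linarith), ← Real.rpow_neg (by linarith)]
      exact Real.rpow_le_rpow_of_exponent_le h0 (by linarith [neg_abs_le e])
    refine le_trans ?_ this
    gcongr
    rw [one_div]
    exact inv_anti₀ (by linarith) h1
  have hsub : Icc (1 - δ) (1 - δ / 2) ⊆ Icc (-1) 1 :=
    Icc_subset_Icc (by linarith) (by linarith)
  have hpt : ∀ x ∈ Icc (1 - δ) (1 - δ / 2),
      ((δ / 2) ^ N * (1 / 2) ^ N / Z) * ((1 / 2) ^ n / 4) ^ 2 ≤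
        jacobiWeight a b x * jacobiP a b n x ^ 2 := by
    intro x hx
    have hy0 : 0 < 1 - x := by linarith [hx.2]
    have hP := jacobiP_ge_near_one ha hb ((le_abs_self a).trans haN) ((le_abs_self b).trans hbN) n
      (x := x) ⟨hx.1, by linarith⟩
    unfold jacobiWeight
    gcongr
    · exact jacobiWeight_nonneg ha' hb' (hsub hx)
    · refine le_trans ?_ (hpow (1 - x) a hy0 (by linarith [hx.1]) haN)
      gcongr
      linarith [hx.2]
    · exact hpow2 (1 + x) b (by linarith [hx.1]) (by linarith) hbN
  have hcontP : Continuous fun x => jacobiP a b n x ^ 2 := by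
    simp only [← jacobiPolynomial_eval]; fun_prop
  have hint : IntegrableOn (fun x => jacobiWeight a b x * jacobiP a b n x ^ 2) (Icc (-1) 1) :=
    (integrableOn_jacobiWeight ha' hb').mul_continuousOn hcontP.continuousOn isCompact_Icc
  rw [integral_jacobiMeasure₁ ha' hb', intervalIntegral.integral_of_le (by norm_num),
    ← integral_Icc_eq_integral_Ioc]
  calc _ = ((δ / 2) ^ N * (1 / 2) ^ N / Z) * ((1 / 2) ^ n / 4) ^ 2 * (δ / 2) := by
        rw [hδq, show (1 / 16 : ℝ) ^ N * (1 / 4) * (1 / 16) =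
          (1 / 16 : ℝ) ^ N * ((1 / 2) ^ 2 * (1 / 16)) by ring, mul_pow, mul_pow (((1 : ℝ) / 2) ^ 2),
          ← pow_mul, ← pow_mul, mul_comm 2 n, mul_comm N n, pow_mul ((1 : ℝ) / 16) n N]
        field_simp
        ring
    _ = ∫ x in Icc (1 - δ) (1 - δ / 2),
          ((δ / 2) ^ N * (1 / 2) ^ N / Z) * ((1 / 2) ^ n / 4) ^ 2 := by
        rw [setIntegral_const, smul_eq_mul, measureReal_def, Real.volume_Icc, ENNReal.toReal_ofReal
          (by linarith)]
        ring
    _ ≤ ∫ x in Icc (1 - δ) (1 - δ / 2), jacobiWeight a b x * jacobiP a b n x ^ 2 :=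
        setIntegral_mono_on (integrableOn_const (by simp)) (hint.mono_set hsub)
          measurableSet_Icc hpt
    _ ≤ _ := setIntegral_mono_set hint (by
        filter_upwards [ae_restrict_mem measurableSet_Icc] with x hx
        exact mul_nonneg (jacobiWeight_nonneg ha' hb' hx) (sq_nonneg _)) hsub.eventuallyLE

theorem integral_jacobiP_sq_pos {a b : ℝ} (ha : -(1 / 2) < a) (hb : -(1 / 2) < b) (n : ℕ) :
    0 < ∫ x, jacobiP a b n x ^ 2 ∂jacobiMeasure₁ a b := by
  obtain ⟨c, ρ, hc, hρ, h⟩ := exists_integral_jacobiP_sq_ge ha hb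
  exact lt_of_lt_of_le (by positivity) (h n)

/-- The normalized Jacobi polynomials grow at most exponentially on `[-1,1]`. -/
theorem exists_abs_jacobiPoly₁_le {a b : ℝ} (ha : -(1 / 2) < a) (hb : -(1 / 2) < b) :
    ∃ C R : ℝ, 0 < C ∧ 0 < R ∧ ∀ n, ∀ x ∈ Icc (-1 : ℝ) 1, |jacobiPoly₁ a b n x| ≤ C * R ^ n := by
  obtain ⟨c, ρ, hc, hρ, h⟩ := exists_integral_jacobiP_sq_ge ha hb
  obtain ⟨N, hN⟩ := exists_nat_ge (max a b)
  refine ⟨4 ^ N / √c, 8 / √ρ, by positivity, by positivity, fun n x hx => ?_⟩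
  have hs : √c * √ρ ^ n ≤ √(∫ x, jacobiP a b n x ^ 2 ∂jacobiMeasure₁ a b) := by
    refine Real.le_sqrt_of_sq_le ((le_of_eq ?_).trans (h n))
    rw [mul_pow, ← pow_mul, mul_comm n 2, pow_mul, Real.sq_sqrt hc.le, Real.sq_sqrt hρ.le]
  rw [jacobiPoly₁, abs_div, abs_of_nonneg (Real.sqrt_nonneg _)]
  calc _ ≤ (2 ^ n * (2 ^ (n + N) * 2 ^ (n + N))) / (√c * √ρ ^ n) := by
        gcongr
        exact abs_jacobiP_le (by linarith) (by linarith) ((le_max_left _ _).trans hN)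
          ((le_max_right _ _).trans hN) n hx
    _ = 4 ^ N / √c * (8 / √ρ) ^ n := by
        rw [← mul_pow, pow_add, show (2 * 2 : ℝ) = 4 by norm_num, div_pow,
          show (8 : ℝ) = 2 * 4 by norm_num, mul_pow]
        field_simp

theorem continuous_jacobiPoly₁ (a b : ℝ) (n : ℕ) : Continuous (jacobiPoly₁ a b n) := by
  unfold jacobiPoly₁
  simp only [← jacobiPolynomial_eval]
  fun_prop

theorem integral_jacobiPoly₁_mul {a b : ℝ} (ha : -(1 / 2) < a) (hb : -(1 / 2) < b) (m n : ℕ) :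
    ∫ x, jacobiPoly₁ a b m x * jacobiPoly₁ a b n x ∂jacobiMeasure₁ a b = if m = n then 1 else 0 := by
  simp only [jacobiPoly₁, div_mul_div_comm, integral_div]
  split_ifs with h
  · subst h
    have := integral_jacobiP_sq_pos ha hb m
    rw [Real.mul_self_sqrt this.le, div_eq_one_iff_eq this.ne']
    simp only [sq]
  · rw [integral_jacobiP_mul_of_ne ha hb h, zero_div]

end JacobiMeasureOne

/-! ### The stable density of order `1/2`, subordination and the constants. -/

section StableDensity

/-- The primitive of the Gaussian that vanishes at `0`. -/
def gaussPrimitive (z : ℝ) : ℝ := ∫ w in (0 : ℝ)..z, Real.exp (-w ^ 2)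

theorem hasDerivAt_gaussPrimitive (z : ℝ) : HasDerivAt gaussPrimitive (Real.exp (-z ^ 2)) z :=
  ((by fun_prop : Continuous fun w : ℝ => Real.exp (-w ^ 2)).integral_hasStrictDerivAt 0 z).hasDerivAt

theorem tendsto_gaussPrimitive_atTop : Tendsto gaussPrimitive atTop (𝓝 (√Real.pi / 2)) := by
  have h := intervalIntegral_tendsto_integral_Ioi (μ := volume) (f := fun w : ℝ => Real.exp (-1 * w ^ 2)) 0
    (integrable_exp_neg_mul_sq one_pos).integrableOn tendsto_id
  rw [integral_gaussian_Ioi, div_one] at h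
  simp only [neg_one_mul, id] at h
  exact h

theorem gaussPrimitive_neg (z : ℝ) : gaussPrimitive (-z) = -gaussPrimitive z := by
  have h := intervalIntegral.integral_comp_neg (a := 0) (b := z) fun w : ℝ => Real.exp (-w ^ 2)
  simp only [even_two.neg_pow, neg_zero] at h
  rw [gaussPrimitive, intervalIntegral.integral_symm, ← h, gaussPrimitive]

theorem tendsto_gaussPrimitive_atBot : Tendsto gaussPrimitive atBot (𝓝 (-(√Real.pi / 2))) := by
  have h := (tendsto_gaussPrimitive_atTop.comp tendsto_neg_atBot_atTop).neg
  refine h.congr fun z => ?_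
  simp [gaussPrimitive_neg]

theorem stableDensity_nonneg {t s : ℝ} (ht : 0 < t) (hs : 0 < s) : 0 ≤ stableDensity t s := by
  unfold stableDensity; positivity

theorem measurable_stableDensity (t : ℝ) : Measurable (stableDensity t) := by
  unfold stableDensity
  fun_prop

/-- Subordination: the Laplace transform of the one-sided stable law of order `1/2`. -/
theorem stableDensity_laplace {t m : ℝ} (ht : 0 < t) (hm : 0 ≤ m) :
    IntegrableOn (fun s => Real.exp (-(m ^ 2 * s)) * stableDensity t s) (Ioi 0) ∧
      ∫ s in Ioi (0 : ℝ), Real.exp (-(m ^ 2 * s)) * stableDensity t s = Real.exp (-(m * t)) := by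
  have hpi : 0 < √Real.pi := Real.sqrt_pos.mpr Real.pi_pos
  -- An explicit primitive, found by completing the square in two ways: `m² s + t²/(4s)` equals
  -- `(m√s ± t/(2√s))² ∓ m t`. In the derivative the terms `m/√s` of the two parts cancel.
  set Φ : ℝ → ℝ := fun s => (Real.exp (m * t) * gaussPrimitive (-(t / (2 * √s) + m * √s)) +
    Real.exp (-(m * t)) * gaussPrimitive (m * √s - t / (2 * √s))) / √Real.pi with hΦ
  set L0 : ℝ := (Real.exp (m * t) * (-(√Real.pi / 2)) + Real.exp (-(m * t)) * (-(√Real.pi / 2))) /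
    √Real.pi with hL0
  have hder : ∀ s ∈ Ioi (0 : ℝ),
      HasDerivAt Φ (Real.exp (-(m ^ 2 * s)) * stableDensity t s) s := by
    intro s hs
    have hs' : 0 < √s := Real.sqrt_pos.mpr hs
    have d0 := Real.hasDerivAt_sqrt (ne_of_gt hs)
    have dinv : HasDerivAt (fun s => t / (2 * √s)) (-(t / (4 * (s * √s)))) s := by
      refine ((hasDerivAt_const s t).div (d0.const_mul 2) (by positivity)).congr_deriv ?_
      have hs0 : s ≠ 0 := ne_of_gt hs
      have := Real.sq_sqrt (le_of_lt hs)
      field_simp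
      rw [this]; field_simp; ring
    have d1 := (hasDerivAt_gaussPrimitive _).comp s (dinv.add (d0.const_mul m)).neg
    have d2 := (hasDerivAt_gaussPrimitive _).comp s ((d0.const_mul m).sub dinv)
    refine (((d1.const_mul (Real.exp (m * t))).add
      (d2.const_mul (Real.exp (-(m * t))))).div_const (√Real.pi)).congr_deriv ?_
    have hpow : s ^ (-(3 / 2) : ℝ) = 1 / (s * √s) := by
      rw [Real.rpow_neg (le_of_lt hs), show (3 / 2 : ℝ) = 1 + 1 / 2 by norm_num,
        Real.rpow_add hs, Real.rpow_one, ← Real.sqrt_eq_rpow, one_div]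
    have hsq := Real.sq_sqrt (le_of_lt hs)
    have hA : Real.exp (m * t) * Real.exp (-(-(t / (2 * √s) + m * √s)) ^ 2) =
        Real.exp (-(m ^ 2 * s)) * Real.exp (-(t ^ 2 / (4 * s))) := by
      rw [← Real.exp_add, ← Real.exp_add]; congr 1
      rw [← hsq]; field_simp; rw [Real.sqrt_sq hs'.le]; ring
    have hB : Real.exp (-(m * t)) * Real.exp (-(m * √s - t / (2 * √s)) ^ 2) =
        Real.exp (-(m ^ 2 * s)) * Real.exp (-(t ^ 2 / (4 * s))) := by
      rw [← Real.exp_add, ← Real.exp_add]; congr 1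
      rw [← hsq]; field_simp; rw [Real.sqrt_sq hs'.le]; ring
    simp only [Pi.add_apply, Pi.neg_apply, Pi.sub_apply]
    rw [← mul_assoc (Real.exp (m * t)), ← mul_assoc (Real.exp (-(m * t))), hA, hB, stableDensity, hpow]
    have hs0 : s ≠ 0 := ne_of_gt hs
    field_simp
    ring
  have hinf : Tendsto (fun s : ℝ => t / (2 * √s)) (𝓝[>] 0) atTop := by
    refine Tendsto.const_mul_atTop ht (Tendsto.inv_tendsto_nhdsGT_zero ?_)
    refine tendsto_nhdsWithin_iff.mpr ⟨?_, ?_⟩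
    · have : Tendsto (fun s : ℝ => 2 * √s) (𝓝 0) (𝓝 (2 * √0)) :=
        (continuous_const.mul Real.continuous_sqrt).tendsto 0
      rw [Real.sqrt_zero, mul_zero] at this
      exact this.mono_left nhdsWithin_le_nhds
    · filter_upwards [self_mem_nhdsWithin] with s hs
      have : 0 < √s := Real.sqrt_pos.mpr hs
      exact mul_pos two_pos this
  have hz : Tendsto (fun s : ℝ => m * √s) (𝓝[>] 0) (𝓝 0) := by
    have : Tendsto (fun s : ℝ => m * √s) (𝓝 0) (𝓝 (m * √0)) :=
      (continuous_const.mul Real.continuous_sqrt).tendsto 0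
    rw [Real.sqrt_zero, mul_zero] at this
    exact this.mono_left nhdsWithin_le_nhds
  have hlim0 : Tendsto Φ (𝓝[>] 0) (𝓝 L0) := by
    refine Tendsto.div_const (Tendsto.add (Tendsto.const_mul _ ?_) (Tendsto.const_mul _ ?_)) _
    · exact tendsto_gaussPrimitive_atBot.comp
        (tendsto_neg_atTop_atBot.comp (hinf.atTop_add hz))
    · refine tendsto_gaussPrimitive_atBot.comp ?_
      simpa [sub_eq_add_neg] using hz.add_atBot (tendsto_neg_atTop_atBot.comp hinf)
  have hzinf : Tendsto (fun s : ℝ => t / (2 * √s)) atTop (𝓝 0) :=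
    Tendsto.const_div_atTop (Tendsto.const_mul_atTop two_pos Real.tendsto_sqrt_atTop) t
  have hlim : Tendsto Φ atTop (𝓝 (L0 + Real.exp (-(m * t)))) := by
    -- For `m = 0` both Gaussian arguments tend to `0` at infinity, so this limit needs its own
    -- computation.
    rcases hm.eq_or_lt with hm0 | hm0
    · have h1 : Tendsto (fun s : ℝ => gaussPrimitive (-(t / (2 * √s) + m * √s))) atTop (𝓝 0) := by
        have h0 : Tendsto gaussPrimitive (𝓝 0) (𝓝 0) := by
          have := (hasDerivAt_gaussPrimitive 0).continuousAt.tendsto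
          simpa [gaussPrimitive] using this
        refine h0.comp ?_
        simpa [← hm0] using hzinf.neg
      have h2 : Tendsto (fun s : ℝ => gaussPrimitive (m * √s - t / (2 * √s))) atTop (𝓝 0) := by
        have h0 : Tendsto gaussPrimitive (𝓝 0) (𝓝 0) := by
          have := (hasDerivAt_gaussPrimitive 0).continuousAt.tendsto
          simpa [gaussPrimitive] using this
        refine h0.comp ?_
        simpa [← hm0] using hzinf.neg
      have := ((h1.const_mul (Real.exp (m * t))).add
        (h2.const_mul (Real.exp (-(m * t))))).div_const (√Real.pi)
      convert this using 2
      rw [hL0, ← hm0]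
      field_simp
      norm_num
    · have hminf : Tendsto (fun s : ℝ => m * √s) atTop atTop :=
        Tendsto.const_mul_atTop hm0 Real.tendsto_sqrt_atTop
      have h1 : Tendsto (fun s : ℝ => gaussPrimitive (-(t / (2 * √s) + m * √s))) atTop
          (𝓝 (-(√Real.pi / 2))) :=
        tendsto_gaussPrimitive_atBot.comp (tendsto_neg_atTop_atBot.comp (hzinf.add_atTop hminf))
      have h2 : Tendsto (fun s : ℝ => gaussPrimitive (m * √s - t / (2 * √s))) atTop
          (𝓝 (√Real.pi / 2)) := by
        refine tendsto_gaussPrimitive_atTop.comp ?_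
        simpa [sub_eq_add_neg] using hminf.atTop_add hzinf.neg
      have := ((h1.const_mul (Real.exp (m * t))).add
        (h2.const_mul (Real.exp (-(m * t))))).div_const (√Real.pi)
      convert this using 2
      rw [hL0]
      field_simp
      ring
  -- Division by zero gives `Φ` a meaningless value at `0`; it is replaced by the limit from the
  -- right.
  set g := Function.update Φ 0 L0 with hg
  have hgΦ : ∀ s ≠ 0, g s = Φ s := fun s hs => Function.update_of_ne hs _ _
  have hcont : ContinuousWithinAt g (Ici 0) 0 := by
    rw [hg, continuousWithinAt_update_same]
    simpa using hlim0
  have hgder : ∀ s ∈ Ioi (0 : ℝ),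
      HasDerivAt g (Real.exp (-(m ^ 2 * s)) * stableDensity t s) s := fun s hs =>
    (hder s hs).congr_of_eventuallyEq ((eventually_ne_nhds (ne_of_gt hs)).mono hgΦ)
  have hglim : Tendsto g atTop (𝓝 (L0 + Real.exp (-(m * t)))) :=
    hlim.congr' ((eventually_ne_atTop 0).mono fun s hs => (hgΦ s hs).symm)
  have hpos : ∀ s ∈ Ioi (0 : ℝ), 0 ≤ Real.exp (-(m ^ 2 * s)) * stableDensity t s := fun s hs =>
    mul_nonneg (Real.exp_pos _).le (stableDensity_nonneg ht hs)
  refine ⟨integrableOn_Ioi_deriv_of_nonneg hcont hgder hpos hglim, ?_⟩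
  rw [integral_Ioi_of_hasDerivAt_of_nonneg hcont hgder hpos hglim, hg, Function.update_self]
  ring

theorem integrableOn_stableDensity {t : ℝ} (ht : 0 < t) : IntegrableOn (stableDensity t) (Ioi 0) := by
  simpa using (stableDensity_laplace ht le_rfl).1

theorem lintegral_stableDensity {t : ℝ} (ht : 0 < t) :
    ∫⁻ s in Ioi (0 : ℝ), ENNReal.ofReal (stableDensity t s) = 1 := by
  rw [← ofReal_integral_eq_lintegral_ofReal (integrableOn_stableDensity ht)]
  · have := (stableDensity_laplace ht le_rfl).2
    simp at this
    simp [this]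
  · filter_upwards [ae_restrict_mem measurableSet_Ioi] with s hs using stableDensity_nonneg ht hs

/-- The `t`-derivative of the stable density. -/
def stableDensityDeriv (t s : ℝ) : ℝ :=
  1 / (2 * √Real.pi) * (1 - t ^ 2 / (2 * s)) * Real.exp (-(t ^ 2 / (4 * s))) * s ^ (-(3 / 2) : ℝ)

theorem hasDerivAt_stableDensity (t s : ℝ) :
    HasDerivAt (fun u => stableDensity u s) (stableDensityDeriv t s) t := by
  have h1 : HasDerivAt (fun u : ℝ => Real.exp (-(u ^ 2 / (4 * s))))
      (Real.exp (-(t ^ 2 / (4 * s))) * -(2 * t / (4 * s))) t := by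
    refine HasDerivAt.exp ?_
    have := (((hasDerivAt_id t).pow 2).div_const (4 * s)).neg
    exact this.congr_deriv (by simp)
  have h2 := ((((hasDerivAt_id t).div_const (2 * √Real.pi)).mul h1).mul_const
    (s ^ (-(3 / 2) : ℝ)))
  refine h2.congr_deriv ?_
  simp only [stableDensityDeriv, id]
  -- At `s = 0` the convention `0 ^ (-3/2) = 0` makes both sides vanish.
  rcases eq_or_ne s 0 with rfl | hs
  · simp
  field_simp
  ring

/-- Half of the exponential absorbs the polynomial factor: with `r = u²/(4s)`, `|1-2r| exp (-r) ≤ 5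
exp (-r/2)`, and `u ≥ 2t` gives `r/2 ≥ t²/(4s)`. A single density thus dominates the derivatives for
all larger parameters, as differentiation under the integral requires. -/
theorem abs_stableDensityDeriv_le {t u s : ℝ} (ht : 0 < t) (hu : 2 * t ≤ u) (hs : 0 < s) :
    |stableDensityDeriv u s| ≤ 5 / t * stableDensity t s := by
  set r := u ^ 2 / (4 * s) with hr
  have hr0 : 0 ≤ r := by positivity
  have e1 : u ^ 2 / (2 * s) = 2 * r := by rw [hr]; field_simp; ring
  have h1 : |1 - 2 * r| * Real.exp (-r) ≤ 5 * Real.exp (-(r / 2)) := by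
    have hexp : r / 2 + 1 ≤ Real.exp (r / 2) := Real.add_one_le_exp _
    have : Real.exp (-r) = Real.exp (-(r / 2)) * Real.exp (-(r / 2)) := by
      rw [← Real.exp_add]; ring_nf
    rw [this, ← mul_assoc]
    gcongr
    rw [Real.exp_neg, ← div_eq_mul_inv, div_le_iff₀ (Real.exp_pos _)]
    calc |1 - 2 * r| ≤ 1 + 2 * r := by rw [abs_le]; constructor <;> linarith
      _ ≤ 5 * (r / 2 + 1) := by linarith
      _ ≤ _ := by gcongr
  have h2 : Real.exp (-(r / 2)) ≤ Real.exp (-(t ^ 2 / (4 * s))) := by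
    have hu2 : (2 * t) ^ 2 ≤ u ^ 2 := by gcongr
    refine Real.exp_le_exp.mpr (neg_le_neg ?_)
    rw [hr, div_div, div_le_div_iff₀ (by positivity) (by positivity)]
    nlinarith [sq_nonneg t]
  have h3 := h1.trans (mul_le_mul_of_nonneg_left h2 (by norm_num : (0 : ℝ) ≤ 5))
  rw [stableDensityDeriv, stableDensity, e1, ← hr, abs_mul, abs_mul, abs_mul,
    abs_of_pos (show 0 < 1 / (2 * √Real.pi) by positivity), abs_of_pos (Real.exp_pos _),
    abs_of_nonneg (Real.rpow_nonneg hs.le _)]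
  calc _ = 1 / (2 * √Real.pi) * (|1 - 2 * r| * Real.exp (-r)) * s ^ (-(3 / 2) : ℝ) := by ring
    _ ≤ 1 / (2 * √Real.pi) * (5 * Real.exp (-(t ^ 2 / (4 * s)))) * s ^ (-(3 / 2) : ℝ) := by
        exact mul_le_mul_of_nonneg_right (mul_le_mul_of_nonneg_left h3 (by positivity))
          (by positivity)
    _ = _ := by field_simp

/-- Differentiation of a subordinated function with respect to the parameter. -/
theorem hasDerivAt_integral_stableDensity {g : ℝ → ℝ}
    (hm : AEStronglyMeasurable g (volume.restrict (Ioi 0)))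
    (hg : ∀ t : ℝ, 0 < t → IntegrableOn (fun s => g s * stableDensity t s) (Ioi 0)) {t : ℝ}
    (ht : 0 < t) :
    HasDerivAt (fun u => ∫ s in Ioi (0 : ℝ), g s * stableDensity u s)
      (∫ s in Ioi (0 : ℝ), g s * stableDensityDeriv t s) t := by
  have hmeas : ∀ u, Measurable (stableDensityDeriv u) := fun u => by
    unfold stableDensityDeriv; fun_prop
  refine (hasDerivAt_integral_of_dominated_loc_of_deriv_le (μ := volume.restrict (Ioi 0))
    (F := fun u s => g s * stableDensity u s) (F' := fun u s => g s * stableDensityDeriv u s)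
    -- The parameter `t/4` is half of the left end of the neighbourhood `u > t/2`, as
    -- `abs_stableDensityDeriv_le` demands.
    (bound := fun s => 5 / (t / 4) * |g s * stableDensity (t / 4) s|)
    (Ioi_mem_nhds (show t / 2 < t by linarith)) ?_ (hg t ht) ?_ ?_ ?_ ?_).2
  · filter_upwards [Ioi_mem_nhds ht] with u hu using (hg u hu).1
  · exact hm.mul (hmeas t).aestronglyMeasurable
  · filter_upwards [ae_restrict_mem measurableSet_Ioi] with s hs u hu
    rw [Real.norm_eq_abs, abs_mul, abs_mul, abs_of_nonneg (stableDensity_nonneg (by linarith) hs),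
      mul_left_comm]
    gcongr
    exact abs_stableDensityDeriv_le (by linarith) (by linarith [mem_Ioi.mp hu]) hs
  · exact ((hg (t / 4) (by linarith)).abs).const_mul _
  · filter_upwards with s u _
    exact (hasDerivAt_stableDensity u s).const_mul (g s)

theorem continuousOn_integral_stableDensityDeriv {g : ℝ → ℝ}
    (hm : AEStronglyMeasurable g (volume.restrict (Ioi 0)))
    (hg : ∀ t : ℝ, 0 < t → IntegrableOn (fun s => g s * stableDensity t s) (Ioi 0)) :
    ContinuousOn (fun t => ∫ s in Ioi (0 : ℝ), g s * stableDensityDeriv t s) (Ioi 0) := by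
  intro t ht
  have ht' : 0 < t := ht
  have hmeas : ∀ u, Measurable (stableDensityDeriv u) := fun u => by
    unfold stableDensityDeriv; fun_prop
  refine (continuousAt_of_dominated
    (bound := fun s => 5 / (t / 4) * |g s * stableDensity (t / 4) s|) ?_ ?_ ?_ ?_).continuousWithinAt
  · exact Eventually.of_forall fun u => hm.mul (hmeas u).aestronglyMeasurable
  · filter_upwards [Ioi_mem_nhds (show t / 2 < t by linarith)] with u hu
    filter_upwards [ae_restrict_mem measurableSet_Ioi] with s hs
    rw [Real.norm_eq_abs, abs_mul, abs_mul, abs_of_nonneg (stableDensity_nonneg (by linarith) hs),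
      mul_left_comm]
    gcongr
    exact abs_stableDensityDeriv_le (by linarith) (by linarith [mem_Ioi.mp hu]) hs
  · exact ((hg (t / 4) (by linarith)).abs).const_mul _
  · filter_upwards with s
    unfold stableDensityDeriv
    fun_prop

/-- Integration by parts with the primitive `s^(-γ) (exp (-s) - 1)`. It vanishes at `0` and at
infinity because `|exp (-s) - 1|` is at most `s` and at most `1`, with `0 < γ < 1`. -/
theorem fracConst_eq {γ : ℝ} (h0 : 0 < γ) (h1 : γ < 1) : fracConst γ = -(Real.Gamma (1 - γ) / γ) := by
  have hG : IntegrableOn (fun s : ℝ => Real.exp (-s) * s ^ (-γ)) (Ioi 0) := by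
    have := Real.GammaIntegral_convergent (s := 1 - γ) (by linarith)
    simpa using this
  have hbound : ∀ s : ℝ, 0 < s → |Real.exp (-s) - 1| ≤ s := by
    intro s hs
    have := Real.add_one_le_exp (-s)
    rw [abs_le]; constructor
    · linarith
    · have : Real.exp (-s) ≤ 1 := Real.exp_le_one_iff.mpr (by linarith)
      linarith
  have hbound' : ∀ s : ℝ, 0 < s → |Real.exp (-s) - 1| ≤ 1 := by
    intro s hs
    have : Real.exp (-s) ≤ 1 := Real.exp_le_one_iff.mpr (by linarith)
    have := Real.exp_pos (-s)
    rw [abs_le]; constructor <;> linarith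
  have hI : IntegrableOn (fun s : ℝ => s ^ (-γ - 1) * (Real.exp (-s) - 1)) (Ioi 0) := by
    have hmeas : Measurable fun s : ℝ => s ^ (-γ - 1) * (Real.exp (-s) - 1) := by fun_prop
    rw [← Ioc_union_Ioi_eq_Ioi zero_le_one]
    refine IntegrableOn.union ?_ ?_
    · have hd : IntegrableOn (fun s : ℝ => s ^ (-γ)) (Ioc 0 1) :=
        (intervalIntegrable_iff_integrableOn_Ioc_of_le zero_le_one).mp
          (intervalIntegral.intervalIntegrable_rpow' (by linarith))
      refine Integrable.mono' hd hmeas.aestronglyMeasurable ?_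
      filter_upwards [ae_restrict_mem measurableSet_Ioc] with s hs
      rw [Real.norm_eq_abs, abs_mul, abs_of_nonneg (Real.rpow_nonneg hs.1.le _)]
      calc _ ≤ s ^ (-γ - 1) * s := by
            have := Real.rpow_nonneg hs.1.le (-γ - 1)
            gcongr; exact hbound s hs.1
        _ = s ^ (-γ) := by rw [← Real.rpow_add_one hs.1.ne']; ring_nf
    · refine Integrable.mono' (integrableOn_Ioi_rpow_of_lt (a := -γ - 1) (by linarith) one_pos)
        hmeas.aestronglyMeasurable ?_
      filter_upwards [ae_restrict_mem measurableSet_Ioi] with s hs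
      have hs0 : 0 < s := one_pos.trans hs
      rw [Real.norm_eq_abs, abs_mul, abs_of_nonneg (Real.rpow_nonneg hs0.le _)]
      exact mul_le_of_le_one_right (Real.rpow_nonneg hs0.le _) (hbound' s hs0)
  have hder : ∀ s ∈ Ioi (0 : ℝ), HasDerivAt (fun s : ℝ => s ^ (-γ) * (Real.exp (-s) - 1))
      (-γ * (s ^ (-γ - 1) * (Real.exp (-s) - 1)) - Real.exp (-s) * s ^ (-γ)) s := by
    intro s hs
    have d1 := (hasDerivAt_id s).rpow_const (p := -γ) (Or.inl (ne_of_gt hs))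
    have d2 := (hasDerivAt_neg s).exp.sub_const 1
    refine (d1.mul d2).congr_deriv ?_
    simp only [id]
    ring
  have hcont : ContinuousWithinAt (fun s : ℝ => s ^ (-γ) * (Real.exp (-s) - 1)) (Ici 0) 0 := by
    have hz : (0 : ℝ) ^ (-γ) * (Real.exp (-0) - 1) = 0 := by simp
    rw [ContinuousWithinAt, hz]
    have hlim : Tendsto (fun s : ℝ => s ^ (1 - γ)) (𝓝[≥] 0) (𝓝 0) := by
      have := (Real.continuous_rpow_const (q := 1 - γ) (by linarith)).tendsto 0
      rw [Real.zero_rpow (by linarith)] at this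
      exact this.mono_left nhdsWithin_le_nhds
    refine squeeze_zero_norm' ?_ hlim
    filter_upwards [self_mem_nhdsWithin] with s hs
    rcases (mem_Ici.mp hs).eq_or_lt with rfl | hs0
    · simp [Real.zero_rpow (show 1 - γ ≠ 0 by linarith)]
    · rw [Real.norm_eq_abs, abs_mul, abs_of_nonneg (Real.rpow_nonneg hs0.le _)]
      calc _ ≤ s ^ (-γ) * s := by
            have := Real.rpow_nonneg hs0.le (-γ)
            gcongr; exact hbound s hs0
        _ = s ^ (1 - γ) := by rw [← Real.rpow_add_one hs0.ne']; ring_nf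
  have hlim : Tendsto (fun s : ℝ => s ^ (-γ) * (Real.exp (-s) - 1)) atTop (𝓝 0) := by
    refine squeeze_zero_norm' ?_ (tendsto_rpow_neg_atTop h0)
    filter_upwards [eventually_gt_atTop 0] with s hs0
    rw [Real.norm_eq_abs, abs_mul, abs_of_nonneg (Real.rpow_nonneg hs0.le _)]
    exact mul_le_of_le_one_right (Real.rpow_nonneg hs0.le _) (hbound' s hs0)
  have h := integral_Ioi_of_hasDerivAt_of_tendsto hcont hder ((hI.const_mul (-γ)).sub hG) hlim
  rw [integral_sub (hI.const_mul (-γ)) hG, integral_const_mul] at h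
  have hGam : Real.Gamma (1 - γ) = ∫ s in Ioi (0 : ℝ), Real.exp (-s) * s ^ (-γ) := by
    rw [Real.Gamma_eq_integral (by linarith)]
    simp
  rw [← hGam] at h
  simp only [neg_zero, Real.exp_zero, sub_self, mul_zero] at h
  rw [fracConst]
  field_simp
  linarith

/-- The product of Gamma values is what the double integral produces on each mode. -/
theorem calderonConst_mul {γ : ℝ} (h0 : 0 < γ) (h1 : γ < 1) :
    calderonConst γ * (Real.Gamma (1 - γ) * Real.Gamma (1 + γ)) = 1 := by
  have p1 := Real.Gamma_pos_of_pos (show 0 < 1 - γ by linarith)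
  have p2 := Real.Gamma_pos_of_pos h0
  rw [calderonConst, fracConst_eq h0 h1, add_comm 1 γ, Real.Gamma_add_one h0.ne']
  field_simp

end StableDensity

/-! ### Hopf's maximal inequality for symmetric Markov densities. -/

section MaximalInequality

open scoped ENNReal

/-- A measurable symmetric transition density with respect to `μ` satisfying the
Chapman–Kolmogorov equations. -/
structure IsMarkovDensity {X : Type*} [MeasurableSpace X] (μ : Measure X)
    (k : ℝ → X → X → ℝ≥0∞) : Prop where
  measurable : Measurable fun p : (ℝ × X) × X => k p.1.1 p.1.2 p.2
  symm : ∀ {s : ℝ}, 0 < s → ∀ x y, k s x y = k s y x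
  lintegral_eq_one : ∀ {s : ℝ}, 0 < s → ∀ x, ∫⁻ y, k s x y ∂μ = 1
  chapman : ∀ {s t : ℝ}, 0 < s → 0 < t → ∀ x z, ∫⁻ y, k s x y * k t y z ∂μ = k (s + t) x z

/-- The semigroup associated with a transition density, on nonnegative functions. -/
def densityOp {X : Type*} [MeasurableSpace X] (μ : Measure X) (k : ℝ → X → X → ℝ≥0∞) (s : ℝ)
    (f : X → ℝ≥0∞) (x : X) : ℝ≥0∞ :=
  ∫⁻ y, k s x y * f y ∂μ

/-- The integral of an orbit of the semigroup over `(0, r]`. -/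
def orbitIntegral {X : Type*} [MeasurableSpace X] (μ : Measure X) (k : ℝ → X → X → ℝ≥0∞)
    (f : X → ℝ≥0∞) (r : ℝ) (x : X) : ℝ≥0∞ :=
  ∫⁻ s in Ioc 0 r, densityOp μ k s f x

/-- The ergodic maximal function along the times `4 ^ j`. -/
def ergodicMaximal {X : Type*} [MeasurableSpace X] (μ : Measure X) (k : ℝ → X → X → ℝ≥0∞)
    (f : X → ℝ≥0∞) (x : X) : ℝ≥0∞ :=
  ⨆ j : ℤ, (ENNReal.ofReal ((4 : ℝ) ^ j))⁻¹ * orbitIntegral μ k f ((4 : ℝ) ^ j) x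

variable {X : Type*} [MeasurableSpace X] {μ : Measure X} {k : ℝ → X → X → ℝ≥0∞}
  {f : X → ℝ≥0∞}

theorem IsMarkovDensity.measurable_density (hk : IsMarkovDensity μ k) (s : ℝ) (x : X) :
    Measurable (k s x) :=
  hk.measurable.comp (measurable_prodMk_left (x := (s, x)))

theorem densityOp_mono (s : ℝ) {g : X → ℝ≥0∞} (h : ∀ x, f x ≤ g x) (x : X) :
    densityOp μ k s f x ≤ densityOp μ k s g x :=
  lintegral_mono fun y => mul_le_mul_right (h y) _

theorem IsMarkovDensity.densityOp_add_const (hk : IsMarkovDensity μ k) (hf : Measurable f) {s : ℝ}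
    (hs : 0 < s) (c : ℝ≥0∞) (x : X) :
    densityOp μ k s (fun y => f y + c) x = densityOp μ k s f x + c := by
  unfold densityOp
  simp_rw [mul_add]
  have hm : Measurable fun y => k s x y * f y := (hk.measurable_density s x).mul hf
  rw [lintegral_add_left hm,
    lintegral_mul_const _ (hk.measurable_density s x), hk.lintegral_eq_one hs, one_mul]

/-- Upper bound for the stable density near zero. -/
theorem stableDensity_le_near {t s : ℝ} (ht : 0 < t) (hs : 0 < s) :
    stableDensity t s ≤ 8 / t ^ 2 := by
  have hpi : 1 ≤ √Real.pi := by
    rw [Real.one_le_sqrt]; linarith [Real.pi_gt_three]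
  have hs' : 0 < √s := Real.sqrt_pos.mpr hs
  have hpow : s ^ (-(3 / 2) : ℝ) = 1 / (√s) ^ 3 := by
    rw [Real.rpow_neg hs.le, one_div, Real.sqrt_eq_rpow, ← Real.rpow_natCast, ← Real.rpow_mul hs.le]
    norm_num
  set w := t / √s with hw
  have hw0 : 0 < w := by positivity
  have e1 : t ^ 2 / (4 * s) = w ^ 2 / 4 := by
    rw [hw, div_pow, Real.sq_sqrt hs.le]; field_simp
  have hexp := Real.quadratic_le_exp_of_nonneg (show 0 ≤ w ^ 2 / 4 by positivity)
  -- The quadratic lower bound for the exponential gives `16 + 4w² + w⁴/2` on the right, and `2w³ ≤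
  -- w⁴ + w²`.
  have hK : w ^ 3 * Real.exp (-(w ^ 2 / 4)) ≤ 16 := by
    rw [Real.exp_neg, ← div_eq_mul_inv, div_le_iff₀ (Real.exp_pos _)]
    nlinarith [mul_nonneg (sq_nonneg w) (sq_nonneg (w - 1))]
  rw [stableDensity, e1, hpow, le_div_iff₀ (by positivity)]
  calc _ = (w ^ 3 * Real.exp (-(w ^ 2 / 4))) / (2 * √Real.pi) := by
        rw [hw]; field_simp
    _ ≤ 16 / (2 * 1) := by gcongr
    _ = 8 := by norm_num

theorem stableDensity_le_far {t s u : ℝ} (ht : 0 < t) (hu : 0 < u) (hs : u ^ 2 ≤ s) :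
    stableDensity t s ≤ t / 2 / u ^ 3 := by
  have hpi : 1 ≤ √Real.pi := by
    rw [Real.one_le_sqrt]; linarith [Real.pi_gt_three]
  have hs0 : 0 < s := lt_of_lt_of_le (by positivity) hs
  have hpow : s ^ (-(3 / 2) : ℝ) = 1 / (√s) ^ 3 := by
    rw [Real.rpow_neg hs0.le, one_div, Real.sqrt_eq_rpow, ← Real.rpow_natCast,
      ← Real.rpow_mul hs0.le]
    norm_num
  have hus : u ≤ √s := Real.le_sqrt_of_sq_le hs
  rw [stableDensity, hpow]
  calc _ ≤ t / (2 * 1) * 1 * (1 / u ^ 3) := by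
        gcongr
        exact Real.exp_le_one_iff.mpr (by simp; positivity)
    _ = _ := by ring

/-- The subordinated semigroup is dominated by the ergodic maximal function. -/
theorem lintegral_densityOp_stableDensity_le {t : ℝ} (ht : 0 < t) (x : X) :
    ∫⁻ s in Ioi (0 : ℝ), densityOp μ k s f x * ENNReal.ofReal (stableDensity t s) ≤
      16 * ergodicMaximal μ k f x := by
  -- With `2^m ≤ t < 2^(m+1)` the natural time scale `t²` is comparable to `4^m`. The times up to
  -- `4^m` contribute at most `8 M`, the shell from `4^(m+i)` to `4^(m+i+1)` at most `4 M 2^(-i)`,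
  -- hence `16 M` in all.
  obtain ⟨m, hm1, hm2⟩ := exists_mem_Ico_zpow ht (one_lt_two (α := ℝ))
  set M := ergodicMaximal μ k f x with hM
  have hJ : ∀ j : ℤ, orbitIntegral μ k f ((4 : ℝ) ^ j) x ≤ ENNReal.ofReal ((4 : ℝ) ^ j) * M := by
    intro j
    have hp : ENNReal.ofReal ((4 : ℝ) ^ j) ≠ 0 := by
      rw [Ne, ENNReal.ofReal_eq_zero, not_le]; positivity
    rw [mul_comm, ← ENNReal.div_le_iff_le_mul (Or.inl hp) (Or.inl ENNReal.ofReal_ne_top),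
      ENNReal.div_eq_inv_mul]
    exact le_iSup (fun j : ℤ => (ENNReal.ofReal ((4 : ℝ) ^ j))⁻¹ *
      orbitIntegral μ k f ((4 : ℝ) ^ j) x) j
  have h4 : ∀ j : ℤ, (4 : ℝ) ^ j = ((2 : ℝ) ^ j) ^ 2 := fun j => by
    rw [← zpow_natCast, ← zpow_mul, mul_comm, zpow_mul]; norm_num
  have hcover : Ioi (0 : ℝ) ⊆ Ioc 0 ((4 : ℝ) ^ m) ∪
      ⋃ i : ℕ, Ioc ((4 : ℝ) ^ (m + i)) ((4 : ℝ) ^ (m + i + 1)) := by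
    intro s hs
    rcases le_or_gt s ((4 : ℝ) ^ m) with h | h
    · exact Or.inl ⟨hs, h⟩
    · obtain ⟨j, hj1, hj2⟩ := exists_mem_Ioc_zpow (mem_Ioi.mp hs) (show (1 : ℝ) < 4 by norm_num)
      have hjm : m ≤ j := by
        have := (zpow_lt_zpow_iff_right₀ (show (1 : ℝ) < 4 by norm_num)).mp (h.trans_le hj2)
        omega
      obtain ⟨i, hi⟩ := Int.eq_ofNat_of_zero_le (show 0 ≤ j - m by omega)
      refine Or.inr (mem_iUnion.mpr ⟨i, ?_⟩)
      rw [show m + (i : ℤ) = j by omega]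
      exact ⟨hj1, hj2⟩
  have hnear : ∫⁻ s in Ioc 0 ((4 : ℝ) ^ m), densityOp μ k s f x *
      ENNReal.ofReal (stableDensity t s) ≤ 8 * M := by
    have hb : ∀ s ∈ Ioc 0 ((4 : ℝ) ^ m), densityOp μ k s f x *
        ENNReal.ofReal (stableDensity t s) ≤
        densityOp μ k s f x * ENNReal.ofReal (8 / (4 : ℝ) ^ m) := by
      intro s hs
      gcongr
      refine (stableDensity_le_near ht hs.1).trans ?_
      rw [h4]
      gcongr
    refine (setLIntegral_mono' measurableSet_Ioc hb).trans ?_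
    rw [lintegral_mul_const' _ _ ENNReal.ofReal_ne_top]
    calc _ ≤ ENNReal.ofReal ((4 : ℝ) ^ m) * M * ENNReal.ofReal (8 / (4 : ℝ) ^ m) :=
          mul_le_mul_left (hJ m) _
      _ = ENNReal.ofReal ((4 : ℝ) ^ m * (8 / (4 : ℝ) ^ m)) * M := by
          rw [ENNReal.ofReal_mul (by positivity)]; ring
      _ = 8 * M := by
          rw [mul_div_cancel₀ _ (by positivity)]; simp
  have hfar : ∀ i : ℕ, ∫⁻ s in Ioc ((4 : ℝ) ^ (m + i)) ((4 : ℝ) ^ (m + i + 1)),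
      densityOp μ k s f x * ENNReal.ofReal (stableDensity t s) ≤ 4 * M * 2⁻¹ ^ i := by
    intro i
    set u : ℝ := (2 : ℝ) ^ (m + i) with hu
    have hu0 : 0 < u := by positivity
    have hb : ∀ s ∈ Ioc ((4 : ℝ) ^ (m + i)) ((4 : ℝ) ^ (m + i + 1)), densityOp μ k s f x *
        ENNReal.ofReal (stableDensity t s) ≤
        densityOp μ k s f x * ENNReal.ofReal ((2 : ℝ) ^ m / u ^ 3) := by
      intro s hs
      gcongr
      refine (stableDensity_le_far ht hu0 (by rw [hu, ← h4]; exact hs.1.le)).trans ?_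
      gcongr
      rw [zpow_add_one₀ two_ne_zero] at hm2
      linarith
    refine (setLIntegral_mono' measurableSet_Ioc hb).trans ?_
    rw [lintegral_mul_const' _ _ ENNReal.ofReal_ne_top]
    calc _ ≤ ENNReal.ofReal ((4 : ℝ) ^ (m + i + 1)) * M * ENNReal.ofReal ((2 : ℝ) ^ m / u ^ 3) := by
          refine mul_le_mul_left ((lintegral_mono_set ?_).trans (hJ (m + i + 1))) _
          exact Ioc_subset_Ioc_left (by positivity)
      _ = ENNReal.ofReal ((4 : ℝ) ^ (m + i + 1) * ((2 : ℝ) ^ m / u ^ 3)) * M := by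
          rw [ENNReal.ofReal_mul (by positivity)]; ring
      _ = ENNReal.ofReal (4 * (1 / 2) ^ i) * M := by
          congr 2
          rw [zpow_add_one₀ (by norm_num), h4, ← hu]
          have : u = 2 ^ m * 2 ^ i := by rw [hu, zpow_add₀ two_ne_zero, zpow_natCast]
          have h2 : (2 : ℝ) ^ m = u * (1 / 2) ^ i := by
            rw [this, mul_assoc, ← mul_pow]; norm_num
          rw [h2]; field_simp
      _ = 4 * M * 2⁻¹ ^ i := by
          rw [ENNReal.ofReal_mul (by norm_num), ENNReal.ofReal_pow (by norm_num), one_div,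
            ENNReal.ofReal_inv_of_pos two_pos]
          simp; ring
  calc _ ≤ ∫⁻ s in Ioc 0 ((4 : ℝ) ^ m) ∪
        ⋃ i : ℕ, Ioc ((4 : ℝ) ^ (m + i)) ((4 : ℝ) ^ (m + i + 1)),
          densityOp μ k s f x * ENNReal.ofReal (stableDensity t s) := lintegral_mono_set hcover
    _ ≤ 8 * M + ∑' i : ℕ, 4 * M * 2⁻¹ ^ i :=
        (lintegral_union_le _ _ _).trans (add_le_add hnear
          ((lintegral_iUnion_le _ _).trans (ENNReal.tsum_le_tsum hfar)))
    _ = 16 * M := by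
        rw [ENNReal.tsum_mul_left, ENNReal.tsum_geometric, ENNReal.one_sub_inv_two, inv_inv]
        ring

variable [SFinite μ]

theorem IsMarkovDensity.measurable_densityOp (hk : IsMarkovDensity μ k) (hf : Measurable f) :
    Measurable fun p : ℝ × X => densityOp μ k p.1 f p.2 :=
  (hk.measurable.mul (hf.comp measurable_snd)).lintegral_prod_right'

theorem IsMarkovDensity.measurable_densityOp_right (hk : IsMarkovDensity μ k) (hf : Measurable f)
    (s : ℝ) : Measurable (densityOp μ k s f) :=
  (hk.measurable_densityOp hf).comp measurable_prodMk_left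

theorem IsMarkovDensity.measurable_densityOp_left (hk : IsMarkovDensity μ k) (hf : Measurable f)
    (x : X) : Measurable fun s => densityOp μ k s f x :=
  (hk.measurable_densityOp hf).comp measurable_prodMk_right

/-- Symmetry turns mass one in the second variable into mass one in the first, which is what
Tonelli's theorem leaves. -/
theorem IsMarkovDensity.lintegral_densityOp (hk : IsMarkovDensity μ k) (hf : Measurable f) {s : ℝ}
    (hs : 0 < s) : ∫⁻ x, densityOp μ k s f x ∂μ = ∫⁻ x, f x ∂μ := by
  unfold densityOp
  rw [lintegral_lintegral_swap]
  · refine lintegral_congr fun y => ?_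
    have hm : Measurable fun x => k s x y := by
      have : (fun x => k s x y) = k s y := funext fun x => hk.symm hs x y
      rw [this]; exact hk.measurable_density s y
    rw [lintegral_mul_const _ hm]
    simp_rw [hk.symm hs _ y]
    rw [hk.lintegral_eq_one hs, one_mul]
  · have : Measurable fun p : X × X => k s p.1 p.2 :=
      hk.measurable.comp (((measurable_const (a := s)).prodMk measurable_fst).prodMk measurable_snd)
    exact (this.mul (hf.comp measurable_snd)).aemeasurable

theorem IsMarkovDensity.densityOp_densityOp (hk : IsMarkovDensity μ k) (hf : Measurable f)
    {s t : ℝ} (hs : 0 < s) (ht : 0 < t) (x : X) :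
    densityOp μ k s (densityOp μ k t f) x = densityOp μ k (s + t) f x := by
  unfold densityOp
  have hmt : Measurable fun p : X × X => k t p.1 p.2 :=
    hk.measurable.comp (((measurable_const (a := t)).prodMk measurable_fst).prodMk measurable_snd)
  have h1 : ∀ y, k s x y * ∫⁻ z, k t y z * f z ∂μ = ∫⁻ z, k s x y * k t y z * f z ∂μ := fun y => by
    have hm : Measurable fun z => k t y z * f z := (hk.measurable_density t y).mul hf
    rw [← lintegral_const_mul _ hm]
    simp_rw [mul_assoc]
  simp_rw [h1]
  rw [lintegral_lintegral_swap]
  · refine lintegral_congr fun z => ?_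
    have hm : Measurable fun y => k s x y * k t y z :=
      (hk.measurable_density s x).mul (hmt.comp measurable_prodMk_right)
    rw [lintegral_mul_const _ hm, hk.chapman hs ht]
  · exact ((((hk.measurable_density s x).comp measurable_fst).mul hmt).mul
      (hf.comp measurable_snd)).aemeasurable

theorem IsMarkovDensity.measurable_orbitIntegral (hk : IsMarkovDensity μ k) (hf : Measurable f)
    (r : ℝ) : Measurable (orbitIntegral μ k f r) :=
  ((hk.measurable_densityOp hf).comp measurable_swap).lintegral_prod_right'

theorem IsMarkovDensity.lintegral_orbitIntegral (hk : IsMarkovDensity μ k) (hf : Measurable f)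
    (r : ℝ) :
    ∫⁻ x, orbitIntegral μ k f r x ∂μ = ENNReal.ofReal r * ∫⁻ x, f x ∂μ := by
  unfold orbitIntegral
  have hm : Measurable fun p : X × ℝ => densityOp μ k p.2 f p.1 :=
    (hk.measurable_densityOp hf).comp measurable_swap
  rw [lintegral_lintegral_swap (f := fun x s => densityOp μ k s f x) hm.aemeasurable]
  have : ∫⁻ s in Ioc 0 r, ∫⁻ x, densityOp μ k s f x ∂μ = ∫⁻ s in Ioc 0 r, ∫⁻ x, f x ∂μ :=
    setLIntegral_congr_fun measurableSet_Ioc fun s hs => hk.lintegral_densityOp hf hs.1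
  rw [this, setLIntegral_const, Real.volume_Ioc, sub_zero, mul_comm]

/-- The interval is cut at `h`, and the semigroup law translates the second piece. With `r` a
multiple of `h` this is the recursion on which Hopf's argument runs. -/
theorem IsMarkovDensity.orbitIntegral_add (hk : IsMarkovDensity μ k) (hf : Measurable f) {h r : ℝ}
    (hh : 0 < h) (hr : 0 ≤ r) (x : X) :
    orbitIntegral μ k f (h + r) x =
      orbitIntegral μ k f h x + densityOp μ k h (orbitIntegral μ k f r) x := by
  have h1 : densityOp μ k h (orbitIntegral μ k f r) x =
      ∫⁻ s in Ioc 0 r, densityOp μ k (h + s) f x := by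
    have e : ∀ s ∈ Ioc 0 r, densityOp μ k (h + s) f x = ∫⁻ y, k h x y * densityOp μ k s f y ∂μ :=
      fun s hs => (hk.densityOp_densityOp hf hh hs.1 x).symm
    rw [setLIntegral_congr_fun measurableSet_Ioc e, lintegral_lintegral_swap]
    · refine lintegral_congr fun y => ?_
      rw [lintegral_const_mul _ (hk.measurable_densityOp_left hf y), orbitIntegral]
    · exact ((hk.measurable_density h x).comp measurable_snd).mul
        (hk.measurable_densityOp hf) |>.aemeasurable
  have h2 : ∫⁻ s in Ioc 0 r, densityOp μ k (h + s) f x =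
      ∫⁻ s in Ioc h (h + r), densityOp μ k s f x := by
    rw [← lintegral_indicator measurableSet_Ioc, ← lintegral_indicator measurableSet_Ioc,
      ← lintegral_add_left_eq_self
        ((Ioc h (h + r)).indicator fun s => densityOp μ k s f x) h]
    refine lintegral_congr fun s => ?_
    simp only [indicator, mem_Ioc, lt_add_iff_pos_right, add_le_add_iff_left]
  rw [h1, h2]
  unfold orbitIntegral
  rw [← Ioc_union_Ioc_eq_Ioc hh.le (by linarith : h ≤ h + r),
    lintegral_union measurableSet_Ioc (Ioc_disjoint_Ioc_of_le le_rfl)]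

/-- Hopf's maximal ergodic inequality for the averages over multiples of `h`. -/
theorem IsMarkovDensity.hopf_maximal (hk : IsMarkovDensity μ k) (hf : Measurable f)
    (hfi : ∫⁻ x, f x ∂μ ≠ ∞) {h : ℝ} (hh : 0 < h) {c : ℝ≥0∞} (hc : c ≠ ∞) (n : ℕ) :
    c * μ {x | ∃ m ≤ n, m * c < orbitIntegral μ k f (m * h) x} ≤
      ENNReal.ofReal h * ∫⁻ x, f x ∂μ := by
  set S : ℕ → X → ℝ≥0∞ := fun m => orbitIntegral μ k f (m * h) with hS
  have hSm : ∀ m, Measurable (S m) := fun m => hk.measurable_orbitIntegral hf _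
  have hS0 : ∀ x, S 0 x = 0 := fun x => by simp [hS, orbitIntegral]
  have hSsucc : ∀ m x, S (m + 1) x = orbitIntegral μ k f h x + densityOp μ k h (S m) x :=
    fun m x => by
      rw [← hk.orbitIntegral_add hf hh (by positivity)]
      simp only [hS]; congr 1; push_cast; ring
  -- Truncated subtraction makes `M` the positive part of the largest `S m - m c`, so the set to be
  -- measured is exactly where `M > 0`.
  set M : X → ℝ≥0∞ := fun x => (Finset.range (n + 1)).sup fun m => S m x - m * c with hM
  have hMm : Measurable M := by
    simp only [hM, Finset.sup_eq_iSup]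
    exact Measurable.iSup fun m => Measurable.iSup fun _ => (hSm m).sub_const _
  have hSM : ∀ m ≤ n, ∀ x, S m x ≤ M x + m * c := fun m hm x => by
    rw [← tsub_le_iff_right]
    exact Finset.le_sup (f := fun m => S m x - m * c) (Finset.mem_range.mpr (by omega))
  set E := {x | 0 < M x} with hE
  have hEm : MeasurableSet E := measurableSet_lt measurable_const hMm
  have hEeq : {x | ∃ m ≤ n, m * c < orbitIntegral μ k f (m * h) x} = E := by
    ext x
    change (∃ m ≤ n, m * c < S m x) ↔ 0 < M x
    simp only [hM, Finset.lt_sup_iff, Finset.mem_range, tsub_pos_iff_lt, Nat.lt_succ_iff]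
  -- Where `M > 0` the maximum is attained at some `j + 1`, since `S 0 = 0`. Then `S (j+1)` is the
  -- first orbit integral plus the operator applied to `S j ≤ M + j c`; constants are preserved, and
  -- `j c` cancels.
  have hpt : ∀ x ∈ E, M x + c ≤ orbitIntegral μ k f h x + densityOp μ k h M x := by
    intro x hx
    obtain ⟨m, hm, hmx⟩ := Finset.exists_mem_eq_sup (Finset.range (n + 1)) ⟨0, by simp⟩
      fun m => S m x - m * c
    have hmx' : M x = S m x - m * c := hmx
    have hpos : 0 < S m x - m * c := hmx' ▸ hx
    rcases m with _ | j
    · simp [hS0] at hpos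
    have hj : j ≤ n := by have := Finset.mem_range.mp hm; omega
    have h1 : M x + (j + 1 : ℕ) * c = S (j + 1) x := by
      rw [hmx', tsub_add_cancel_of_le (tsub_pos_iff_lt.mp hpos).le]
    have h2 : S (j + 1) x ≤ orbitIntegral μ k f h x + (densityOp μ k h M x + j * c) := by
      rw [hSsucc, ← hk.densityOp_add_const hMm hh]
      gcongr
      exact densityOp_mono h (hSM j hj) x
    have h3 : M x + c + j * c ≤ orbitIntegral μ k f h x + densityOp μ k h M x + j * c := by
      calc M x + c + j * c = M x + (j + 1 : ℕ) * c := by push_cast; ring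
        _ ≤ _ := by rw [h1, add_assoc]; exact h2
    exact (ENNReal.add_le_add_iff_right (by finiteness)).mp h3
  have hMi : ∫⁻ x, M x ∂μ ≠ ∞ := by
    have hle : ∀ x, M x ≤ ∑ m ∈ Finset.range (n + 1), S m x := fun x =>
      Finset.sup_le fun m hm => tsub_le_self.trans
        (Finset.single_le_sum (f := fun m => S m x) (fun _ _ => zero_le) hm)
    refine ne_top_of_le_ne_top ?_ (lintegral_mono hle)
    rw [lintegral_finsetSum _ fun m _ => hSm m]
    simp only [hS, hk.lintegral_orbitIntegral hf]
    exact (ENNReal.sum_lt_top.mpr fun m _ => by finiteness).ne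
  have hEM : ∫⁻ x in E, M x ∂μ = ∫⁻ x, M x ∂μ := by
    refine setLIntegral_eq_of_support_subset ?_
    intro x hx
    exact pos_iff_ne_zero.mpr hx
  rw [hEeq]
  -- The pointwise bound is integrated over `E` on the left and over the whole space on the right.
  -- The operator preserves integrals, so the finite integral of `M` can be cancelled.
  have key : ∫⁻ x, M x ∂μ + c * μ E ≤
      ∫⁻ x, M x ∂μ + ENNReal.ofReal h * ∫⁻ x, f x ∂μ := by
    calc _ = ∫⁻ x in E, (M x + c) ∂μ := by
          rw [lintegral_add_left hMm, hEM, setLIntegral_const]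
      _ ≤ ∫⁻ x in E, (orbitIntegral μ k f h x + densityOp μ k h M x) ∂μ :=
          setLIntegral_mono' hEm hpt
      _ ≤ ∫⁻ x, (orbitIntegral μ k f h x + densityOp μ k h M x) ∂μ := setLIntegral_le_lintegral _ _
      _ = _ := by
          rw [lintegral_add_left (hk.measurable_orbitIntegral hf h),
            hk.lintegral_orbitIntegral hf, hk.lintegral_densityOp hMm hh, add_comm]
  exact (ENNReal.add_le_add_iff_left hMi).mp key

/-- The weak type `(1,1)` inequality for the ergodic maximal function. -/
theorem IsMarkovDensity.ergodicMaximal_weak_type (hk : IsMarkovDensity μ k) (hf : Measurable f)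
    (hfi : ∫⁻ x, f x ∂μ ≠ ∞) {c : ℝ≥0∞} (hc : c ≠ ∞) :
    c * μ {x | c < ergodicMaximal μ k f x} ≤ ∫⁻ x, f x ∂μ := by
  set E : ℕ → Set X := fun m => {x | ∃ j : ℤ, -(m : ℤ) ≤ j ∧ j ≤ m ∧
    c < (ENNReal.ofReal ((4 : ℝ) ^ j))⁻¹ * orbitIntegral μ k f ((4 : ℝ) ^ j) x} with hE
  have hmono : Monotone E := fun m n hmn x ⟨j, h1, h2, h3⟩ => ⟨j, by omega, by omega, h3⟩
  have hU : {x | c < ergodicMaximal μ k f x} = ⋃ m, E m := by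
    ext x
    simp only [mem_iUnion, ergodicMaximal, hE]
    change c < _ ↔ _
    rw [lt_iSup_iff]
    constructor
    · rintro ⟨j, hj⟩
      exact ⟨j.natAbs, j, by omega, by omega, hj⟩
    · rintro ⟨m, j, -, -, hj⟩
      exact ⟨j, hj⟩
  rw [hU, hmono.measure_iUnion, ENNReal.mul_iSup]
  refine iSup_le fun m => ?_
  -- All times `4^j` with `|j| ≤ m` are integer multiples of `h`, by factors at most `4^(2m)`.
  -- Hopf's inequality is applied at level `h c`, and `h` cancels.
  set h : ℝ := (4 : ℝ) ^ (-(m : ℤ)) with hh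
  have hh0 : 0 < h := by positivity
  have hsub : E m ⊆ {x | ∃ i ≤ 4 ^ (2 * m), (i : ℕ) * (ENNReal.ofReal h * c) <
      orbitIntegral μ k f (i * h) x} := by
    rintro x ⟨j, h1, h2, h3⟩
    obtain ⟨i, hi⟩ := Int.eq_ofNat_of_zero_le (show 0 ≤ j + m by omega)
    refine ⟨4 ^ i, Nat.pow_le_pow_right (by norm_num) (by omega), ?_⟩
    have e : ((4 ^ i : ℕ) : ℝ) * h = (4 : ℝ) ^ j := by
      rw [hh]; push_cast
      rw [← zpow_natCast, ← zpow_add₀ (by norm_num)]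
      congr 1; omega
    have e' : ((4 ^ i : ℕ) : ℝ≥0∞) * ENNReal.ofReal h = ENNReal.ofReal ((4 : ℝ) ^ j) := by
      rw [← e, ENNReal.ofReal_mul (by positivity), ENNReal.ofReal_natCast]
    rw [e, ← mul_assoc, e']
    have hp : ENNReal.ofReal ((4 : ℝ) ^ j) ≠ 0 := by
      rw [Ne, ENNReal.ofReal_eq_zero, not_le]; positivity
    rw [mul_comm _ c, ← ENNReal.lt_div_iff_mul_lt (Or.inl hp) (Or.inl ENNReal.ofReal_ne_top),
      ENNReal.div_eq_inv_mul]
    exact h3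
  have hhop := hk.hopf_maximal hf hfi hh0 (c := ENNReal.ofReal h * c) (by finiteness) (4 ^ (2 * m))
  rw [mul_assoc] at hhop
  have h0 : ENNReal.ofReal h ≠ 0 := by
    rw [Ne, ENNReal.ofReal_eq_zero, not_le]; exact hh0
  have := (ENNReal.mul_le_mul_iff_right h0 ENNReal.ofReal_ne_top).mp hhop
  exact (mul_le_mul_right (measure_mono hsub) c).trans this

theorem IsMarkovDensity.lintegral_lintegral_stableDensity (hk : IsMarkovDensity μ k)
    (hf : Measurable f) {t : ℝ} (ht : 0 < t) :
    ∫⁻ x, (∫⁻ s in Ioi (0 : ℝ), densityOp μ k s f x * ENNReal.ofReal (stableDensity t s)) ∂μ =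
      ∫⁻ x, f x ∂μ := by
  have hψ : Measurable fun s => ENNReal.ofReal (stableDensity t s) :=
    (measurable_stableDensity t).ennreal_ofReal
  have hm : Measurable fun p : X × ℝ =>
      densityOp μ k p.2 f p.1 * ENNReal.ofReal (stableDensity t p.2) :=
    ((hk.measurable_densityOp hf).comp measurable_swap).mul (hψ.comp measurable_snd)
  rw [lintegral_lintegral_swap (f := fun x s => densityOp μ k s f x *
    ENNReal.ofReal (stableDensity t s)) hm.aemeasurable]
  have : ∀ s ∈ Ioi (0 : ℝ), ∫⁻ x, densityOp μ k s f x * ENNReal.ofReal (stableDensity t s) ∂μ =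
      (∫⁻ x, f x ∂μ) * ENNReal.ofReal (stableDensity t s) := fun s hs => by
    rw [lintegral_mul_const _ (hk.measurable_densityOp_right hf s), hk.lintegral_densityOp hf hs]
  rw [setLIntegral_congr_fun measurableSet_Ioi this, lintegral_const_mul _ hψ,
    lintegral_stableDensity ht, mul_one]

end MaximalInequality

/-! ### Expansions on the cube: summability, density and positivity. -/

section JacobiExpansions

/-- The supremum of `|p_n|` over `[-1,1]`. -/
def jacobiSup₁ (a b : ℝ) (n : ℕ) : ℝ := sSup ((fun x => |jacobiPoly₁ a b n x|) '' Icc (-1) 1)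

theorem abs_jacobiPoly₁_le_sup (a b : ℝ) (n : ℕ) {x : ℝ} (hx : x ∈ Icc (-1 : ℝ) 1) :
    |jacobiPoly₁ a b n x| ≤ jacobiSup₁ a b n :=
  le_csSup (isCompact_Icc.image (continuous_jacobiPoly₁ a b n).abs).bddAbove
    (mem_image_of_mem _ hx)

theorem jacobiSup₁_nonneg (a b : ℝ) (n : ℕ) : 0 ≤ jacobiSup₁ a b n :=
  (abs_nonneg _).trans (abs_jacobiPoly₁_le_sup a b n (x := 0) (by norm_num))

theorem summable_exp_mul_jacobiSup₁ {a b : ℝ} (ha : -(1 / 2) < a) (hb : -(1 / 2) < b) {t : ℝ}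
    (ht : 0 < t) : Summable fun n : ℕ =>
      Real.exp (-((n : ℝ) * (n + a + b + 1) * t)) * (jacobiSup₁ a b n * jacobiSup₁ a b n) := by
  obtain ⟨C, R, hC, hR, h⟩ := exists_abs_jacobiPoly₁_le ha hb
  have hM : ∀ n, jacobiSup₁ a b n ≤ C * R ^ n := fun n =>
    csSup_le (nonempty_Icc.mpr (by norm_num) |>.image _) (by rintro _ ⟨x, hx, rfl⟩; exact h n x hx)
  -- Two factors `R^n` must be absorbed by `exp (-n² t)`; the extra `1` leaves the summable `exp
  -- (-n)`. Completing the square in `n K ≤ n² t + K²/(4t)` does this, and the linear part of the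
  -- eigenvalue only helps.
  set K := 2 * Real.log R + 1 with hK
  refine Summable.of_nonneg_of_le (fun n => mul_nonneg (Real.exp_pos _).le
    (mul_self_nonneg _)) (fun n => ?_)
    ((Real.summable_exp_neg_nat).mul_left (C ^ 2 * Real.exp (K ^ 2 / (4 * t))))
  have hRn : R ^ n = Real.exp (n * Real.log R) := by
    rw [mul_comm, Real.exp_mul, Real.exp_log hR, Real.rpow_natCast]
  calc _ ≤ Real.exp (-((n : ℝ) * (n + a + b + 1) * t)) * ((C * R ^ n) * (C * R ^ n)) := by
        have := jacobiSup₁_nonneg a b n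
        gcongr <;> exact hM n
    _ = C ^ 2 * Real.exp (-((n : ℝ) * (n + a + b + 1) * t) + n * Real.log R + n * Real.log R) := by
        rw [Real.exp_add, Real.exp_add, hRn]; ring
    _ ≤ C ^ 2 * Real.exp (K ^ 2 / (4 * t) + -n) := by
        refine mul_le_mul_of_nonneg_left (Real.exp_le_exp.mpr ?_) (by positivity)
        have h1 : 0 ≤ (n : ℝ) * (a + b + 1) * t := by
          have : 0 ≤ a + b + 1 := by linarith
          positivity
        have h2 : (n : ℝ) * K ≤ n ^ 2 * t + K ^ 2 / (4 * t) := by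
          have : n ^ 2 * t + K ^ 2 / (4 * t) - (n : ℝ) * K = (2 * t * n - K) ^ 2 / (4 * t) := by
            field_simp; ring
          have h3 : 0 ≤ (2 * t * n - K) ^ 2 / (4 * t) := by positivity
          linarith
        have e : (n : ℝ) * (n + a + b + 1) * t = n ^ 2 * t + n * (a + b + 1) * t := by ring
        have e' : (n : ℝ) * K = 2 * (n * Real.log R) + n := by rw [hK]; ring
        rw [e]
        linarith
    _ = _ := by rw [Real.exp_add]; ring

/-- A product of summable nonnegative families is summable over multi-indices. -/
theorem summable_pi_prod {d : ℕ} {g : Fin d → ℕ → ℝ} (h0 : ∀ i n, 0 ≤ g i n)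
    (hg : ∀ i, Summable (g i)) : Summable fun κ : Fin d → ℕ => ∏ i, g i (κ i) := by
  refine summable_of_sum_le (c := ∏ i, ∑' n, g i n)
    (fun κ => Finset.prod_nonneg fun i _ => h0 i _) fun u => ?_
  -- A finite set of multi-indices lies in a box, over which the sum of products factors.
  have hsub : u ⊆ Fintype.piFinset fun i => u.image fun κ => κ i := fun κ hκ =>
    Fintype.mem_piFinset.mpr fun i => Finset.mem_image_of_mem _ hκ
  calc _ ≤ ∑ κ ∈ Fintype.piFinset fun i => u.image fun κ => κ i, ∏ i, g i (κ i) :=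
        Finset.sum_le_sum_of_subset_of_nonneg hsub fun κ _ _ =>
          Finset.prod_nonneg fun i _ => h0 i _
    _ = ∏ i, ∑ n ∈ u.image fun κ => κ i, g i n := (Finset.prod_univ_sum _ _).symm
    _ ≤ _ := Finset.prod_le_prod (fun i _ => Finset.sum_nonneg fun n _ => h0 i n)
        fun i _ => (hg i).sum_le_tsum _ fun n _ => h0 i n

variable {d : ℕ} {α β : Fin d → ℝ}

/-- A bound for `|p_κ|` on the cube. -/
def jacobiSup (α β : Fin d → ℝ) (κ : Fin d → ℕ) : ℝ := ∏ i, jacobiSup₁ (α i) (β i) (κ i)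

theorem jacobiSup_nonneg (α β : Fin d → ℝ) (κ : Fin d → ℕ) : 0 ≤ jacobiSup α β κ :=
  Finset.prod_nonneg fun _ _ => jacobiSup₁_nonneg _ _ _

theorem abs_jacobiPoly_le (α β : Fin d → ℝ) (κ : Fin d → ℕ) {x : Fin d → ℝ}
    (hx : x ∈ Icc (-1 : Fin d → ℝ) 1) : |jacobiPoly α β κ x| ≤ jacobiSup α β κ := by
  rw [jacobiPoly, Finset.abs_prod]
  exact Finset.prod_le_prod (fun _ _ => abs_nonneg _) fun i _ =>
    abs_jacobiPoly₁_le_sup _ _ _ ⟨hx.1 i, hx.2 i⟩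

theorem continuous_jacobiPoly (α β : Fin d → ℝ) (κ : Fin d → ℕ) :
    Continuous (jacobiPoly α β κ) :=
  continuous_finsetProd _ fun i _ => (continuous_jacobiPoly₁ _ _ _).comp (continuous_apply i)

theorem summable_exp_mul_jacobiSup (hα : ∀ i, -(1 / 2 : ℝ) < α i) (hβ : ∀ i, -(1 / 2 : ℝ) < β i)
    {t : ℝ} (ht : 0 < t) : Summable fun κ : Fin d → ℕ =>
      Real.exp (-(jacobiEigenvalue α β κ * t)) * (jacobiSup α β κ * jacobiSup α β κ) := by
  refine (summable_pi_prod (fun i n => mul_nonneg (Real.exp_pos _).le (mul_self_nonneg _))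
    fun i => summable_exp_mul_jacobiSup₁ (hα i) (hβ i) ht).congr fun κ => ?_
  rw [Finset.prod_mul_distrib, Finset.prod_mul_distrib, ← Real.exp_sum, Finset.sum_neg_distrib,
    ← Finset.sum_mul]
  rfl

theorem jacobiEigenvalue_nonneg (hα : ∀ i, -(1 / 2 : ℝ) < α i) (hβ : ∀ i, -(1 / 2 : ℝ) < β i)
    (κ : Fin d → ℕ) : 0 ≤ jacobiEigenvalue α β κ :=
  Finset.sum_nonneg fun i _ => by
    have := hα i
    have := hβ i
    have h : (0 : ℝ) ≤ κ i := by positivity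
    exact mul_nonneg h (by linarith)

theorem jacobiEigenvalue_pos (hα : ∀ i, -(1 / 2 : ℝ) < α i) (hβ : ∀ i, -(1 / 2 : ℝ) < β i)
    {κ : Fin d → ℕ} (hκ : κ ≠ 0) : 0 < jacobiEigenvalue α β κ := by
  obtain ⟨i, hi⟩ := Function.ne_iff.mp hκ
  refine Finset.sum_pos' (fun i _ => ?_) ⟨i, Finset.mem_univ i, ?_⟩
  · have := hα i
    have := hβ i
    have h : (0 : ℝ) ≤ κ i := by positivity
    exact mul_nonneg h (by linarith)
  · have := hα i
    have := hβ i
    have h : (0 : ℝ) < κ i := by exact_mod_cast Nat.pos_of_ne_zero hi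
    exact mul_pos h (by linarith)

theorem jacobiEigenvalue_zero (α β : Fin d → ℝ) : jacobiEigenvalue α β 0 = 0 := by
  simp [jacobiEigenvalue]

theorem isFiniteMeasure_jacobiMeasure (hα : ∀ i, -(1 / 2 : ℝ) < α i)
    (hβ : ∀ i, -(1 / 2 : ℝ) < β i) : IsFiniteMeasure (jacobiMeasure α β) := by
  have : ∀ i, IsFiniteMeasure (jacobiMeasure₁ (α i) (β i)) := fun i =>
    isFiniteMeasure_jacobiMeasure₁ (by linarith [hα i]) (by linarith [hβ i])
  unfold jacobiMeasure
  infer_instance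

theorem ae_mem_jacobiMeasure (hα : ∀ i, -(1 / 2 : ℝ) < α i) (hβ : ∀ i, -(1 / 2 : ℝ) < β i) :
    ∀ᵐ x ∂jacobiMeasure α β, x ∈ Icc (-1 : Fin d → ℝ) 1 := by
  have : ∀ i, IsFiniteMeasure (jacobiMeasure₁ (α i) (β i)) := fun i =>
    isFiniteMeasure_jacobiMeasure₁ (by linarith [hα i]) (by linarith [hβ i])
  have h : ∀ᵐ x ∂jacobiMeasure α β, ∀ i, x i ∈ Icc (-1 : ℝ) 1 :=
    eventually_all.mpr fun i =>
      Measure.tendsto_eval_ae_ae.eventually (ae_mem_jacobiMeasure₁ (α i) (β i))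
  filter_upwards [h] with x hx using ⟨fun i => (hx i).1, fun i => (hx i).2⟩

theorem integrable_jacobiMeasure_of_continuous (hα : ∀ i, -(1 / 2 : ℝ) < α i)
    (hβ : ∀ i, -(1 / 2 : ℝ) < β i) {f : (Fin d → ℝ) → ℝ} (hf : Continuous f) :
    Integrable f (jacobiMeasure α β) := by
  have := isFiniteMeasure_jacobiMeasure hα hβ
  obtain ⟨C, hC⟩ := isCompact_Icc.exists_bound_of_continuousOn (s := Icc (-1 : Fin d → ℝ) 1)
    hf.continuousOn
  exact Integrable.of_bound hf.aestronglyMeasurable C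
    ((ae_mem_jacobiMeasure hα hβ).mono fun x hx => hC x hx)

theorem integral_jacobiPoly_mul (hα : ∀ i, -(1 / 2 : ℝ) < α i) (hβ : ∀ i, -(1 / 2 : ℝ) < β i)
    (κ η : Fin d → ℕ) :
    ∫ x, jacobiPoly α β κ x * jacobiPoly α β η x ∂jacobiMeasure α β = if κ = η then 1 else 0 := by
  have : ∀ i, IsFiniteMeasure (jacobiMeasure₁ (α i) (β i)) := fun i =>
    isFiniteMeasure_jacobiMeasure₁ (by linarith [hα i]) (by linarith [hβ i])
  simp only [jacobiPoly, ← Finset.prod_mul_distrib]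
  rw [jacobiMeasure, integral_fintype_prod_eq_prod (fun i y =>
    jacobiPoly₁ (α i) (β i) (κ i) y * jacobiPoly₁ (α i) (β i) (η i) y)]
  simp only [integral_jacobiPoly₁_mul (hα _) (hβ _)]
  split_ifs with h
  · subst h; simp
  · obtain ⟨i, hi⟩ := Function.ne_iff.mp h
    exact Finset.prod_eq_zero (Finset.mem_univ i) (if_neg hi)

/-- A finite linear combination of normalized Jacobi polynomials. -/
def jacobiExpand (α β : Fin d → ℝ) (F : Finset (Fin d → ℕ)) (c : (Fin d → ℕ) → ℝ)
    (x : Fin d → ℝ) : ℝ := ∑ κ ∈ F, c κ * jacobiPoly α β κ x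

theorem continuous_jacobiExpand (α β : Fin d → ℝ) (F : Finset (Fin d → ℕ))
    (c : (Fin d → ℕ) → ℝ) : Continuous (jacobiExpand α β F c) :=
  continuous_finsetSum _ fun κ _ => (continuous_jacobiPoly α β κ).const_mul (c κ)

theorem integral_jacobiExpand_mul (hα : ∀ i, -(1 / 2 : ℝ) < α i) (hβ : ∀ i, -(1 / 2 : ℝ) < β i)
    (F : Finset (Fin d → ℕ)) (c : (Fin d → ℕ) → ℝ) (η : Fin d → ℕ) :
    ∫ x, jacobiExpand α β F c x * jacobiPoly α β η x ∂jacobiMeasure α β =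
      if η ∈ F then c η else 0 := by
  simp only [jacobiExpand, Finset.sum_mul, mul_assoc]
  have hi : ∀ κ ∈ F, Integrable (fun x => c κ * (jacobiPoly α β κ x * jacobiPoly α β η x))
      (jacobiMeasure α β) := fun κ _ => (integrable_jacobiMeasure_of_continuous hα hβ
    ((continuous_jacobiPoly α β κ).mul (continuous_jacobiPoly α β η))).const_mul (c κ)
  rw [integral_finsetSum _ hi]
  simp only [integral_const_mul, integral_jacobiPoly_mul hα hβ, mul_ite, mul_one, mul_zero]
  simp

/-- Every polynomial is a finite combination of normalized Jacobi polynomials. -/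
theorem exists_jacobiExpand (hα : ∀ i, -(1 / 2 : ℝ) < α i) (hβ : ∀ i, -(1 / 2 : ℝ) < β i)
    (q : MvPolynomial (Fin d) ℝ) :
    ∃ F c, ∀ x, MvPolynomial.eval x q = jacobiExpand α β F c x := by
  set V : Submodule ℝ ((Fin d → ℝ) → ℝ) := Submodule.span ℝ (range (jacobiPoly α β)) with hV
  suffices h : (fun x => MvPolynomial.eval x q) ∈ V by
    obtain ⟨c, hc⟩ := (Finsupp.mem_span_range_iff_exists_finsupp).mp h
    refine ⟨c.support, c, fun x => ?_⟩
    have := congrFun hc x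
    simp only [Finsupp.sum, Finset.sum_apply, Pi.smul_apply, smul_eq_mul] at this
    exact this.symm
  have h1 : ∀ i : Fin d, ∀ m : ℕ, ∃ (s : Finset ℕ) (c : ℕ → ℝ), ∀ y : ℝ,
      y ^ m = ∑ n ∈ s, c n * jacobiPoly₁ (α i) (β i) n y := by
    intro i m
    have hm : (Polynomial.X ^ m : Polynomial ℝ) ∈
        Submodule.span ℝ (range (jacobiPolynomial (α i) (β i))) := by
      rw [span_jacobiPolynomial (by linarith [hα i]) (by linarith [hβ i])]; trivial
    obtain ⟨c, hc⟩ := (Finsupp.mem_span_range_iff_exists_finsupp).mp hm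
    refine ⟨c.support,
      fun n => c n * √(∫ y, jacobiP (α i) (β i) n y ^ 2 ∂jacobiMeasure₁ (α i) (β i)),
      fun y => ?_⟩
    have hy := congrArg (Polynomial.eval y) hc
    rw [Polynomial.eval_pow, Polynomial.eval_X] at hy
    rw [← hy, Finsupp.sum, Polynomial.eval_finsetSum]
    refine Finset.sum_congr rfl fun n _ => ?_
    have hpos := Real.sqrt_pos.mpr (integral_jacobiP_sq_pos (hα i) (hβ i) n)
    rw [Polynomial.eval_smul, jacobiPolynomial_eval, smul_eq_mul, jacobiPoly₁]
    field_simp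
  choose s e he using h1
  induction q using MvPolynomial.induction_on' with
  | monomial m a =>
    have hmon : (fun x : Fin d → ℝ => MvPolynomial.eval x (MvPolynomial.monomial m a)) =
        ∑ κ ∈ Fintype.piFinset fun i => s i (m i),
          (a * ∏ i, e i (m i) (κ i)) • jacobiPoly α β κ := by
      ext x
      rw [MvPolynomial.eval_monomial, Finsupp.prod_fintype _ _ (by simp)]
      rw [Finset.prod_congr rfl fun i _ => he i (m i) (x i), Finset.prod_univ_sum,
        Finset.mul_sum, Finset.sum_apply]
      refine Finset.sum_congr rfl fun κ _ => ?_
      rw [Finset.prod_mul_distrib, Pi.smul_apply, smul_eq_mul, jacobiPoly, mul_assoc]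
    rw [hmon]
    exact Submodule.sum_mem _ fun κ _ => Submodule.smul_mem _ _
      (Submodule.subset_span (mem_range_self κ))
  | add p q hp hq =>
    have : (fun x : Fin d → ℝ => MvPolynomial.eval x (p + q)) =
        (fun x => MvPolynomial.eval x p) + fun x => MvPolynomial.eval x q := by
      ext x; simp
    rw [this]
    exact V.add_mem hp hq

/-- Weierstrass approximation by polynomials on the cube. -/
theorem exists_mvPolynomial_near {f : (Fin d → ℝ) → ℝ} (hf : Continuous f) {ε : ℝ} (hε : 0 < ε) :
    ∃ q : MvPolynomial (Fin d) ℝ, ∀ x ∈ Icc (-1 : Fin d → ℝ) 1,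
      |MvPolynomial.eval x q - f x| < ε := by
  set X : Fin d → C(Fin d → ℝ, ℝ) := fun i => ⟨fun x => x i, continuous_apply i⟩ with hX
  set A : Subalgebra ℝ C(Fin d → ℝ, ℝ) := (MvPolynomial.aeval (R := ℝ) X).range
  have hA : A.SeparatesPoints := by
    intro x y hxy
    obtain ⟨i, hi⟩ := Function.ne_iff.mp hxy
    exact ⟨fun x => x i, ⟨X i, ⟨MvPolynomial.X i, by simp⟩, rfl⟩, hi⟩
  obtain ⟨g, ⟨q, hq⟩, hgf⟩ :=
    ContinuousMap.exists_mem_subalgebra_near_continuous_of_isCompact_of_separatesPoints hA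
      ⟨f, hf⟩ (isCompact_Icc (a := (-1 : Fin d → ℝ)) (b := 1)) hε
  refine ⟨q, fun x hx => ?_⟩
  have hev : ∀ p : MvPolynomial (Fin d) ℝ,
      (MvPolynomial.aeval (R := ℝ) X p : C(Fin d → ℝ, ℝ)) x = MvPolynomial.eval x p := by
    intro p
    induction p using MvPolynomial.induction_on with
    | C a => simp
    | add p q hp hq => simp [hp, hq]
    | mul_X p i hp =>
      rw [map_mul, map_mul, ContinuousMap.mul_apply, hp, MvPolynomial.aeval_X,
        MvPolynomial.eval_X]
      rfl
  have := hgf x hx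
  rw [← hq] at this
  rw [← hev, ← Real.norm_eq_abs]
  exact this

theorem exists_jacobiExpand_near (hα : ∀ i, -(1 / 2 : ℝ) < α i) (hβ : ∀ i, -(1 / 2 : ℝ) < β i)
    {f : (Fin d → ℝ) → ℝ} (hf : Continuous f) {ε : ℝ} (hε : 0 < ε) :
    ∃ F c, ∀ x ∈ Icc (-1 : Fin d → ℝ) 1, |jacobiExpand α β F c x - f x| < ε := by
  obtain ⟨q, hq⟩ := exists_mvPolynomial_near hf hε
  obtain ⟨F, c, h⟩ := exists_jacobiExpand hα hβ q
  exact ⟨F, c, fun x hx => by rw [← h]; exact hq x hx⟩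

/-- Expansions are dense in `L¹`. -/
theorem exists_jacobiExpand_lintegral_sub_le (hα : ∀ i, -(1 / 2 : ℝ) < α i)
    (hβ : ∀ i, -(1 / 2 : ℝ) < β i) {f : (Fin d → ℝ) → ℝ} (hf : Integrable f (jacobiMeasure α β))
    {ε : ENNReal} (hε : ε ≠ 0) :
    ∃ F c, ∫⁻ x, ‖f x - jacobiExpand α β F c x‖ₑ ∂jacobiMeasure α β ≤ ε := by
  have := isFiniteMeasure_jacobiMeasure hα hβ
  obtain ⟨g, -, hg, hgc, hgi⟩ :=
    hf.exists_hasCompactSupport_lintegral_sub_le (ENNReal.half_pos hε).ne'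
  obtain ⟨δ, hδ0, hδ⟩ : ∃ δ : NNReal, 0 < δ ∧ δ * jacobiMeasure α β univ ≤ ε / 2 := by
    obtain ⟨δ, hδ0, hδ⟩ := ENNReal.exists_nnreal_pos_mul_lt (measure_ne_top (jacobiMeasure α β) univ)
      (ENNReal.half_pos hε).ne'
    exact ⟨δ, hδ0, hδ.le⟩
  obtain ⟨F, c, h⟩ := exists_jacobiExpand_near hα hβ hgc (ε := δ) (by exact_mod_cast hδ0)
  refine ⟨F, c, ?_⟩
  have hc := continuous_jacobiExpand α β F c
  calc _ ≤ ∫⁻ x, (‖f x - g x‖ₑ + ‖g x - jacobiExpand α β F c x‖ₑ) ∂jacobiMeasure α β := by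
        refine lintegral_mono fun x => ?_
        rw [← sub_add_sub_cancel (f x) (g x)]
        exact enorm_add_le _ _
    _ = ∫⁻ x, ‖f x - g x‖ₑ ∂jacobiMeasure α β +
          ∫⁻ x, ‖g x - jacobiExpand α β F c x‖ₑ ∂jacobiMeasure α β :=
        lintegral_add_right _ (hgc.sub hc).enorm.measurable
    _ ≤ ε / 2 + ∫⁻ _, (δ : ENNReal) ∂jacobiMeasure α β := by
        refine add_le_add hg (lintegral_mono_ae ?_)
        filter_upwards [ae_mem_jacobiMeasure hα hβ] with x hx
        rw [← ofReal_norm, Real.norm_eq_abs, abs_sub_comm]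
        exact (ENNReal.ofReal_le_ofReal (h x hx).le).trans (by simp)
    _ ≤ ε / 2 + ε / 2 := by rw [lintegral_const]; gcongr
    _ = ε := ENNReal.add_halves ε

/-- The resolvent of the Jacobi operator preserves nonnegativity on the cube. -/
theorem jacobiExpand_resolvent_nonneg (hα : ∀ i, -(1 / 2 : ℝ) < α i)
    (hβ : ∀ i, -(1 / 2 : ℝ) < β i) (F : Finset (Fin d → ℕ)) (c : (Fin d → ℕ) → ℝ) {h : ℝ}
    (hh : 0 ≤ h) (hpos : ∀ x ∈ Icc (-1 : Fin d → ℝ) 1, 0 ≤ jacobiExpand α β F c x) :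
    ∀ x ∈ Icc (-1 : Fin d → ℝ) 1,
      0 ≤ jacobiExpand α β F (fun κ => c κ * (1 + h * jacobiEigenvalue α β κ)⁻¹) x := by
  set c' : (Fin d → ℕ) → ℝ := fun κ => c κ * (1 + h * jacobiEigenvalue α β κ)⁻¹ with hc'
  obtain ⟨x₀, hx₀, hmin⟩ := isCompact_Icc.exists_isMinOn (s := Icc (-1 : Fin d → ℝ) 1)
    ⟨0, by constructor <;> intro i <;> simp⟩ (continuous_jacobiExpand α β F c').continuousOn
  -- Only the minimum point `x₀` matters. There the resolvent equation expresses the new function as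
  -- the old one plus `h` times the Jacobi operator of the new one, and both terms are nonnegative.
  suffices hx : 0 ≤ jacobiExpand α β F c' x₀ from fun x hx' => hx.trans (hmin hx')
  have hL : ∀ i : Fin d, 0 ≤ ∑ κ ∈ F, -((κ i : ℝ) * (κ i + α i + β i + 1)) *
      (c' κ * jacobiPoly α β κ x₀) := by
    intro i
    set N : ℕ → ℝ := fun n => √(∫ y, jacobiP (α i) (β i) n y ^ 2 ∂jacobiMeasure₁ (α i) (β i))
    set A : (Fin d → ℕ) → ℝ := fun κ => c' κ *
      (∏ j ∈ Finset.univ.erase i, jacobiPoly₁ (α j) (β j) (κ j) (x₀ j)) * (N (κ i))⁻¹ with hA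
    -- The restriction to the line through `x₀` in direction `i`. It is minimal on `[-1,1]` at `x₀
    -- i`, so the one-dimensional minimum principle applies to each coordinate separately.
    set g : Polynomial ℝ := ∑ κ ∈ F, A κ • jacobiPolynomial (α i) (β i) (κ i) with hg
    have hterm : ∀ κ, ∀ y, A κ * jacobiP (α i) (β i) (κ i) y =
        c' κ * jacobiPoly α β κ (Function.update x₀ i y) := by
      intro κ y
      rw [jacobiPoly, ← Finset.mul_prod_erase _ _ (Finset.mem_univ i), Function.update_self]
      have : ∏ j ∈ Finset.univ.erase i, jacobiPoly₁ (α j) (β j) (κ j) (Function.update x₀ i y j) =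
          ∏ j ∈ Finset.univ.erase i, jacobiPoly₁ (α j) (β j) (κ j) (x₀ j) :=
        Finset.prod_congr rfl fun j hj => by
          rw [Function.update_of_ne (Finset.ne_of_mem_erase hj)]
      rw [this, jacobiPoly₁, hA]
      ring
    have hgev : ∀ y, g.eval y = jacobiExpand α β F c' (Function.update x₀ i y) := by
      intro y
      rw [hg, Polynomial.eval_finsetSum, jacobiExpand]
      refine Finset.sum_congr rfl fun κ _ => ?_
      rw [Polynomial.eval_smul, jacobiPolynomial_eval, smul_eq_mul, hterm]
    have hmin' : ∀ z ∈ Icc (-1 : ℝ) 1, g.eval (x₀ i) ≤ g.eval z := by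
      intro z hz
      rw [hgev, hgev, Function.update_eq_self]
      refine hmin ⟨fun j => ?_, fun j => ?_⟩
      · by_cases hj : j = i
        · subst hj; simpa using hz.1
        · simpa [Function.update_of_ne hj] using hx₀.1 j
      · by_cases hj : j = i
        · subst hj; simpa using hz.2
        · simpa [Function.update_of_ne hj] using hx₀.2 j
    have := jacobiOp_eval_nonneg_of_isMinOn (by linarith [hα i] : -1 < α i)
      (by linarith [hβ i] : -1 < β i) g ⟨hx₀.1 i, hx₀.2 i⟩ hmin'
    rw [hg, map_sum, Polynomial.eval_finsetSum] at this
    refine this.trans_eq (Finset.sum_congr rfl fun κ _ => ?_)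
    rw [map_smul, jacobiOp_jacobiPolynomial, Polynomial.eval_smul, Polynomial.eval_smul,
      jacobiPolynomial_eval, smul_eq_mul, smul_eq_mul, mul_left_comm, hterm,
      Function.update_eq_self]
  have hsum := Finset.sum_nonneg fun i (_ : i ∈ Finset.univ) => hL i
  rw [Finset.sum_comm] at hsum
  have hdecomp : jacobiExpand α β F c' x₀ = jacobiExpand α β F c x₀ +
      h * ∑ κ ∈ F, ∑ i, -((κ i : ℝ) * (κ i + α i + β i + 1)) * (c' κ * jacobiPoly α β κ x₀) := by
    rw [jacobiExpand, jacobiExpand, Finset.mul_sum, ← Finset.sum_add_distrib]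
    refine Finset.sum_congr rfl fun κ _ => ?_
    rw [← Finset.sum_mul, Finset.sum_neg_distrib]
    change _ = _ + h * (-jacobiEigenvalue α β κ * _)
    have : 1 + h * jacobiEigenvalue α β κ ≠ 0 := by
      have := jacobiEigenvalue_nonneg hα hβ κ
      positivity
    simp only [hc']
    field_simp
    ring
  rw [hdecomp]
  exact add_nonneg (hpos x₀ hx₀) (mul_nonneg hh hsum)

/-- The Jacobi semigroup preserves nonnegativity of polynomials on the cube. -/
theorem jacobiExpand_exp_nonneg (hα : ∀ i, -(1 / 2 : ℝ) < α i)
    (hβ : ∀ i, -(1 / 2 : ℝ) < β i) (F : Finset (Fin d → ℕ)) (c : (Fin d → ℕ) → ℝ) {t : ℝ}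
    (ht : 0 ≤ t) (hpos : ∀ x ∈ Icc (-1 : Fin d → ℝ) 1, 0 ≤ jacobiExpand α β F c x)
    {x : Fin d → ℝ} (hx : x ∈ Icc (-1 : Fin d → ℝ) 1) :
    0 ≤ jacobiExpand α β F (fun κ => c κ * Real.exp (-(jacobiEigenvalue α β κ * t))) x := by
  -- Powers of resolvents stay positive, and `(1 + t λ / n)^(-n)` tends to `exp (-λ t)`. The index
  -- `n = 0` is harmless, with `t / 0 = 0`.
  have hiter : ∀ h : ℝ, 0 ≤ h → ∀ n : ℕ, ∀ x ∈ Icc (-1 : Fin d → ℝ) 1,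
      0 ≤ jacobiExpand α β F
        (fun κ => c κ * ((1 + h * jacobiEigenvalue α β κ) ^ n)⁻¹) x := by
    intro h hh n
    induction n with
    | zero => simpa using hpos
    | succ n ih =>
      have := jacobiExpand_resolvent_nonneg hα hβ F _ hh ih
      simpa only [mul_assoc, ← mul_inv, ← pow_succ] using this
  have hlim : Tendsto (fun n : ℕ => jacobiExpand α β F
      (fun κ => c κ * ((1 + t / n * jacobiEigenvalue α β κ) ^ n)⁻¹) x) atTop
      (𝓝 (jacobiExpand α β F (fun κ => c κ * Real.exp (-(jacobiEigenvalue α β κ * t))) x)) := by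
    refine tendsto_finsetSum _ fun κ _ => Tendsto.mul_const _ (Tendsto.const_mul _ ?_)
    rw [Real.exp_neg]
    refine Tendsto.inv₀ ?_ (Real.exp_pos _).ne'
    refine (Real.tendsto_one_add_div_pow_exp (jacobiEigenvalue α β κ * t)).congr fun n => ?_
    congr 1; ring
  exact ge_of_tendsto' hlim fun n => hiter (t / n) (by positivity) n x hx

end JacobiExpansions

/-! ### The Jacobi heat kernel is a symmetric Markov density. -/

section JacobiSemigroup

variable {d : ℕ} {α β : Fin d → ℝ}

/-- The nearest-point map onto the cube `[-1,1]^d`. -/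
def cubeProj (x : Fin d → ℝ) (i : Fin d) : ℝ := max (-1) (min 1 (x i))

theorem cubeProj_mem (x : Fin d → ℝ) : cubeProj x ∈ Icc (-1 : Fin d → ℝ) 1 :=
  ⟨fun _ => le_max_left _ _, fun _ => max_le (by norm_num) (min_le_left _ _)⟩

theorem cubeProj_of_mem {x : Fin d → ℝ} (hx : x ∈ Icc (-1 : Fin d → ℝ) 1) : cubeProj x = x := by
  ext i
  have h1 : -1 ≤ x i := hx.1 i
  have h2 : x i ≤ 1 := hx.2 i
  rw [cubeProj, min_eq_right h2, max_eq_right h1]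

theorem continuous_cubeProj : Continuous (cubeProj : (Fin d → ℝ) → Fin d → ℝ) :=
  continuous_pi fun i => continuous_const.max (continuous_const.min (continuous_apply i))

theorem abs_jacobiKernel_term_le (α β : Fin d → ℝ) (t : ℝ) (κ : Fin d → ℕ) {x y : Fin d → ℝ}
    (hx : x ∈ Icc (-1 : Fin d → ℝ) 1) (hy : y ∈ Icc (-1 : Fin d → ℝ) 1) :
    |Real.exp (-(jacobiEigenvalue α β κ * t)) * jacobiPoly α β κ x * jacobiPoly α β κ y| ≤
      Real.exp (-(jacobiEigenvalue α β κ * t)) * (jacobiSup α β κ * jacobiSup α β κ) := by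
  rw [abs_mul, abs_mul, abs_of_pos (Real.exp_pos _), mul_assoc]
  have := jacobiSup_nonneg α β κ
  gcongr
  · exact abs_jacobiPoly_le α β κ hx
  · exact abs_jacobiPoly_le α β κ hy

theorem jacobiKernel_comm (α β : Fin d → ℝ) (t : ℝ) (x y : Fin d → ℝ) :
    jacobiKernel α β t x y = jacobiKernel α β t y x :=
  tsum_congr fun _ => by ring

/-- Composition with `cubeProj` keeps both points in the cube, where `jacobiSup` controls the terms.
The series then converges uniformly for times beyond half of the given one. -/
theorem continuousOn_jacobiKernel (hα : ∀ i, -(1 / 2 : ℝ) < α i)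
    (hβ : ∀ i, -(1 / 2 : ℝ) < β i) :
    ContinuousOn (fun p : (ℝ × (Fin d → ℝ)) × (Fin d → ℝ) =>
      jacobiKernel α β p.1.1 (cubeProj p.1.2) (cubeProj p.2)) {p | 0 < p.1.1} := by
  intro p hp
  have hp' : 0 < p.1.1 := hp
  have hc : ContinuousOn (fun p : (ℝ × (Fin d → ℝ)) × (Fin d → ℝ) =>
      jacobiKernel α β p.1.1 (cubeProj p.1.2) (cubeProj p.2)) {q | p.1.1 / 2 < q.1.1} := by
    refine continuousOn_tsum (fun κ => Continuous.continuousOn ?_)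
      (summable_exp_mul_jacobiSup hα hβ (half_pos hp')) fun κ q hq => ?_
    · exact (Continuous.mul (by fun_prop) ((continuous_jacobiPoly α β κ).comp
        (continuous_cubeProj.comp (by fun_prop)))).mul
        ((continuous_jacobiPoly α β κ).comp (continuous_cubeProj.comp (by fun_prop)))
    · refine (abs_jacobiKernel_term_le α β q.1.1 κ (cubeProj_mem _) (cubeProj_mem _)).trans ?_
      have hq' : p.1.1 / 2 < q.1.1 := hq
      have := jacobiEigenvalue_nonneg hα hβ κ
      have := jacobiSup_nonneg α β κ
      gcongr
  have ho : IsOpen {q : (ℝ × (Fin d → ℝ)) × (Fin d → ℝ) | p.1.1 / 2 < q.1.1} :=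
    isOpen_lt continuous_const (by fun_prop)
  exact (hc.continuousAt (ho.mem_nhds (half_lt_self hp'))).continuousWithinAt

theorem continuous_jacobiKernel_right (hα : ∀ i, -(1 / 2 : ℝ) < α i)
    (hβ : ∀ i, -(1 / 2 : ℝ) < β i) {t : ℝ} (ht : 0 < t) (x : Fin d → ℝ) :
    Continuous fun y => jacobiKernel α β t (cubeProj x) (cubeProj y) := by
  have h := (continuousOn_jacobiKernel hα hβ).comp_continuous
    (f := fun y : Fin d → ℝ => ((t, x), y)) (by fun_prop) fun _ => ht
  exact h

/-- Spectral expansion of the Jacobi semigroup on `L¹`. -/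
theorem hasSum_jacobiT (hα : ∀ i, -(1 / 2 : ℝ) < α i) (hβ : ∀ i, -(1 / 2 : ℝ) < β i)
    {f : (Fin d → ℝ) → ℝ} (hf : Integrable f (jacobiMeasure α β)) {t : ℝ} (ht : 0 < t)
    {x : Fin d → ℝ} (hx : x ∈ Icc (-1 : Fin d → ℝ) 1) :
    HasSum (fun κ => Real.exp (-(jacobiEigenvalue α β κ * t)) * jacobiPoly α β κ x *
      ∫ y, f y * jacobiPoly α β κ y ∂jacobiMeasure α β) (jacobiT α β t f x) := by
  set G : (Fin d → ℕ) → (Fin d → ℝ) → ℝ := fun κ y =>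
    f y * (Real.exp (-(jacobiEigenvalue α β κ * t)) * jacobiPoly α β κ x * jacobiPoly α β κ y)
  have hb : ∀ κ, ∀ᵐ y ∂jacobiMeasure α β, ‖G κ y‖ ≤ ‖f y‖ *
      (Real.exp (-(jacobiEigenvalue α β κ * t)) * (jacobiSup α β κ * jacobiSup α β κ)) := fun κ => by
    filter_upwards [ae_mem_jacobiMeasure hα hβ] with y hy
    rw [norm_mul]
    gcongr
    exact abs_jacobiKernel_term_le α β t κ hx hy
  have hm : ∀ κ, AEStronglyMeasurable (G κ) (jacobiMeasure α β) := fun κ =>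
    hf.1.mul ((continuous_jacobiPoly α β κ).const_mul _).aestronglyMeasurable
  have hG : ∀ κ, Integrable (G κ) (jacobiMeasure α β) := fun κ =>
    (hf.norm.mul_const _).mono' (hm κ) (hb κ)
  have hsum : Summable fun κ => ∫ y, ‖G κ y‖ ∂jacobiMeasure α β := by
    refine Summable.of_nonneg_of_le (fun κ => integral_nonneg fun _ => norm_nonneg _) (fun κ => ?_)
      ((summable_exp_mul_jacobiSup hα hβ ht).mul_left (∫ y, ‖f y‖ ∂jacobiMeasure α β))
    rw [← integral_mul_const]
    exact integral_mono_ae (hG κ).norm (hf.norm.mul_const _) (hb κ)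
  have h := hasSum_integral_of_summable_integral_norm hG hsum
  have e1 : ∫ y, (∑' κ, G κ y) ∂jacobiMeasure α β = jacobiT α β t f x := by
    simp only [G, tsum_mul_left]
    rfl
  rw [e1] at h
  refine h.congr_fun fun κ => ?_
  rw [← integral_const_mul]
  exact integral_congr_ae (Eventually.of_forall fun y => by simp only [G]; ring)

/-- Almost everywhere equality is the right assumption for iterating: `jacobiQ` of an expansion is
identified as an expansion on the cube only. -/
theorem jacobiT_of_ae_eq_expand (hα : ∀ i, -(1 / 2 : ℝ) < α i) (hβ : ∀ i, -(1 / 2 : ℝ) < β i)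
    {f : (Fin d → ℝ) → ℝ} {F : Finset (Fin d → ℕ)} {c : (Fin d → ℕ) → ℝ}
    (hf : f =ᵐ[jacobiMeasure α β] jacobiExpand α β F c) {t : ℝ} (ht : 0 < t)
    {x : Fin d → ℝ} (hx : x ∈ Icc (-1 : Fin d → ℝ) 1) :
    jacobiT α β t f x =
      jacobiExpand α β F (fun κ => c κ * Real.exp (-(jacobiEigenvalue α β κ * t))) x := by
  have hfi : Integrable f (jacobiMeasure α β) := (integrable_jacobiMeasure_of_continuous hα hβ
    (continuous_jacobiExpand α β F c)).congr hf.symm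
  have h := hasSum_jacobiT hα hβ hfi ht hx
  have hint : ∀ κ, ∫ y, f y * jacobiPoly α β κ y ∂jacobiMeasure α β = if κ ∈ F then c κ else 0 :=
    fun κ => by
      rw [← integral_jacobiExpand_mul hα hβ F c κ]
      exact integral_congr_ae (by filter_upwards [hf] with y hy; rw [hy])
  simp only [hint] at h
  refine h.unique ?_
  have h2 : HasSum (fun κ => Real.exp (-(jacobiEigenvalue α β κ * t)) * jacobiPoly α β κ x *
      if κ ∈ F then c κ else 0) (∑ κ ∈ F, Real.exp (-(jacobiEigenvalue α β κ * t)) *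
        jacobiPoly α β κ x * if κ ∈ F then c κ else 0) :=
    hasSum_sum_of_ne_finset_zero fun κ hκ => by simp [hκ]
  convert h2 using 1
  exact Finset.sum_congr rfl fun κ hκ => by simp only [if_pos hκ]; ring

theorem jacobiT_expand (hα : ∀ i, -(1 / 2 : ℝ) < α i) (hβ : ∀ i, -(1 / 2 : ℝ) < β i)
    (F : Finset (Fin d → ℕ)) (c : (Fin d → ℕ) → ℝ) {t : ℝ} (ht : 0 < t)
    {x : Fin d → ℝ} (hx : x ∈ Icc (-1 : Fin d → ℝ) 1) :
    jacobiT α β t (jacobiExpand α β F c) x =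
      jacobiExpand α β F (fun κ => c κ * Real.exp (-(jacobiEigenvalue α β κ * t))) x :=
  jacobiT_of_ae_eq_expand hα hβ (ae_eq_refl _) ht hx

theorem jacobiT_jacobiPoly (hα : ∀ i, -(1 / 2 : ℝ) < α i) (hβ : ∀ i, -(1 / 2 : ℝ) < β i)
    (κ : Fin d → ℕ) {t : ℝ} (ht : 0 < t) {x : Fin d → ℝ} (hx : x ∈ Icc (-1 : Fin d → ℝ) 1) :
    jacobiT α β t (jacobiPoly α β κ) x =
      Real.exp (-(jacobiEigenvalue α β κ * t)) * jacobiPoly α β κ x := by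
  have h := jacobiT_of_ae_eq_expand hα hβ (f := jacobiPoly α β κ) (F := {κ}) (c := fun _ => 1)
    (Eventually.of_forall fun y => by simp [jacobiExpand]) ht hx
  simpa [jacobiExpand] using h

/-- The mode `κ = 0` is a nonzero constant with eigenvalue `0`, so it is fixed by the semigroup and
can be divided out. -/
theorem jacobiT_one (hα : ∀ i, -(1 / 2 : ℝ) < α i) (hβ : ∀ i, -(1 / 2 : ℝ) < β i) {t : ℝ}
    (ht : 0 < t) {x : Fin d → ℝ} (hx : x ∈ Icc (-1 : Fin d → ℝ) 1) :
    ∫ y, jacobiKernel α β t x y ∂jacobiMeasure α β = 1 := by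
  set A : ℝ := ∏ i, (√(∫ y, jacobiP (α i) (β i) 0 y ^ 2 ∂jacobiMeasure₁ (α i) (β i)))⁻¹ with hA
  have hA0 : A ≠ 0 := Finset.prod_ne_zero_iff.mpr fun i _ =>
    inv_ne_zero (Real.sqrt_pos.mpr (integral_jacobiP_sq_pos (hα i) (hβ i) 0)).ne'
  have hp : ∀ y, jacobiPoly α β 0 y = A := fun y => by
    refine Finset.prod_congr rfl fun i _ => ?_
    rw [jacobiPoly₁, div_eq_mul_inv]
    simp [jacobiP, realBinom_zero]
  have h := jacobiT_jacobiPoly hα hβ 0 ht hx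
  simp only [jacobiT, hp, jacobiEigenvalue_zero, zero_mul, neg_zero, Real.exp_zero, one_mul,
    integral_const_mul] at h
  exact mul_left_cancel₀ hA0 (h.trans (mul_one A).symm)

/-- The Jacobi heat kernel is nonnegative. -/
theorem jacobiKernel_nonneg_ae (hα : ∀ i, -(1 / 2 : ℝ) < α i) (hβ : ∀ i, -(1 / 2 : ℝ) < β i)
    {t : ℝ} (ht : 0 < t) (x : Fin d → ℝ) :
    ∀ᵐ y ∂jacobiMeasure α β, 0 ≤ jacobiKernel α β t (cubeProj x) (cubeProj y) := by
  have := isFiniteMeasure_jacobiMeasure hα hβ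
  set μ := jacobiMeasure α β
  set g : (Fin d → ℝ) → ℝ := fun y => jacobiKernel α β t (cubeProj x) (cubeProj y) with hg
  have hgc : Continuous g := continuous_jacobiKernel_right hα hβ ht x
  -- Testing against the negative part `n` of the kernel section `g`: positivity of the semigroup
  -- gives a nonnegative integral of `n g`, yet `n g = -n²`, so `n` vanishes almost everywhere.
  set n : (Fin d → ℝ) → ℝ := fun y => max (-g y) 0 with hn
  have hnc : Continuous n := hgc.neg.max continuous_const
  have hi : ∀ {f : (Fin d → ℝ) → ℝ}, Continuous f → Integrable f μ := fun hf =>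
    integrable_jacobiMeasure_of_continuous hα hβ hf
  have hI : 0 ≤ ∫ y, |g y| ∂μ := integral_nonneg fun _ => abs_nonneg _
  -- Positivity is known for polynomials only. A polynomial within `ε` of `n + ε` is nonnegative on
  -- the cube and differs from `n` by at most `2ε`.
  have key : ∀ ε : ℝ, 0 < ε → -(2 * ε * ∫ y, |g y| ∂μ) ≤ ∫ y, n y * g y ∂μ := by
    intro ε hε
    obtain ⟨F, c, hq⟩ := exists_jacobiExpand_near hα hβ (hnc.add_const ε) hε
    set q := jacobiExpand α β F c with hqdef
    have hqc : Continuous q := continuous_jacobiExpand α β F c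
    have hqpos : ∀ y ∈ Icc (-1 : Fin d → ℝ) 1, 0 ≤ q y := fun y hy => by
      have := (abs_lt.mp (hq y hy)).1
      have : 0 ≤ n y := le_max_right _ _
      linarith
    have hT : 0 ≤ ∫ y, q y * g y ∂μ := by
      have h1 := jacobiExpand_exp_nonneg hα hβ F c ht.le hqpos (cubeProj_mem x)
      rw [← jacobiT_expand hα hβ F c ht (cubeProj_mem x)] at h1
      refine h1.trans_eq (integral_congr_ae ?_)
      filter_upwards [ae_mem_jacobiMeasure hα hβ] with y hy
      simp only [hg, cubeProj_of_mem hy, q]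
    have hdiff : ∫ y, (q y - n y) * g y ∂μ ≤ 2 * ε * ∫ y, |g y| ∂μ := by
      rw [← integral_const_mul]
      refine integral_mono_ae (hi ((hqc.sub hnc).mul hgc)) ((hi hgc.abs).const_mul _) ?_
      filter_upwards [ae_mem_jacobiMeasure hα hβ] with y hy
      have h1 := abs_lt.mp (hq y hy)
      calc (q y - n y) * g y ≤ |(q y - n y) * g y| := le_abs_self _
        _ = |q y - n y| * |g y| := abs_mul _ _
        _ ≤ 2 * ε * |g y| := by
            gcongr
            rw [abs_le]; constructor <;> linarith [h1.1, h1.2]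
    have hsplit : ∫ y, (q y - n y) * g y ∂μ = ∫ y, q y * g y ∂μ - ∫ y, n y * g y ∂μ := by
      have i1 : Integrable (fun y => q y * g y) μ := hi (hqc.mul hgc)
      have i2 : Integrable (fun y => n y * g y) μ := hi (hnc.mul hgc)
      rw [← integral_sub i1 i2]
      simp only [sub_mul]
    linarith
  have h0 : 0 ≤ ∫ y, n y * g y ∂μ := by
    have hlim : Tendsto (fun ε : ℝ => -(2 * ε * ∫ y, |g y| ∂μ)) (𝓝[>] 0) (𝓝 0) := by
      have : Continuous fun ε : ℝ => -(2 * ε * ∫ y, |g y| ∂μ) := by fun_prop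
      have := this.tendsto 0
      simp only [mul_zero, zero_mul, neg_zero] at this
      exact this.mono_left nhdsWithin_le_nhds
    exact le_of_tendsto hlim (by filter_upwards [self_mem_nhdsWithin] with ε hε using key ε hε)
  have hsq : ∀ y, n y * g y = -(n y ^ 2) := fun y => by
    simp only [hn]
    rcases le_total (g y) 0 with h | h
    · rw [max_eq_left (by linarith)]; ring
    · rw [max_eq_right (by linarith)]; ring
  simp only [hsq, integral_neg] at h0
  have hz : ∫ y, n y ^ 2 ∂μ = 0 :=
    le_antisymm (by linarith) (integral_nonneg fun _ => sq_nonneg _)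
  have := (integral_eq_zero_iff_of_nonneg (fun y => sq_nonneg (n y)) (hi (hnc.pow 2))).mp hz
  filter_upwards [this] with y hy
  have hny : n y = 0 := by simpa using hy
  have : -g y ≤ n y := le_max_left _ _
  change 0 ≤ g y
  linarith

/-- Chapman–Kolmogorov on the spectral side: the kernel section at time `s` has coefficients `exp
(-λ_κ s) p_κ(x)`, and the semigroup at time `t` multiplies them by `exp (-λ_κ t)`. -/
theorem integral_jacobiKernel_mul (hα : ∀ i, -(1 / 2 : ℝ) < α i) (hβ : ∀ i, -(1 / 2 : ℝ) < β i)
    {s t : ℝ} (hs : 0 < s) (ht : 0 < t) (x z : Fin d → ℝ) :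
    ∫ y, jacobiKernel α β s (cubeProj x) (cubeProj y) *
      jacobiKernel α β t (cubeProj y) (cubeProj z) ∂jacobiMeasure α β =
        jacobiKernel α β (s + t) (cubeProj x) (cubeProj z) := by
  set f : (Fin d → ℝ) → ℝ := fun y => jacobiKernel α β s (cubeProj x) (cubeProj y) with hf
  have hfi : Integrable f (jacobiMeasure α β) := integrable_jacobiMeasure_of_continuous hα hβ
    (continuous_jacobiKernel_right hα hβ hs x)
  have h1 : ∫ y, f y * jacobiKernel α β t (cubeProj y) (cubeProj z) ∂jacobiMeasure α β =
      jacobiT α β t f (cubeProj z) := by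
    refine integral_congr_ae ?_
    filter_upwards [ae_mem_jacobiMeasure hα hβ] with y hy
    rw [cubeProj_of_mem hy, jacobiKernel_comm]
  have h2 : ∀ κ, ∫ y, f y * jacobiPoly α β κ y ∂jacobiMeasure α β =
      Real.exp (-(jacobiEigenvalue α β κ * s)) * jacobiPoly α β κ (cubeProj x) := fun κ => by
    rw [← jacobiT_jacobiPoly hα hβ κ hs (cubeProj_mem x)]
    refine integral_congr_ae ?_
    filter_upwards [ae_mem_jacobiMeasure hα hβ] with y hy
    simp only [hf, cubeProj_of_mem hy]
    ring
  rw [h1, ← (hasSum_jacobiT hα hβ hfi ht (cubeProj_mem z)).tsum_eq]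
  refine tsum_congr fun κ => ?_
  rw [h2, mul_add, neg_add, Real.exp_add]
  ring

/-- The Jacobi heat kernel, extended to the whole space, as an extended nonnegative density. -/
def jacobiDensity (α β : Fin d → ℝ) (s : ℝ) (x y : Fin d → ℝ) : ENNReal :=
  if 0 < s then ENNReal.ofReal (jacobiKernel α β s (cubeProj x) (cubeProj y)) else 0

theorem isMarkovDensity_jacobiDensity (hα : ∀ i, -(1 / 2 : ℝ) < α i)
    (hβ : ∀ i, -(1 / 2 : ℝ) < β i) : IsMarkovDensity (jacobiMeasure α β) (jacobiDensity α β) where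
  measurable := by
    have hs : MeasurableSet {p : (ℝ × (Fin d → ℝ)) × (Fin d → ℝ) | 0 < p.1.1} :=
      measurableSet_lt measurable_const (by fun_prop)
    have h := (ENNReal.continuous_ofReal.comp_continuousOn
      (continuousOn_jacobiKernel hα hβ)).measurable_piecewise
      (continuousOn_const (c := (0 : ENNReal))) hs
    convert h using 1
    ext p
    simp [piecewise, jacobiDensity]
  symm hs x y := by
    unfold jacobiDensity
    rw [jacobiKernel_comm]
  lintegral_eq_one {s} hs x := by
    simp only [jacobiDensity, if_pos hs]
    rw [← ofReal_integral_eq_lintegral_ofReal (integrable_jacobiMeasure_of_continuous hα hβ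
      (continuous_jacobiKernel_right hα hβ hs x)) (jacobiKernel_nonneg_ae hα hβ hs x)]
    have : ∫ y, jacobiKernel α β s (cubeProj x) (cubeProj y) ∂jacobiMeasure α β = 1 := by
      rw [← jacobiT_one hα hβ hs (cubeProj_mem x)]
      refine integral_congr_ae ?_
      filter_upwards [ae_mem_jacobiMeasure hα hβ] with y hy
      rw [cubeProj_of_mem hy]
    rw [this, ENNReal.ofReal_one]
  chapman {s t} hs ht x z := by
    simp only [jacobiDensity, if_pos hs, if_pos ht, if_pos (add_pos hs ht)]
    have hz : ∀ᵐ y ∂jacobiMeasure α β, 0 ≤ jacobiKernel α β t (cubeProj y) (cubeProj z) := by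
      filter_upwards [jacobiKernel_nonneg_ae hα hβ ht z] with y hy
      rwa [jacobiKernel_comm]
    have hc : Continuous fun y => jacobiKernel α β t (cubeProj y) (cubeProj z) := by
      simp only [jacobiKernel_comm α β t _ (cubeProj z)]
      exact continuous_jacobiKernel_right hα hβ ht z
    have hi : Integrable (fun y => jacobiKernel α β s (cubeProj x) (cubeProj y) *
        jacobiKernel α β t (cubeProj y) (cubeProj z)) (jacobiMeasure α β) :=
      integrable_jacobiMeasure_of_continuous hα hβ
        ((continuous_jacobiKernel_right hα hβ hs x).mul hc)
    rw [← integral_jacobiKernel_mul hα hβ hs ht x z, ofReal_integral_eq_lintegral_ofReal hi]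
    · refine lintegral_congr_ae ?_
      filter_upwards [jacobiKernel_nonneg_ae hα hβ hs x] with y hy
      rw [ENNReal.ofReal_mul hy]
    · filter_upwards [jacobiKernel_nonneg_ae hα hβ hs x, hz] with y h1 h2 using mul_nonneg h1 h2

theorem integrable_mul_jacobiKernel (hα : ∀ i, -(1 / 2 : ℝ) < α i)
    (hβ : ∀ i, -(1 / 2 : ℝ) < β i) {f : (Fin d → ℝ) → ℝ} (hf : Integrable f (jacobiMeasure α β))
    {t : ℝ} (ht : 0 < t) {x : Fin d → ℝ} (hx : x ∈ Icc (-1 : Fin d → ℝ) 1) :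
    Integrable (fun y => f y * jacobiKernel α β t x y) (jacobiMeasure α β) := by
  have hc := continuous_jacobiKernel_right hα hβ ht x
  obtain ⟨C, hC⟩ := isCompact_Icc.exists_bound_of_continuousOn (s := Icc (-1 : Fin d → ℝ) 1)
    hc.continuousOn
  have hi : Integrable (fun y => f y * jacobiKernel α β t (cubeProj x) (cubeProj y))
      (jacobiMeasure α β) := hf.mul_bdd hc.aestronglyMeasurable
        ((ae_mem_jacobiMeasure hα hβ).mono fun y hy => hC y hy)
  refine hi.congr ?_
  filter_upwards [ae_mem_jacobiMeasure hα hβ] with y hy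
  rw [cubeProj_of_mem hx, cubeProj_of_mem hy]

theorem jacobiT_sub (hα : ∀ i, -(1 / 2 : ℝ) < α i) (hβ : ∀ i, -(1 / 2 : ℝ) < β i)
    {f g : (Fin d → ℝ) → ℝ} (hf : Integrable f (jacobiMeasure α β))
    (hg : Integrable g (jacobiMeasure α β)) {t : ℝ} (ht : 0 < t) {x : Fin d → ℝ}
    (hx : x ∈ Icc (-1 : Fin d → ℝ) 1) :
    jacobiT α β t (fun y => f y - g y) x = jacobiT α β t f x - jacobiT α β t g x := by
  unfold jacobiT
  rw [← integral_sub (integrable_mul_jacobiKernel hα hβ hf ht hx)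
    (integrable_mul_jacobiKernel hα hβ hg ht hx)]
  simp only [sub_mul]

theorem enorm_jacobiT_le (hα : ∀ i, -(1 / 2 : ℝ) < α i) (hβ : ∀ i, -(1 / 2 : ℝ) < β i)
    (f : (Fin d → ℝ) → ℝ) {t : ℝ} (ht : 0 < t) {x : Fin d → ℝ}
    (hx : x ∈ Icc (-1 : Fin d → ℝ) 1) :
    ‖jacobiT α β t f x‖ₑ ≤
      densityOp (jacobiMeasure α β) (jacobiDensity α β) t (fun y => ‖f y‖ₑ) x := by
  refine (enorm_integral_le_lintegral_enorm _).trans_eq (lintegral_congr_ae ?_)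
  filter_upwards [ae_mem_jacobiMeasure hα hβ, jacobiKernel_nonneg_ae hα hβ ht x] with y hy h0
  rw [enorm_mul, mul_comm, jacobiDensity, if_pos ht, ← Real.enorm_of_nonneg h0,
    cubeProj_of_mem hx, cubeProj_of_mem hy]

/-- Supplies a version jointly measurable in time and space; agreement on the cube is enough, since
the measure is carried by it. -/
theorem aestronglyMeasurable_jacobiT (hα : ∀ i, -(1 / 2 : ℝ) < α i)
    (hβ : ∀ i, -(1 / 2 : ℝ) < β i) {f : (Fin d → ℝ) → ℝ}
    (hf : AEStronglyMeasurable f (jacobiMeasure α β)) :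
    ∃ T : ℝ × (Fin d → ℝ) → ℝ, StronglyMeasurable T ∧
      ∀ s, 0 < s → ∀ x ∈ Icc (-1 : Fin d → ℝ) 1, jacobiT α β s f x = T (s, x) := by
  have := isFiniteMeasure_jacobiMeasure hα hβ
  have hs : MeasurableSet {p : (ℝ × (Fin d → ℝ)) × (Fin d → ℝ) | 0 < p.1.1} :=
    measurableSet_lt measurable_const (by fun_prop)
  have hk := ((continuousOn_jacobiKernel hα hβ).measurable_piecewise
    (continuousOn_const (c := (0 : ℝ))) hs).stronglyMeasurable
  have hprod := ((hf.stronglyMeasurable_mk.comp_measurable measurable_snd).mul hk)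
  refine ⟨_, hprod.integral_prod_right' (ν := jacobiMeasure α β), fun s hs x hx => ?_⟩
  refine integral_congr_ae ?_
  filter_upwards [ae_mem_jacobiMeasure hα hβ, hf.ae_eq_mk] with y hy hfy
  have hmem : ((s, x), y) ∈ {p : (ℝ × (Fin d → ℝ)) × (Fin d → ℝ) | 0 < p.1.1} := hs
  simp only [Pi.mul_apply, Function.comp_apply, piecewise_eq_of_mem _ _ _ hmem, ← hfy,
    cubeProj_of_mem hx, cubeProj_of_mem hy]

end JacobiSemigroup

/-! ### The Poisson–Jacobi semigroup: maximal bounds and limits at zero and infinity. -/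

section PoissonJacobi

open scoped ENNReal

variable {d : ℕ} {α β : Fin d → ℝ}

/-- The ergodic maximal function of the Jacobi semigroup applied to `|f|`. -/
def jacobiMaximal (α β : Fin d → ℝ) (f : (Fin d → ℝ) → ℝ) (x : Fin d → ℝ) : ℝ≥0∞ :=
  ergodicMaximal (jacobiMeasure α β) (jacobiDensity α β) (fun y => ‖f y‖ₑ) x

theorem jacobiMaximal_weak_type (hα : ∀ i, -(1 / 2 : ℝ) < α i) (hβ : ∀ i, -(1 / 2 : ℝ) < β i)
    {f : (Fin d → ℝ) → ℝ} (hfm : StronglyMeasurable f) (hf : Integrable f (jacobiMeasure α β))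
    {c : ℝ≥0∞} (hc : c ≠ ∞) :
    c * jacobiMeasure α β {x | c < jacobiMaximal α β f x} ≤ ∫⁻ x, ‖f x‖ₑ ∂jacobiMeasure α β := by
  have := isFiniteMeasure_jacobiMeasure hα hβ
  exact (isMarkovDensity_jacobiDensity hα hβ).ergodicMaximal_weak_type hfm.enorm hf.2.ne hc

/-- The weak type inequality at the levels `n + 1`, with `n` tending to infinity. -/
theorem ae_jacobiMaximal_ne_top (hα : ∀ i, -(1 / 2 : ℝ) < α i) (hβ : ∀ i, -(1 / 2 : ℝ) < β i)
    {f : (Fin d → ℝ) → ℝ} (hfm : StronglyMeasurable f) (hf : Integrable f (jacobiMeasure α β)) :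
    ∀ᵐ x ∂jacobiMeasure α β, jacobiMaximal α β f x ≠ ∞ := by
  rw [ae_iff]
  simp only [ne_eq, not_not]
  have hle : ∀ n : ℕ, jacobiMeasure α β {x | jacobiMaximal α β f x = ∞} ≤
      (∫⁻ x, ‖f x‖ₑ ∂jacobiMeasure α β) / ((n + 1 : ℕ) : ℝ≥0∞) := fun n => by
    rw [ENNReal.le_div_iff_mul_le (Or.inl (by simp)) (Or.inl (by simp)), mul_comm]
    refine le_trans ?_ (jacobiMaximal_weak_type hα hβ hfm hf (ENNReal.natCast_ne_top (n + 1)))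
    gcongr with x
    intro hx
    rw [hx]; exact ENNReal.natCast_lt_top _
  have hlim : Tendsto (fun n : ℕ => (∫⁻ x, ‖f x‖ₑ ∂jacobiMeasure α β) / ((n + 1 : ℕ) : ℝ≥0∞))
      atTop (𝓝 0) := by
    have h1 : Tendsto (fun n : ℕ => (((n + 1 : ℕ) : ℝ≥0∞))⁻¹) atTop (𝓝 0) :=
      ENNReal.tendsto_inv_nat_nhds_zero.comp (tendsto_add_atTop_nat 1)
    have := ENNReal.Tendsto.const_mul (a := ∫⁻ x, ‖f x‖ₑ ∂jacobiMeasure α β) h1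
      (Or.inr hf.2.ne)
    simpa [div_eq_mul_inv] using this
  exact le_antisymm (ge_of_tendsto' hlim hle) zero_le

theorem lintegral_enorm_jacobiT_mul_le (hα : ∀ i, -(1 / 2 : ℝ) < α i)
    (hβ : ∀ i, -(1 / 2 : ℝ) < β i) (f : (Fin d → ℝ) → ℝ) {t : ℝ} (ht : 0 < t) {x : Fin d → ℝ}
    (hx : x ∈ Icc (-1 : Fin d → ℝ) 1) :
    ∫⁻ s in Ioi (0 : ℝ), ‖jacobiT α β s f x * stableDensity t s‖ₑ ≤
      ∫⁻ s in Ioi (0 : ℝ), densityOp (jacobiMeasure α β) (jacobiDensity α β) s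
        (fun y => ‖f y‖ₑ) x * ENNReal.ofReal (stableDensity t s) := by
  refine setLIntegral_mono' measurableSet_Ioi fun s hs => ?_
  rw [enorm_mul, Real.enorm_of_nonneg (stableDensity_nonneg ht hs)]
  gcongr
  exact enorm_jacobiT_le hα hβ f hs hx

theorem enorm_poissonJacobi_le (hα : ∀ i, -(1 / 2 : ℝ) < α i)
    (hβ : ∀ i, -(1 / 2 : ℝ) < β i) (f : (Fin d → ℝ) → ℝ) {t : ℝ} (ht : 0 < t) {x : Fin d → ℝ}
    (hx : x ∈ Icc (-1 : Fin d → ℝ) 1) :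
    ‖poissonJacobi α β t f x‖ₑ ≤
      ∫⁻ s in Ioi (0 : ℝ), densityOp (jacobiMeasure α β) (jacobiDensity α β) s
        (fun y => ‖f y‖ₑ) x * ENNReal.ofReal (stableDensity t s) :=
  (enorm_integral_le_lintegral_enorm _).trans (lintegral_enorm_jacobiT_mul_le hα hβ f ht hx)

theorem enorm_poissonJacobi_le_maximal (hα : ∀ i, -(1 / 2 : ℝ) < α i)
    (hβ : ∀ i, -(1 / 2 : ℝ) < β i) (f : (Fin d → ℝ) → ℝ) {t : ℝ} (ht : 0 < t) {x : Fin d → ℝ}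
    (hx : x ∈ Icc (-1 : Fin d → ℝ) 1) :
    ‖poissonJacobi α β t f x‖ₑ ≤ 16 * jacobiMaximal α β f x :=
  (enorm_poissonJacobi_le hα hβ f ht hx).trans (lintegral_densityOp_stableDensity_le ht x)

theorem lintegral_enorm_poissonJacobi_le (hα : ∀ i, -(1 / 2 : ℝ) < α i)
    (hβ : ∀ i, -(1 / 2 : ℝ) < β i) {f : (Fin d → ℝ) → ℝ} (hfm : StronglyMeasurable f) {t : ℝ}
    (ht : 0 < t) : ∫⁻ x, ‖poissonJacobi α β t f x‖ₑ ∂jacobiMeasure α β ≤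
      ∫⁻ x, ‖f x‖ₑ ∂jacobiMeasure α β := by
  have := isFiniteMeasure_jacobiMeasure hα hβ
  rw [← (isMarkovDensity_jacobiDensity hα hβ).lintegral_lintegral_stableDensity hfm.enorm ht]
  refine lintegral_mono_ae ?_
  filter_upwards [ae_mem_jacobiMeasure hα hβ] with x hx using enorm_poissonJacobi_le hα hβ f ht hx

theorem aestronglyMeasurable_jacobiT_left (hα : ∀ i, -(1 / 2 : ℝ) < α i)
    (hβ : ∀ i, -(1 / 2 : ℝ) < β i) {f : (Fin d → ℝ) → ℝ}
    (hf : AEStronglyMeasurable f (jacobiMeasure α β)) {x : Fin d → ℝ}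
    (hx : x ∈ Icc (-1 : Fin d → ℝ) 1) :
    AEStronglyMeasurable (fun s => jacobiT α β s f x) (volume.restrict (Ioi 0)) := by
  obtain ⟨T, hT, h⟩ := aestronglyMeasurable_jacobiT hα hβ hf
  refine ⟨fun s => T (s, x), hT.comp_measurable measurable_prodMk_right, ?_⟩
  filter_upwards [ae_restrict_mem measurableSet_Ioi] with s hs using h s hs x hx

theorem aestronglyMeasurable_poissonJacobi (hα : ∀ i, -(1 / 2 : ℝ) < α i)
    (hβ : ∀ i, -(1 / 2 : ℝ) < β i) {f : (Fin d → ℝ) → ℝ}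
    (hf : AEStronglyMeasurable f (jacobiMeasure α β)) (t : ℝ) :
    AEStronglyMeasurable (poissonJacobi α β t f) (jacobiMeasure α β) := by
  obtain ⟨T, hT, h⟩ := aestronglyMeasurable_jacobiT hα hβ hf
  have hprod : StronglyMeasurable fun p : ℝ × (Fin d → ℝ) => T p * stableDensity t p.1 :=
    hT.mul ((measurable_stableDensity t).comp measurable_fst).stronglyMeasurable
  refine ⟨_, hprod.integral_prod_left' (μ := volume.restrict (Ioi (0 : ℝ))), ?_⟩
  filter_upwards [ae_mem_jacobiMeasure hα hβ] with x hx
  refine setIntegral_congr_fun measurableSet_Ioi fun s hs => ?_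
  simp only [h s hs x hx]

/-- Finiteness of the maximal function at `x` gives absolute convergence for every `t` at once, so
the exceptional null set does not depend on `t`. -/
theorem integrableOn_jacobiT_mul (hα : ∀ i, -(1 / 2 : ℝ) < α i)
    (hβ : ∀ i, -(1 / 2 : ℝ) < β i) {f : (Fin d → ℝ) → ℝ}
    (hf : AEStronglyMeasurable f (jacobiMeasure α β)) {x : Fin d → ℝ}
    (hx : x ∈ Icc (-1 : Fin d → ℝ) 1) (hM : jacobiMaximal α β f x ≠ ∞) {t : ℝ} (ht : 0 < t) :
    IntegrableOn (fun s => jacobiT α β s f x * stableDensity t s) (Ioi 0) := by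
  refine ⟨(aestronglyMeasurable_jacobiT_left hα hβ hf hx).mul
    (measurable_stableDensity t).aestronglyMeasurable, ?_⟩
  refine ((lintegral_enorm_jacobiT_mul_le hα hβ f ht hx).trans
    (lintegral_densityOp_stableDensity_le ht x)).trans_lt ?_
  exact ENNReal.mul_lt_top (by simp) hM.lt_top

theorem poissonJacobi_sub (hα : ∀ i, -(1 / 2 : ℝ) < α i) (hβ : ∀ i, -(1 / 2 : ℝ) < β i)
    {f g : (Fin d → ℝ) → ℝ} (hf : Integrable f (jacobiMeasure α β))
    (hg : Integrable g (jacobiMeasure α β)) {x : Fin d → ℝ}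
    (hx : x ∈ Icc (-1 : Fin d → ℝ) 1) (hMf : jacobiMaximal α β f x ≠ ∞)
    (hMg : jacobiMaximal α β g x ≠ ∞) {t : ℝ} (ht : 0 < t) :
    poissonJacobi α β t (fun y => f y - g y) x =
      poissonJacobi α β t f x - poissonJacobi α β t g x := by
  unfold poissonJacobi
  rw [← integral_sub (integrableOn_jacobiT_mul hα hβ hf.1 hx hMf ht)
    (integrableOn_jacobiT_mul hα hβ hg.1 hx hMg ht)]
  refine setIntegral_congr_fun measurableSet_Ioi fun s hs => ?_
  simp only [jacobiT_sub hα hβ hf hg hs hx, sub_mul]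

/-- Differentiability of `P_t f (x)` in `t` and the fundamental theorem of calculus. -/
theorem poissonJacobi_differentiable (hα : ∀ i, -(1 / 2 : ℝ) < α i)
    (hβ : ∀ i, -(1 / 2 : ℝ) < β i) {f : (Fin d → ℝ) → ℝ}
    (hf : AEStronglyMeasurable f (jacobiMeasure α β)) {x : Fin d → ℝ}
    (hx : x ∈ Icc (-1 : Fin d → ℝ) 1) (hM : jacobiMaximal α β f x ≠ ∞) :
    (∀ t : ℝ, 0 < t → DifferentiableAt ℝ (fun u => poissonJacobi α β u f x) t) ∧
      ∀ a b : ℝ, 0 < a → a ≤ b →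
        IntervalIntegrable (fun t => jacobiQ α β t f x / t) volume a b ∧
        ∫ t in a..b, jacobiQ α β t f x / t =
          poissonJacobi α β a f x - poissonJacobi α β b f x := by
  have hm := aestronglyMeasurable_jacobiT_left hα hβ hf hx
  have hi := fun (t : ℝ) (ht : 0 < t) => integrableOn_jacobiT_mul hα hβ hf hx hM ht
  have hder : ∀ t : ℝ, 0 < t → HasDerivAt (fun u => poissonJacobi α β u f x)
      (∫ s in Ioi (0 : ℝ), jacobiT α β s f x * stableDensityDeriv t s) t := fun t ht =>
    hasDerivAt_integral_stableDensity hm hi ht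
  have hcont := continuousOn_integral_stableDensityDeriv hm hi
  refine ⟨fun t ht => (hder t ht).differentiableAt, fun a b ha hab => ?_⟩
  have hsub : uIcc a b ⊆ Ioi 0 := by
    rw [uIcc_of_le hab]; exact fun t ht => ha.trans_le ht.1
  have hint := (hcont.mono hsub).neg.intervalIntegrable (μ := volume)
  have heq : EqOn (fun t => -∫ s in Ioi (0 : ℝ), jacobiT α β s f x * stableDensityDeriv t s)
      (fun t => jacobiQ α β t f x / t) (uIcc a b) := fun t ht => by
    have ht0 : 0 < t := hsub ht
    simp only [jacobiQ, (hder t ht0).deriv]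
    field_simp
  have heq' : EqOn (fun t => -∫ s in Ioi (0 : ℝ), jacobiT α β s f x * stableDensityDeriv t s)
      (fun t => jacobiQ α β t f x / t) (uIoc a b) := heq.mono uIoc_subset_uIcc
  refine ⟨hint.congr heq', ?_⟩
  rw [← intervalIntegral.integral_congr heq, intervalIntegral.integral_eq_sub_of_hasDerivAt
    (fun t ht => (hder t (hsub ht)).neg) hint]
  simp only [Pi.neg_apply]
  ring

theorem poissonJacobi_of_ae_eq_expand (hα : ∀ i, -(1 / 2 : ℝ) < α i)
    (hβ : ∀ i, -(1 / 2 : ℝ) < β i) {f : (Fin d → ℝ) → ℝ} {F : Finset (Fin d → ℕ)}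
    {c : (Fin d → ℕ) → ℝ} (hf : f =ᵐ[jacobiMeasure α β] jacobiExpand α β F c) {t : ℝ} (ht : 0 < t)
    {x : Fin d → ℝ} (hx : x ∈ Icc (-1 : Fin d → ℝ) 1) :
    poissonJacobi α β t f x =
      jacobiExpand α β F (fun κ => c κ * Real.exp (-(√(jacobiEigenvalue α β κ) * t))) x := by
  have hl := fun κ => stableDensity_laplace ht (Real.sqrt_nonneg (jacobiEigenvalue α β κ))
  simp only [Real.sq_sqrt (jacobiEigenvalue_nonneg hα hβ _)] at hl
  have h1 : poissonJacobi α β t f x = ∫ s in Ioi (0 : ℝ), ∑ κ ∈ F,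
      c κ * jacobiPoly α β κ x *
        (Real.exp (-(jacobiEigenvalue α β κ * s)) * stableDensity t s) := by
    refine setIntegral_congr_fun measurableSet_Ioi fun s hs => ?_
    simp only [jacobiT_of_ae_eq_expand hα hβ hf hs hx, jacobiExpand, Finset.sum_mul]
    exact Finset.sum_congr rfl fun κ _ => by ring
  rw [h1, integral_finsetSum _ fun κ _ => (hl κ).1.const_mul _]
  refine Finset.sum_congr rfl fun κ _ => ?_
  rw [integral_const_mul, (hl κ).2]
  ring

theorem poissonJacobi_expand (hα : ∀ i, -(1 / 2 : ℝ) < α i)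
    (hβ : ∀ i, -(1 / 2 : ℝ) < β i) (F : Finset (Fin d → ℕ))
    (c : (Fin d → ℕ) → ℝ) {t : ℝ} (ht : 0 < t)
    {x : Fin d → ℝ} (hx : x ∈ Icc (-1 : Fin d → ℝ) 1) :
    poissonJacobi α β t (jacobiExpand α β F c) x =
      jacobiExpand α β F (fun κ => c κ * Real.exp (-(√(jacobiEigenvalue α β κ) * t))) x :=
  poissonJacobi_of_ae_eq_expand hα hβ (ae_eq_refl _) ht hx

/-- The Jacobi polynomial of degree zero is constant. -/
theorem jacobiPoly_zero_eq (α β : Fin d → ℝ) (x y : Fin d → ℝ) :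
    jacobiPoly α β 0 x = jacobiPoly α β 0 y := by
  simp [jacobiPoly, jacobiPoly₁, jacobiP]

theorem integral_mul_jacobiPoly_zero {f : (Fin d → ℝ) → ℝ}
    (h0 : ∫ y, f y ∂jacobiMeasure α β = 0) :
    ∫ y, f y * jacobiPoly α β 0 y ∂jacobiMeasure α β = 0 := by
  simp only [jacobiPoly_zero_eq α β _ 0]
  rw [integral_mul_const, h0, zero_mul]

/-- Approximation of mean-zero functions by mean-zero expansions in `L¹`. -/
theorem exists_jacobiExpand_lintegral_sub_le_of_integral_eq_zero (hα : ∀ i, -(1 / 2 : ℝ) < α i)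
    (hβ : ∀ i, -(1 / 2 : ℝ) < β i) {f : (Fin d → ℝ) → ℝ} (hf : Integrable f (jacobiMeasure α β))
    (h0 : ∫ y, f y ∂jacobiMeasure α β = 0) {ε : ℝ≥0∞} (hε : ε ≠ 0) :
    ∃ F c, (0 : Fin d → ℕ) ∉ F ∧
      ∫⁻ x, ‖f x - jacobiExpand α β F c x‖ₑ ∂jacobiMeasure α β ≤ ε := by
  have := isFiniteMeasure_jacobiMeasure hα hβ
  set μ := jacobiMeasure α β
  set p := jacobiPoly α β 0
  set S := jacobiSup α β 0
  have hpS : ∀ x ∈ Icc (-1 : Fin d → ℝ) 1, ‖p x‖ₑ ≤ ENNReal.ofReal S := fun x hx => by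
    rw [← ofReal_norm, Real.norm_eq_abs]
    exact ENNReal.ofReal_le_ofReal (abs_jacobiPoly_le α β 0 hx)
  -- The cost of deleting the constant mode. As `f` has mean zero, the coefficient `z` of that mode
  -- in `q` is the integral of `(q - f) p`, hence at most `S` times the `L¹` error; the deleted term
  -- `z p` has norm at most `|z| S μ(univ)`.
  set C : ℝ≥0∞ := 1 + ENNReal.ofReal S * (ENNReal.ofReal S * μ univ) with hC
  have hCtop : C ≠ ∞ := by finiteness
  obtain ⟨F, c, hq⟩ := exists_jacobiExpand_lintegral_sub_le hα hβ hf
    (ε := ε / C) (ENNReal.div_pos hε hCtop).ne'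
  set q := jacobiExpand α β F c
  set z : ℝ := if (0 : Fin d → ℕ) ∈ F then c 0 else 0 with hz
  have hqi : Integrable q μ := integrable_jacobiMeasure_of_continuous hα hβ
    (continuous_jacobiExpand α β F c)
  have hpc : Continuous p := continuous_jacobiPoly α β 0
  have hqm : AEMeasurable (fun x => ‖f x - q x‖ₑ) μ := (hf.1.sub hqi.1).enorm
  have hz2 : ‖z‖ₑ ≤ ENNReal.ofReal S * ∫⁻ x, ‖f x - q x‖ₑ ∂μ := by
    have hzi : z = ∫ y, q y * p y ∂μ := (integral_jacobiExpand_mul hα hβ F c 0).symm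
    have hp0 : ∀ y, p y = p 0 := fun y => jacobiPoly_zero_eq α β y 0
    have e : z = ∫ y, (q y - f y) * p y ∂μ := by
      rw [hzi]
      simp only [hp0]
      rw [integral_mul_const, integral_mul_const, integral_sub hqi hf, h0, sub_zero]
    rw [e, ← lintegral_const_mul'' _ hqm]
    refine (enorm_integral_le_lintegral_enorm _).trans (lintegral_mono_ae ?_)
    filter_upwards [ae_mem_jacobiMeasure hα hβ] with y hy
    rw [enorm_mul, mul_comm, enorm_sub_rev]
    gcongr
    exact hpS y hy
  refine ⟨F.erase 0, c, Finset.notMem_erase _ _, ?_⟩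
  have hsplit : ∀ x, jacobiExpand α β (F.erase 0) c x = q x - z * p x := by
    intro x
    by_cases h : (0 : Fin d → ℕ) ∈ F
    · have := Finset.add_sum_erase F (fun κ => c κ * jacobiPoly α β κ x) h
      simp only [hz, if_pos h]
      change _ = (∑ κ ∈ F, _) - _
      rw [← this]
      simp [jacobiExpand, p]
    · rw [Finset.erase_eq_of_notMem h]
      simp [hz, h, q]
  calc _ ≤ ∫⁻ x, (‖f x - q x‖ₑ + ‖z * p x‖ₑ) ∂μ := by
        refine lintegral_mono fun x => ?_
        rw [hsplit, show f x - (q x - z * p x) = (f x - q x) + z * p x by ring]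
        exact enorm_add_le _ _
    _ = ∫⁻ x, ‖f x - q x‖ₑ ∂μ + ∫⁻ x, ‖z * p x‖ₑ ∂μ := lintegral_add_left' hqm _
    _ ≤ ∫⁻ x, ‖f x - q x‖ₑ ∂μ + ∫⁻ _, ‖z‖ₑ * ENNReal.ofReal S ∂μ := by
        refine add_le_add le_rfl (lintegral_mono_ae ?_)
        filter_upwards [ae_mem_jacobiMeasure hα hβ] with y hy
        rw [enorm_mul]
        gcongr
        exact hpS y hy
    _ ≤ ∫⁻ x, ‖f x - q x‖ₑ ∂μ +
          (ENNReal.ofReal S * ∫⁻ x, ‖f x - q x‖ₑ ∂μ) * ENNReal.ofReal S * μ univ := by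
        rw [lintegral_const]
        gcongr
    _ = C * ∫⁻ x, ‖f x - q x‖ₑ ∂μ := by rw [hC]; ring
    _ ≤ C * (ε / C) := by gcongr
    _ ≤ ε := ENNReal.mul_div_le

theorem tendsto_poissonJacobi_expand_zero (hα : ∀ i, -(1 / 2 : ℝ) < α i)
    (hβ : ∀ i, -(1 / 2 : ℝ) < β i) (F : Finset (Fin d → ℕ)) (c : (Fin d → ℕ) → ℝ)
    {x : Fin d → ℝ} (hx : x ∈ Icc (-1 : Fin d → ℝ) 1) :
    Tendsto (fun t => poissonJacobi α β t (jacobiExpand α β F c) x) (𝓝[>] 0)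
      (𝓝 (jacobiExpand α β F c x)) := by
  have hc : Continuous fun t : ℝ =>
      jacobiExpand α β F (fun κ => c κ * Real.exp (-(√(jacobiEigenvalue α β κ) * t))) x := by
    unfold jacobiExpand; fun_prop
  have h := (hc.tendsto 0).mono_left (nhdsWithin_le_nhds (s := Ioi 0))
  simp only [mul_zero, neg_zero, Real.exp_zero, mul_one] at h
  refine h.congr' ?_
  filter_upwards [self_mem_nhdsWithin] with t ht using (poissonJacobi_expand hα hβ F c ht hx).symm

theorem tendsto_poissonJacobi_expand_atTop (hα : ∀ i, -(1 / 2 : ℝ) < α i)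
    (hβ : ∀ i, -(1 / 2 : ℝ) < β i) {F : Finset (Fin d → ℕ)} (hF : (0 : Fin d → ℕ) ∉ F)
    (c : (Fin d → ℕ) → ℝ) {x : Fin d → ℝ} (hx : x ∈ Icc (-1 : Fin d → ℝ) 1) :
    Tendsto (fun t => poissonJacobi α β t (jacobiExpand α β F c) x) atTop (𝓝 0) := by
  have h : Tendsto (fun t : ℝ =>
      jacobiExpand α β F (fun κ => c κ * Real.exp (-(√(jacobiEigenvalue α β κ) * t))) x) atTop
      (𝓝 (∑ κ ∈ F, c κ * 0 * jacobiPoly α β κ x)) := by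
    refine tendsto_finsetSum _ fun κ hκ => Tendsto.mul_const _ (Tendsto.const_mul _ ?_)
    have hpos : 0 < √(jacobiEigenvalue α β κ) := Real.sqrt_pos.mpr
      (jacobiEigenvalue_pos hα hβ fun h => hF (h ▸ hκ))
    exact Real.tendsto_exp_neg_atTop_nhds_zero.comp (Tendsto.const_mul_atTop hpos tendsto_id)
  simp only [mul_zero, zero_mul, Finset.sum_const_zero] at h
  refine h.congr' ?_
  filter_upwards [eventually_gt_atTop 0] with t ht using (poissonJacobi_expand hα hβ F c ht hx).symm

/-- Almost everywhere convergence of `P_t f` at `0` and at infinity. -/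
theorem ae_tendsto_poissonJacobi (hα : ∀ i, -(1 / 2 : ℝ) < α i)
    (hβ : ∀ i, -(1 / 2 : ℝ) < β i) {f : (Fin d → ℝ) → ℝ} (hfm : StronglyMeasurable f)
    (hf : Integrable f (jacobiMeasure α β)) (h0 : ∫ y, f y ∂jacobiMeasure α β = 0) :
    ∀ᵐ x ∂jacobiMeasure α β,
      Tendsto (fun t => poissonJacobi α β t f x) (𝓝[>] 0) (𝓝 (f x)) ∧
      Tendsto (fun t => poissonJacobi α β t f x) atTop (𝓝 0) := by
  have := isFiniteMeasure_jacobiMeasure hα hβ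
  set μ := jacobiMeasure α β
  -- An `L¹` error of `2^(-n)` times `2^(-n)` makes the sets where the maximal function or the error
  -- itself exceeds `2^(-n)` have measure at most `2^(-n)`. These are summable, so Borel–Cantelli
  -- applies.
  have hex : ∀ n : ℕ, ∃ F c, (0 : Fin d → ℕ) ∉ F ∧
      ∫⁻ x, ‖f x - jacobiExpand α β F c x‖ₑ ∂μ ≤ 2⁻¹ ^ n * 2⁻¹ ^ n := fun n =>
    exists_jacobiExpand_lintegral_sub_le_of_integral_eq_zero hα hβ hf h0 (by simp)
  choose F c hF hq using hex
  set q : ℕ → (Fin d → ℝ) → ℝ := fun n => jacobiExpand α β (F n) (c n)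
  have hqc : ∀ n, Continuous (q n) := fun n => continuous_jacobiExpand _ _ _ _
  have hqi : ∀ n, Integrable (q n) μ := fun n =>
    integrable_jacobiMeasure_of_continuous hα hβ (hqc n)
  have hdm : ∀ n, StronglyMeasurable fun x => f x - q n x := fun n =>
    hfm.sub (hqc n).stronglyMeasurable
  have hp0 : ∀ n : ℕ, (2⁻¹ : ℝ≥0∞) ^ n ≠ 0 := fun n => by simp
  have hpt : ∀ n : ℕ, (2⁻¹ : ℝ≥0∞) ^ n ≠ ∞ := fun n => by finiteness
  have hsumm : ∑' n : ℕ, (2⁻¹ : ℝ≥0∞) ^ n ≠ ∞ := by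
    rw [ENNReal.tsum_geometric, ENNReal.one_sub_inv_two, inv_inv]; simp
  have hA : ∀ᵐ x ∂μ, ∀ᶠ n in atTop,
      x ∉ {x | (2⁻¹ : ℝ≥0∞) ^ n < jacobiMaximal α β (fun y => f y - q n y) x} := by
    refine ae_eventually_notMem (ne_top_of_le_ne_top hsumm (ENNReal.tsum_le_tsum fun n => ?_))
    have := (jacobiMaximal_weak_type hα hβ (hdm n) (hf.sub (hqi n)) (hpt n)).trans (hq n)
    exact (ENNReal.mul_le_mul_iff_right (hp0 n) (hpt n)).mp this
  have hB : ∀ᵐ x ∂μ, ∀ᶠ n in atTop, x ∉ {x | (2⁻¹ : ℝ≥0∞) ^ n ≤ ‖f x - q n x‖ₑ} := by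
    refine ae_eventually_notMem (ne_top_of_le_ne_top hsumm (ENNReal.tsum_le_tsum fun n => ?_))
    have := (mul_meas_ge_le_lintegral (μ := μ) (hdm n).enorm (2⁻¹ ^ n)).trans (hq n)
    exact (ENNReal.mul_le_mul_iff_right (hp0 n) (hpt n)).mp this
  have hMq : ∀ᵐ x ∂μ, ∀ n, jacobiMaximal α β (q n) x ≠ ∞ := ae_all_iff.mpr fun n =>
    ae_jacobiMaximal_ne_top hα hβ (hqc n).stronglyMeasurable (hqi n)
  filter_upwards [hA, hB, hMq, ae_jacobiMaximal_ne_top hα hβ hfm hf, ae_mem_jacobiMeasure hα hβ]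
    with x hxA hxB hxq hxf hx
  -- The approximation of `P_t f` is uniform in `t`, so the limits known for expansions transfer
  -- both at zero and at infinity.
  have key : ∀ ε : ℝ, 0 < ε → ∃ n, |f x - q n x| < ε ∧
      ∀ t : ℝ, 0 < t → |poissonJacobi α β t f x - poissonJacobi α β t (q n) x| < ε := by
    intro ε hε
    have hlim : Tendsto (fun n : ℕ => 16 * (2⁻¹ : ℝ≥0∞) ^ n) atTop (𝓝 0) := by
      have := ENNReal.Tendsto.const_mul (a := 16)
        (ENNReal.tendsto_pow_atTop_nhds_zero_of_lt_one (r := 2⁻¹) (by simp)) (Or.inr (by simp))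
      simpa using this
    have hsmall := hlim.eventually_lt_const (ENNReal.ofReal_pos.mpr hε)
    obtain ⟨n, hnA, hnB, hn⟩ := (hxA.and (hxB.and hsmall)).exists
    simp only [not_lt, not_le] at hnA hnB
    have hle : (2⁻¹ : ℝ≥0∞) ^ n ≤ 16 * 2⁻¹ ^ n := by
      calc (2⁻¹ : ℝ≥0∞) ^ n = 1 * 2⁻¹ ^ n := (one_mul _).symm
        _ ≤ _ := by gcongr; norm_num
    refine ⟨n, ?_, fun t ht => ?_⟩
    · rw [← Real.norm_eq_abs, ← ENNReal.ofReal_lt_ofReal_iff hε, ofReal_norm]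
      exact hnB.trans_le (hle.trans hn.le)
    · rw [← poissonJacobi_sub hα hβ hf (hqi n) hx hxf (hxq n) ht, ← Real.norm_eq_abs,
        ← ENNReal.ofReal_lt_ofReal_iff hε, ofReal_norm]
      refine (enorm_poissonJacobi_le_maximal hα hβ _ ht hx).trans_lt (lt_of_le_of_lt ?_ hn)
      gcongr
  constructor
  · rw [Metric.tendsto_nhds]
    intro ε hε
    obtain ⟨n, h1, h2⟩ := key (ε / 3) (by positivity)
    have h3 := (Metric.tendsto_nhds.mp
      (tendsto_poissonJacobi_expand_zero hα hβ (F n) (c n) hx)) (ε / 3) (by positivity)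
    filter_upwards [h3, self_mem_nhdsWithin] with t ht ht0
    have h4 := h2 t ht0
    rw [Real.dist_eq] at ht ⊢
    rw [abs_lt] at *
    constructor <;> linarith [h1.1, h1.2, h4.1, h4.2, ht.1, ht.2]
  · rw [Metric.tendsto_nhds]
    intro ε hε
    obtain ⟨n, -, h2⟩ := key (ε / 2) (by positivity)
    have h3 := (Metric.tendsto_nhds.mp
      (tendsto_poissonJacobi_expand_atTop hα hβ (hF n) (c n) hx)) (ε / 2) (by positivity)
    filter_upwards [h3, eventually_gt_atTop 0] with t ht ht0
    have h4 := h2 t ht0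
    rw [Real.dist_eq] at ht ⊢
    rw [abs_lt] at *
    constructor <;> linarith [h4.1, h4.2, ht.1, ht.2]

/-- Convergence in `L¹` of `P_a f - P_b f` to `f`. -/
theorem tendsto_lintegral_poissonJacobi_sub (hα : ∀ i, -(1 / 2 : ℝ) < α i)
    (hβ : ∀ i, -(1 / 2 : ℝ) < β i) {f : (Fin d → ℝ) → ℝ} (hfm : StronglyMeasurable f)
    (hf : Integrable f (jacobiMeasure α β)) (h0 : ∫ y, f y ∂jacobiMeasure α β = 0) :
    Tendsto (fun p : ℝ × ℝ => ∫⁻ x, ‖poissonJacobi α β p.1 f x - poissonJacobi α β p.2 f x -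
      f x‖ₑ ∂jacobiMeasure α β) (𝓝[>] (0 : ℝ) ×ˢ atTop) (𝓝 0) := by
  have := isFiniteMeasure_jacobiMeasure hα hβ
  set μ := jacobiMeasure α β
  rw [ENNReal.tendsto_nhds_zero]
  intro ε hε
  obtain ⟨F, c, hF, hq⟩ := exists_jacobiExpand_lintegral_sub_le_of_integral_eq_zero hα hβ hf h0
    (ε := ε / 2 / 3) (ENNReal.div_pos (ENNReal.half_pos hε.ne').ne' (by simp)).ne'
  set q := jacobiExpand α β F c with hqdef
  have hqc : Continuous q := continuous_jacobiExpand _ _ _ _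
  have hqi : Integrable q μ := integrable_jacobiMeasure_of_continuous hα hβ hqc
  have hdm : StronglyMeasurable fun x => f x - q x := hfm.sub hqc.stronglyMeasurable
  -- A bound, uniform on the cube, for the error of the expansion itself. It tends to `0` because
  -- the constant mode is absent. Of the tolerance `ε`, half pays for `D` and a sixth for each of
  -- the three terms in `f - q`.
  set D : ℝ × ℝ → ℝ := fun p => ∑ κ ∈ F, |c κ| *
    (|Real.exp (-(√(jacobiEigenvalue α β κ) * p.1)) - 1 -
      Real.exp (-(√(jacobiEigenvalue α β κ) * p.2))|) * jacobiSup α β κ with hD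
  have hDlim : Tendsto D (𝓝[>] (0 : ℝ) ×ˢ atTop) (𝓝 0) := by
    have : Tendsto D (𝓝[>] (0 : ℝ) ×ˢ atTop)
        (𝓝 (∑ κ ∈ F, |c κ| * |Real.exp (-(√(jacobiEigenvalue α β κ) * 0)) - 1 - 0| *
          jacobiSup α β κ)) := by
      refine tendsto_finsetSum _ fun κ hκ => Tendsto.mul_const _ (Tendsto.const_mul _
        (Tendsto.abs (Tendsto.sub (Tendsto.sub_const ?_ 1) ?_)))
      · have hc : Continuous fun t : ℝ => Real.exp (-(√(jacobiEigenvalue α β κ) * t)) := by fun_prop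
        exact ((hc.tendsto 0).mono_left nhdsWithin_le_nhds).comp tendsto_fst
      · have hpos : 0 < √(jacobiEigenvalue α β κ) := Real.sqrt_pos.mpr
          (jacobiEigenvalue_pos hα hβ fun h => hF (h ▸ hκ))
        exact (Real.tendsto_exp_neg_atTop_nhds_zero.comp
          (Tendsto.const_mul_atTop hpos tendsto_id)).comp tendsto_snd
    simpa using this
  have hDlim' : Tendsto (fun p => ENNReal.ofReal (D p) * μ univ) (𝓝[>] (0 : ℝ) ×ˢ atTop)
      (𝓝 0) := by
    have := ENNReal.Tendsto.mul_const (b := μ univ) (ENNReal.tendsto_ofReal hDlim)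
      (Or.inr (measure_ne_top _ _))
    simpa using this
  have hpos : ∀ᶠ p : ℝ × ℝ in 𝓝[>] (0 : ℝ) ×ˢ atTop, 0 < p.1 ∧ 0 < p.2 :=
    (eventually_mem_nhdsWithin (a := (0 : ℝ)) (s := Ioi 0)).prod_mk (eventually_gt_atTop (0 : ℝ))
  filter_upwards [hpos, ENNReal.tendsto_nhds_zero.mp hDlim' (ε / 2) (ENNReal.half_pos hε.ne')]
    with p ⟨hp1, hp2⟩ hDp
  have hae : ∀ᵐ x ∂μ, ‖poissonJacobi α β p.1 f x - poissonJacobi α β p.2 f x - f x‖ₑ ≤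
      ‖poissonJacobi α β p.1 (fun y => f y - q y) x‖ₑ +
      ‖poissonJacobi α β p.2 (fun y => f y - q y) x‖ₑ + ‖f x - q x‖ₑ + ENNReal.ofReal (D p) := by
    filter_upwards [ae_jacobiMaximal_ne_top hα hβ hfm hf,
      ae_jacobiMaximal_ne_top hα hβ hqc.stronglyMeasurable hqi, ae_mem_jacobiMeasure hα hβ]
      with x hxf hxq hx
    have e : poissonJacobi α β p.1 f x - poissonJacobi α β p.2 f x - f x =
        poissonJacobi α β p.1 (fun y => f y - q y) x -
        poissonJacobi α β p.2 (fun y => f y - q y) x - (f x - q x) +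
        (poissonJacobi α β p.1 q x - q x - poissonJacobi α β p.2 q x) := by
      rw [poissonJacobi_sub hα hβ hf hqi hx hxf hxq hp1,
        poissonJacobi_sub hα hβ hf hqi hx hxf hxq hp2]
      ring
    have hDq : |poissonJacobi α β p.1 q x - q x - poissonJacobi α β p.2 q x| ≤ D p := by
      rw [poissonJacobi_expand hα hβ F c hp1 hx, poissonJacobi_expand hα hβ F c hp2 hx, hqdef]
      simp only [jacobiExpand, ← Finset.sum_sub_distrib]
      refine (Finset.abs_sum_le_sum_abs _ _).trans (Finset.sum_le_sum fun κ _ => ?_)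
      rw [← sub_mul, ← sub_mul, abs_mul, ← mul_sub_one, ← mul_sub, abs_mul]
      gcongr
      exact abs_jacobiPoly_le α β κ hx
    rw [e]
    refine (enorm_add_le _ _).trans (add_le_add ((enorm_sub_le).trans
      (add_le_add enorm_sub_le le_rfl)) ?_)
    rw [← ofReal_norm, Real.norm_eq_abs]
    exact ENNReal.ofReal_le_ofReal hDq
  have hle : ∀ t : ℝ, 0 < t → ∫⁻ x, ‖poissonJacobi α β t (fun y => f y - q y) x‖ₑ ∂μ ≤ ε / 2 / 3 :=
    fun t ht => (lintegral_enorm_poissonJacobi_le hα hβ hdm ht).trans hq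
  calc _ ≤ ∫⁻ x, (‖poissonJacobi α β p.1 (fun y => f y - q y) x‖ₑ +
      ‖poissonJacobi α β p.2 (fun y => f y - q y) x‖ₑ + ‖f x - q x‖ₑ + ENNReal.ofReal (D p)) ∂μ :=
        lintegral_mono_ae hae
    _ ≤ ε / 2 / 3 + ε / 2 / 3 + ε / 2 / 3 + ε / 2 := by
        rw [lintegral_add_right _ measurable_const, lintegral_const, lintegral_add_right _ hdm.enorm,
          lintegral_add_left'
            (aestronglyMeasurable_poissonJacobi hα hβ hdm.aestronglyMeasurable p.1).enorm]
        gcongr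
        exacts [hle _ hp1, hle _ hp2]
    _ = ε := by
        rw [ENNReal.add_thirds, ENNReal.add_halves]

end PoissonJacobi

/-! ### The two reproducing formulas. -/

section CalderonFormulas

variable {d : ℕ} {α β : Fin d → ℝ}

theorem poissonJacobi_congr_ae {f g : (Fin d → ℝ) → ℝ} (h : f =ᵐ[jacobiMeasure α β] g) (t : ℝ) :
    poissonJacobi α β t f = poissonJacobi α β t g := by
  have hT : ∀ s x, jacobiT α β s f x = jacobiT α β s g x := fun s x =>
    integral_congr_ae (h.mono fun y hy => by simp only [hy])
  funext x
  simp only [poissonJacobi, hT]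

theorem jacobiQ_congr_ae {f g : (Fin d → ℝ) → ℝ} (h : f =ᵐ[jacobiMeasure α β] g) (t : ℝ) :
    jacobiQ α β t f = jacobiQ α β t g := by
  funext x
  simp only [jacobiQ, poissonJacobi_congr_ae h]

theorem eventually_pos_fst_le_snd :
    ∀ᶠ p : ℝ × ℝ in 𝓝[>] (0 : ℝ) ×ˢ atTop, 0 < p.1 ∧ p.1 ≤ p.2 := by
  have h1 : ∀ᶠ a : ℝ in 𝓝[>] (0 : ℝ), a ∈ Ioo (0 : ℝ) 1 := Ioo_mem_nhdsGT one_pos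
  filter_upwards [h1.prod_mk (eventually_ge_atTop (1 : ℝ))] with p hp
  exact ⟨hp.1.1, hp.1.2.le.trans hp.2⟩

/-- Calderón's reproducing formula for mean-zero integrable functions. -/
theorem calderon_reproducing_of_stronglyMeasurable (hα : ∀ i, -(1 / 2 : ℝ) < α i)
    (hβ : ∀ i, -(1 / 2 : ℝ) < β i) {f : (Fin d → ℝ) → ℝ} (hfm : StronglyMeasurable f)
    (hf : Integrable f (jacobiMeasure α β)) (h0 : ∫ y, f y ∂jacobiMeasure α β = 0) :
    (∀ᵐ x ∂jacobiMeasure α β,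
      (∀ t : ℝ, 0 < t → DifferentiableAt ℝ (fun u => poissonJacobi α β u f x) t) ∧
      (∀ a b : ℝ, 0 < a → a ≤ b →
        IntervalIntegrable (fun t => jacobiQ α β t f x / t) volume a b) ∧
      Tendsto (fun p : ℝ × ℝ => ∫ t in p.1..p.2, jacobiQ α β t f x / t)
        (𝓝[>] (0 : ℝ) ×ˢ atTop) (𝓝 (f x))) ∧
    Tendsto (fun p : ℝ × ℝ =>
        eLpNorm (fun x => (∫ t in p.1..p.2, jacobiQ α β t f x / t) - f x) 1 (jacobiMeasure α β))
      (𝓝[>] (0 : ℝ) ×ˢ atTop) (𝓝 0) := by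
  have hdiff : ∀ᵐ x ∂jacobiMeasure α β,
      (∀ t : ℝ, 0 < t → DifferentiableAt ℝ (fun u => poissonJacobi α β u f x) t) ∧
      ∀ a b : ℝ, 0 < a → a ≤ b →
        IntervalIntegrable (fun t => jacobiQ α β t f x / t) volume a b ∧
        ∫ t in a..b, jacobiQ α β t f x / t =
          poissonJacobi α β a f x - poissonJacobi α β b f x := by
    filter_upwards [ae_jacobiMaximal_ne_top hα hβ hfm hf, ae_mem_jacobiMeasure hα hβ] with x hM hx
      using poissonJacobi_differentiable hα hβ hf.1 hx hM
  constructor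
  · filter_upwards [hdiff, ae_tendsto_poissonJacobi hα hβ hfm hf h0] with x hx hlim
    refine ⟨hx.1, fun a b ha hab => (hx.2 a b ha hab).1, ?_⟩
    have := (hlim.1.comp tendsto_fst).sub (hlim.2.comp (tendsto_snd (f := 𝓝[>] (0 : ℝ))))
    rw [sub_zero] at this
    refine this.congr' ?_
    filter_upwards [eventually_pos_fst_le_snd] with p hp
    exact (hx.2 p.1 p.2 hp.1 hp.2).2.symm
  · refine (tendsto_lintegral_poissonJacobi_sub hα hβ hfm hf h0).congr' ?_
    filter_upwards [eventually_pos_fst_le_snd] with p hp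
    rw [eLpNorm_one_eq_lintegral_enorm]
    refine lintegral_congr_ae ?_
    filter_upwards [hdiff] with x hx
    simp only [(hx.2 p.1 p.2 hp.1 hp.2).2]

theorem calderon_reproducing (hα : ∀ i, -(1 / 2 : ℝ) < α i)
    (hβ : ∀ i, -(1 / 2 : ℝ) < β i) {f : (Fin d → ℝ) → ℝ}
    (hf : Integrable f (jacobiMeasure α β)) (h0 : ∫ y, f y ∂jacobiMeasure α β = 0) :
    (∀ᵐ x ∂jacobiMeasure α β,
      (∀ t : ℝ, 0 < t → DifferentiableAt ℝ (fun u => poissonJacobi α β u f x) t) ∧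
      (∀ a b : ℝ, 0 < a → a ≤ b →
        IntervalIntegrable (fun t => jacobiQ α β t f x / t) volume a b) ∧
      Tendsto (fun p : ℝ × ℝ => ∫ t in p.1..p.2, jacobiQ α β t f x / t)
        (𝓝[>] (0 : ℝ) ×ˢ atTop) (𝓝 (f x))) ∧
    Tendsto (fun p : ℝ × ℝ =>
        eLpNorm (fun x => (∫ t in p.1..p.2, jacobiQ α β t f x / t) - f x) 1 (jacobiMeasure α β))
      (𝓝[>] (0 : ℝ) ×ˢ atTop) (𝓝 0) := by
  have hfg := hf.1.ae_eq_mk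
  obtain ⟨h1, h2⟩ := calderon_reproducing_of_stronglyMeasurable hα hβ hf.1.stronglyMeasurable_mk
    (hf.congr hfg) ((integral_congr_ae hfg).symm.trans h0)
  simp only [poissonJacobi_congr_ae hfg, jacobiQ_congr_ae hfg]
  constructor
  · filter_upwards [h1, hfg] with x hx hfx
    rw [hfx]
    exact hx
  · refine h2.congr fun p => eLpNorm_congr_ae ?_
    filter_upwards [hfg] with x hfx
    rw [hfx]

theorem hasDerivAt_jacobiExpand_exp (F : Finset (Fin d → ℕ)) (c : (Fin d → ℕ) → ℝ)
    (x : Fin d → ℝ) (u : ℝ) :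
    HasDerivAt (fun v => jacobiExpand α β F
        (fun κ => c κ * Real.exp (-(√(jacobiEigenvalue α β κ) * v))) x)
      (jacobiExpand α β F (fun κ => c κ * -√(jacobiEigenvalue α β κ) *
        Real.exp (-(√(jacobiEigenvalue α β κ) * u))) x) u := by
  unfold jacobiExpand
  refine HasDerivAt.fun_sum fun κ _ => HasDerivAt.mul_const ?_ _
  have h := (((hasDerivAt_id u).const_mul √(jacobiEigenvalue α β κ)).fun_neg.exp).const_mul (c κ)
  refine h.congr_deriv ?_
  simp only [id_eq]
  ring

theorem poissonJacobi_eventuallyEq (hα : ∀ i, -(1 / 2 : ℝ) < α i)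
    (hβ : ∀ i, -(1 / 2 : ℝ) < β i) {f : (Fin d → ℝ) → ℝ} {F : Finset (Fin d → ℕ)}
    {c : (Fin d → ℕ) → ℝ} (hf : f =ᵐ[jacobiMeasure α β] jacobiExpand α β F c) {t : ℝ} (ht : 0 < t)
    {x : Fin d → ℝ} (hx : x ∈ Icc (-1 : Fin d → ℝ) 1) :
    (fun u => poissonJacobi α β u f x) =ᶠ[𝓝 t] fun u =>
      jacobiExpand α β F (fun κ => c κ * Real.exp (-(√(jacobiEigenvalue α β κ) * u))) x := by
  filter_upwards [Ioi_mem_nhds ht] with u hu using poissonJacobi_of_ae_eq_expand hα hβ hf hu hx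

theorem jacobiQ_of_ae_eq_expand (hα : ∀ i, -(1 / 2 : ℝ) < α i)
    (hβ : ∀ i, -(1 / 2 : ℝ) < β i) {f : (Fin d → ℝ) → ℝ} {F : Finset (Fin d → ℕ)}
    {c : (Fin d → ℕ) → ℝ} (hf : f =ᵐ[jacobiMeasure α β] jacobiExpand α β F c) {t : ℝ} (ht : 0 < t)
    {x : Fin d → ℝ} (hx : x ∈ Icc (-1 : Fin d → ℝ) 1) :
    jacobiQ α β t f x = jacobiExpand α β F (fun κ => c κ * (t * (√(jacobiEigenvalue α β κ) *
      Real.exp (-(√(jacobiEigenvalue α β κ) * t))))) x := by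
  rw [jacobiQ, (poissonJacobi_eventuallyEq hα hβ hf ht hx).deriv_eq,
    (hasDerivAt_jacobiExpand_exp F c x t).deriv, jacobiExpand, jacobiExpand, Finset.mul_sum]
  exact Finset.sum_congr rfl fun κ _ => by ring

theorem contDiffAt_poissonJacobi (hα : ∀ i, -(1 / 2 : ℝ) < α i)
    (hβ : ∀ i, -(1 / 2 : ℝ) < β i) {f : (Fin d → ℝ) → ℝ} {F : Finset (Fin d → ℕ)}
    {c : (Fin d → ℕ) → ℝ} (hf : f =ᵐ[jacobiMeasure α β] jacobiExpand α β F c) {t : ℝ} (ht : 0 < t)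
    {x : Fin d → ℝ} (hx : x ∈ Icc (-1 : Fin d → ℝ) 1) :
    ContDiffAt ℝ 2 (fun u => poissonJacobi α β u f x) t := by
  refine ContDiffAt.congr_of_eventuallyEq ?_ (poissonJacobi_eventuallyEq hα hβ hf ht hx)
  unfold jacobiExpand
  fun_prop

theorem iteratedDeriv_two_poissonJacobi (hα : ∀ i, -(1 / 2 : ℝ) < α i)
    (hβ : ∀ i, -(1 / 2 : ℝ) < β i) {f : (Fin d → ℝ) → ℝ} {F : Finset (Fin d → ℕ)}
    {c : (Fin d → ℕ) → ℝ} (hf : f =ᵐ[jacobiMeasure α β] jacobiExpand α β F c) {t : ℝ} (ht : 0 < t)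
    {x : Fin d → ℝ} (hx : x ∈ Icc (-1 : Fin d → ℝ) 1) :
    iteratedDeriv 2 (fun u => poissonJacobi α β u f x) t =
      jacobiExpand α β F (fun κ => c κ * -√(jacobiEigenvalue α β κ) *
        -√(jacobiEigenvalue α β κ) * Real.exp (-(√(jacobiEigenvalue α β κ) * t))) x := by
  rw [(poissonJacobi_eventuallyEq hα hβ hf ht hx).iteratedDeriv_eq, iteratedDeriv_succ,
    iteratedDeriv_one,
    show deriv _ = _ from funext fun u => (hasDerivAt_jacobiExpand_exp F c x u).deriv]
  exact (hasDerivAt_jacobiExpand_exp F _ x t).deriv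

theorem integrableOn_rpow_mul_mul_exp_neg {a m : ℝ} (ha : -1 < a) (hm : 0 < m) :
    IntegrableOn (fun t : ℝ => t ^ a * (m * Real.exp (-(m * t)))) (Ioi 0) := by
  have h := (integrableOn_rpow_mul_exp_neg_mul_rpow ha one_pos hm).const_mul m
  simp only [Real.rpow_one, neg_mul] at h
  exact h.congr (ae_of_all _ fun t => by ring)

/-- One Gamma integral serves all of part (ii), with exponents `-γ`, `γ` and `1`. -/
theorem integral_rpow_mul_mul_exp_neg {a m : ℝ} (ha : -1 < a) (hm : 0 < m) :
    ∫ t in Ioi (0 : ℝ), t ^ a * (m * Real.exp (-(m * t))) = m ^ (-a) * Real.Gamma (1 + a) := by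
  have h := Real.integral_rpow_mul_exp_neg_mul_Ioi (a := 1 + a) (by linarith) hm
  simp only [add_sub_cancel_left] at h
  calc _ = m * ∫ t in Ioi (0 : ℝ), t ^ a * Real.exp (-(m * t)) := by
        rw [← integral_const_mul]
        exact integral_congr_ae (ae_of_all _ fun t => by ring)
    _ = _ := by
        rw [h, one_div, Real.inv_rpow hm.le, ← Real.rpow_neg hm.le, ← mul_assoc]
        congr 1
        nth_rewrite 1 [← Real.rpow_one m]
        rw [← Real.rpow_add hm]
        ring_nf

theorem exists_jacobiExpand_of_integral_eq_zero (hα : ∀ i, -(1 / 2 : ℝ) < α i)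
    (hβ : ∀ i, -(1 / 2 : ℝ) < β i) {q : MvPolynomial (Fin d) ℝ}
    (h0 : ∫ y, MvPolynomial.eval y q ∂jacobiMeasure α β = 0) :
    ∃ (F : Finset (Fin d → ℕ)) (c : (Fin d → ℕ) → ℝ), 0 ∉ F ∧
      ∀ x, MvPolynomial.eval x q = jacobiExpand α β F c x := by
  classical
  obtain ⟨F, c, h⟩ := exists_jacobiExpand hα hβ q
  refine ⟨F.erase 0, c, Finset.notMem_erase _ _, fun x => ?_⟩
  rw [h]
  by_cases hF : (0 : Fin d → ℕ) ∈ F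
  · have hc : c 0 = 0 := by
      have h1 := integral_jacobiExpand_mul hα hβ F c 0
      rw [if_pos hF] at h1
      rw [← h1]
      exact integral_mul_jacobiPoly_zero (by simpa only [h] using h0)
    rw [jacobiExpand, jacobiExpand, ← Finset.add_sum_erase _ _ hF, hc]
    simp
  · rw [Finset.erase_eq_of_notMem hF]

section Expansion

variable {f : (Fin d → ℝ) → ℝ} {F : Finset (Fin d → ℕ)} {c : (Fin d → ℕ) → ℝ} {x : Fin d → ℝ}

/-- The factors `s` and `t` produced by the two operators cancel against the divisions, and on each
mode the integrand separates into a function of `t` times a function of `s`. -/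
theorem jacobiQ_jacobiQ_of_eq_expand (hα : ∀ i, -(1 / 2 : ℝ) < α i)
    (hβ : ∀ i, -(1 / 2 : ℝ) < β i) (hf : ∀ y, f y = jacobiExpand α β F c y)
    (hx : x ∈ Icc (-1 : Fin d → ℝ) 1) {s t : ℝ} (hs : 0 < s) (ht : 0 < t) (γ : ℝ) :
    t ^ (-γ) * s ^ γ * jacobiQ α β t (jacobiQ α β s f) x / s / t =
      ∑ κ ∈ F, c κ * jacobiPoly α β κ x *
        ((t ^ (-γ) * (√(jacobiEigenvalue α β κ) * Real.exp (-(√(jacobiEigenvalue α β κ) * t)))) *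
        (s ^ γ * (√(jacobiEigenvalue α β κ) *
          Real.exp (-(√(jacobiEigenvalue α β κ) * s))))) := by
  have hQ : jacobiQ α β s f =ᵐ[jacobiMeasure α β] jacobiExpand α β F fun κ =>
      c κ * (s * (√(jacobiEigenvalue α β κ) * Real.exp (-(√(jacobiEigenvalue α β κ) * s)))) := by
    filter_upwards [ae_mem_jacobiMeasure hα hβ] with y hy
    exact jacobiQ_of_ae_eq_expand hα hβ (ae_of_all _ hf) hs hy
  rw [jacobiQ_of_ae_eq_expand hα hβ hQ ht hx, jacobiExpand, Finset.mul_sum, Finset.sum_div,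
    Finset.sum_div]
  refine Finset.sum_congr rfl fun κ _ => ?_
  field_simp

theorem sqrt_jacobiEigenvalue_pos (hα : ∀ i, -(1 / 2 : ℝ) < α i) (hβ : ∀ i, -(1 / 2 : ℝ) < β i)
    (hF : 0 ∉ F) {κ : Fin d → ℕ} (hκ : κ ∈ F) : 0 < √(jacobiEigenvalue α β κ) :=
  Real.sqrt_pos.mpr (jacobiEigenvalue_pos hα hβ fun h => hF (h ▸ hκ))

theorem integrableOn_jacobiQ_jacobiQ (hα : ∀ i, -(1 / 2 : ℝ) < α i)
    (hβ : ∀ i, -(1 / 2 : ℝ) < β i) (hf : ∀ y, f y = jacobiExpand α β F c y) (hF : 0 ∉ F)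
    (hx : x ∈ Icc (-1 : Fin d → ℝ) 1) {γ : ℝ} (hγ0 : 0 < γ) (hγ1 : γ < 1) :
    IntegrableOn
      (fun p : ℝ × ℝ => p.1 ^ (-γ) * p.2 ^ γ *
        jacobiQ α β p.1 (jacobiQ α β p.2 f) x / p.2 / p.1) (Ioi 0 ×ˢ Ioi 0) := by
  refine IntegrableOn.congr_fun ?_
    (fun p hp => (jacobiQ_jacobiQ_of_eq_expand hα hβ hf hx hp.2 hp.1 γ).symm)
    (measurableSet_Ioi.prod measurableSet_Ioi)
  rw [IntegrableOn, Measure.volume_eq_prod, ← Measure.prod_restrict]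
  refine integrable_finsetSum _ fun κ hκ => Integrable.const_mul ?_ _
  have hm := sqrt_jacobiEigenvalue_pos hα hβ hF hκ
  exact (integrableOn_rpow_mul_mul_exp_neg (by linarith) hm).mul_prod
    (integrableOn_rpow_mul_mul_exp_neg (by linarith) hm)

/-- The opposite powers `m^(-γ)` and `m^γ` from the two integrations cancel, so every mode acquires
the same constant and the sum reassembles `f`. -/
theorem integral_integral_jacobiQ_jacobiQ (hα : ∀ i, -(1 / 2 : ℝ) < α i)
    (hβ : ∀ i, -(1 / 2 : ℝ) < β i) (hf : ∀ y, f y = jacobiExpand α β F c y) (hF : 0 ∉ F)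
    (hx : x ∈ Icc (-1 : Fin d → ℝ) 1) {γ : ℝ} (hγ0 : 0 < γ) (hγ1 : γ < 1) :
    ∫ t in Ioi (0 : ℝ), ∫ s in Ioi (0 : ℝ),
      t ^ (-γ) * s ^ γ * jacobiQ α β t (jacobiQ α β s f) x / s / t =
      Real.Gamma (1 - γ) * Real.Gamma (1 + γ) * f x := by
  set m : (Fin d → ℕ) → ℝ := fun κ => √(jacobiEigenvalue α β κ)
  have hm : ∀ κ ∈ F, 0 < m κ := fun κ hκ => sqrt_jacobiEigenvalue_pos hα hβ hF hκ
  have h1 : ∀ t ∈ Ioi (0 : ℝ), ∫ s in Ioi (0 : ℝ),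
      t ^ (-γ) * s ^ γ * jacobiQ α β t (jacobiQ α β s f) x / s / t =
      ∑ κ ∈ F, c κ * jacobiPoly α β κ x * (m κ ^ (-γ) * Real.Gamma (1 + γ)) *
        (t ^ (-γ) * (m κ * Real.exp (-(m κ * t)))) := by
    intro t ht
    rw [setIntegral_congr_fun measurableSet_Ioi
      fun s hs => jacobiQ_jacobiQ_of_eq_expand hα hβ hf hx hs ht γ,
      integral_finsetSum _ fun κ hκ => ((integrableOn_rpow_mul_mul_exp_neg (by linarith)
        (hm κ hκ)).const_mul _).const_mul _]
    refine Finset.sum_congr rfl fun κ hκ => ?_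
    rw [integral_const_mul, integral_const_mul,
      integral_rpow_mul_mul_exp_neg (by linarith) (hm κ hκ)]
    ring
  rw [setIntegral_congr_fun measurableSet_Ioi h1, integral_finsetSum _ fun κ hκ =>
    (integrableOn_rpow_mul_mul_exp_neg (by linarith) (hm κ hκ)).const_mul _, hf, jacobiExpand,
    Finset.mul_sum]
  refine Finset.sum_congr rfl fun κ hκ => ?_
  have hone : m κ ^ (-γ) * m κ ^ γ = 1 := by
    rw [← Real.rpow_add (hm κ hκ), neg_add_cancel, Real.rpow_zero]
  rw [integral_const_mul, integral_rpow_mul_mul_exp_neg (by linarith) (hm κ hκ), neg_neg,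
    ← sub_eq_add_neg]
  linear_combination (c κ * jacobiPoly α β κ x * Real.Gamma (1 + γ) * Real.Gamma (1 - γ)) * hone

theorem mul_iteratedDeriv_two_poissonJacobi (hα : ∀ i, -(1 / 2 : ℝ) < α i)
    (hβ : ∀ i, -(1 / 2 : ℝ) < β i) (hf : ∀ y, f y = jacobiExpand α β F c y)
    (hx : x ∈ Icc (-1 : Fin d → ℝ) 1) {u : ℝ} (hu : 0 < u) :
    u * iteratedDeriv 2 (fun v => poissonJacobi α β v f x) u =
      ∑ κ ∈ F, c κ * jacobiPoly α β κ x * √(jacobiEigenvalue α β κ) *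
        (u ^ (1 : ℝ) * (√(jacobiEigenvalue α β κ) *
          Real.exp (-(√(jacobiEigenvalue α β κ) * u)))) := by
  rw [iteratedDeriv_two_poissonJacobi hα hβ (ae_of_all _ hf) hu hx, jacobiExpand, Finset.mul_sum]
  refine Finset.sum_congr rfl fun κ _ => ?_
  rw [Real.rpow_one]
  ring

theorem integrableOn_mul_iteratedDeriv_two_poissonJacobi (hα : ∀ i, -(1 / 2 : ℝ) < α i)
    (hβ : ∀ i, -(1 / 2 : ℝ) < β i) (hf : ∀ y, f y = jacobiExpand α β F c y) (hF : 0 ∉ F)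
    (hx : x ∈ Icc (-1 : Fin d → ℝ) 1) :
    IntegrableOn (fun u => u * iteratedDeriv 2 (fun v => poissonJacobi α β v f x) u) (Ioi 0) := by
  refine IntegrableOn.congr_fun ?_
    (fun u hu => (mul_iteratedDeriv_two_poissonJacobi hα hβ hf hx hu).symm) measurableSet_Ioi
  exact integrable_finsetSum _ fun κ hκ => (integrableOn_rpow_mul_mul_exp_neg (by norm_num)
    (sqrt_jacobiEigenvalue_pos hα hβ hF hκ)).const_mul _

theorem integral_mul_iteratedDeriv_two_poissonJacobi (hα : ∀ i, -(1 / 2 : ℝ) < α i)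
    (hβ : ∀ i, -(1 / 2 : ℝ) < β i) (hf : ∀ y, f y = jacobiExpand α β F c y) (hF : 0 ∉ F)
    (hx : x ∈ Icc (-1 : Fin d → ℝ) 1) :
    ∫ u in Ioi (0 : ℝ), u * iteratedDeriv 2 (fun v => poissonJacobi α β v f x) u = f x := by
  have hm := fun κ hκ => sqrt_jacobiEigenvalue_pos hα hβ hF (κ := κ) hκ
  rw [setIntegral_congr_fun measurableSet_Ioi
    fun u hu => mul_iteratedDeriv_two_poissonJacobi hα hβ hf hx hu, integral_finsetSum _ fun κ hκ =>
    (integrableOn_rpow_mul_mul_exp_neg (by norm_num) (hm κ hκ)).const_mul _, hf, jacobiExpand]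
  refine Finset.sum_congr rfl fun κ hκ => ?_
  have hne := (hm κ hκ).ne'
  rw [integral_const_mul, integral_rpow_mul_mul_exp_neg (by norm_num) (hm κ hκ), one_add_one_eq_two,
    Real.Gamma_two, Real.rpow_neg_one]
  field_simp

end Expansion

end CalderonFormulas

end

theorem mainTheorem7 {d : ℕ} (α β : Fin d → ℝ)
    (hα : ∀ i, -(1 / 2 : ℝ) < α i) (hβ : ∀ i, -(1 / 2 : ℝ) < β i) :
    -- (i): the improper integral of `Q_t f / t` exists and equals `f`, in `L¹` and a.e.
    (∀ f : (Fin d → ℝ) → ℝ, Integrable f (jacobiMeasure α β) →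
      ∫ y, f y ∂jacobiMeasure α β = 0 →
      (∀ᵐ x ∂jacobiMeasure α β,
        (∀ t : ℝ, 0 < t → DifferentiableAt ℝ (fun u => poissonJacobi α β u f x) t) ∧
        (∀ a b : ℝ, 0 < a → a ≤ b →
          IntervalIntegrable (fun t => jacobiQ α β t f x / t) volume a b) ∧
        Tendsto (fun p : ℝ × ℝ => ∫ t in p.1..p.2, jacobiQ α β t f x / t)
          (𝓝[>] (0 : ℝ) ×ˢ atTop) (𝓝 (f x))) ∧
      Tendsto (fun p : ℝ × ℝ =>
          eLpNorm (fun x => (∫ t in p.1..p.2, jacobiQ α β t f x / t) - f x) 1 (jacobiMeasure α β))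
        (𝓝[>] (0 : ℝ) ×ˢ atTop) (𝓝 0)) ∧
    -- (ii): mean-zero polynomials
    (∀ q : MvPolynomial (Fin d) ℝ,
      ∫ y, MvPolynomial.eval y q ∂jacobiMeasure α β = 0 →
      ∀ x ∈ Icc (-1 : Fin d → ℝ) 1,
        (∀ u : ℝ, 0 < u →
          ContDiffAt ℝ 2 (fun v => poissonJacobi α β v (fun y => MvPolynomial.eval y q) x) u) ∧
        (∀ s t : ℝ, 0 < s → 0 < t →
          DifferentiableAt ℝ (fun v => poissonJacobi α β v
            (jacobiQ α β s fun y => MvPolynomial.eval y q) x) t) ∧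
        IntegrableOn
          (fun u => u *
            iteratedDeriv 2 (fun v => poissonJacobi α β v (fun y => MvPolynomial.eval y q) x) u)
          (Ioi 0) ∧
        ∀ γ : ℝ, 0 < γ → γ < 1 →
          IntegrableOn
            (fun p : ℝ × ℝ => p.1 ^ (-γ) * p.2 ^ γ *
              jacobiQ α β p.1 (jacobiQ α β p.2 fun y => MvPolynomial.eval y q) x / p.2 / p.1)
            (Ioi 0 ×ˢ Ioi 0) ∧
          MvPolynomial.eval x q =
            calderonConst γ * ∫ t in Ioi (0 : ℝ), ∫ s in Ioi (0 : ℝ),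
              t ^ (-γ) * s ^ γ *
                jacobiQ α β t (jacobiQ α β s fun y => MvPolynomial.eval y q) x / s / t ∧
          (calderonConst γ * ∫ t in Ioi (0 : ℝ), ∫ s in Ioi (0 : ℝ),
              t ^ (-γ) * s ^ γ *
                jacobiQ α β t (jacobiQ α β s fun y => MvPolynomial.eval y q) x / s / t) =
            ∫ u in Ioi (0 : ℝ), u *
              iteratedDeriv 2 (fun v => poissonJacobi α β v (fun y => MvPolynomial.eval y q) x) u) := by
  refine ⟨fun f hf h0 => calderon_reproducing hα hβ hf h0, fun q h0 x hx => ?_⟩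
  obtain ⟨F, c, hF, hq⟩ := exists_jacobiExpand_of_integral_eq_zero hα hβ h0
  refine ⟨fun u hu => contDiffAt_poissonJacobi hα hβ (ae_of_all _ hq) hu hx,
    fun s t hs ht => ?_, integrableOn_mul_iteratedDeriv_two_poissonJacobi hα hβ hq hF hx,
    fun γ hγ0 hγ1 => ?_⟩
  -- `Q_s` of the polynomial agrees on the cube with an expansion over the same modes, whose
  -- coefficients are those given by `jacobiQ_of_ae_eq_expand`.
  · refine (contDiffAt_poissonJacobi hα hβ (F := F) (c := fun κ => c κ *
      (s * (√(jacobiEigenvalue α β κ) * Real.exp (-(√(jacobiEigenvalue α β κ) * s)))))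
      ?_ ht hx).differentiableAt (by simp)
    filter_upwards [ae_mem_jacobiMeasure hα hβ] with y hy
    exact jacobiQ_of_ae_eq_expand hα hβ (ae_of_all _ hq) hs hy
  · have h1 := integral_integral_jacobiQ_jacobiQ hα hβ hq hF hx hγ0 hγ1
    have h2 := calderonConst_mul hγ0 hγ1
    rw [h1, integral_mul_iteratedDeriv_two_poissonJacobi hα hβ hq hF hx, ← mul_assoc, h2, one_mul]
    exact ⟨integrableOn_jacobiQ_jacobiQ hα hβ hq hF hx hγ0 hγ1, rfl, rfl⟩
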